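/- Let $V$, $U$, $W$ be finite-dimensional superspaces ($\mathbb Z/2$-graded vector spaces) over $\mathbb C$ of dimensions $(n|m)$, $(k|l)$ and $(p|q)$, and write $|x|\in\{0,1\}$ for the parity of a homogeneous element $x$. Put $R_V=\{1,\dots,n;\bar 1,\dots,\bar m\}$, $R_U=\{1,\dots,k;\bar 1,\dots,\bar l\}$, $R_W=\{1,\dots,p;\bar 1,\dots,\bar q\}$, and let $\{e_i\}_{i\in R_V}$, $\{u_r\}_{r\in R_U}$, $\{w_s\}_{s\in R_W}$ be homogeneous bases of $V$, $U$, $W$, where unbarred indices label even vectors and barred indices label odd ones. Let $\{e_i^*\}$ be the dual basis of $V^*$, $e_i^*(e_j)=\delta_{ij}$. Let $\mathfrak A^{p,q}_{k,l}=S^{\bullet}(U\otimes V\oplus V^*\otimes W)$ be the symmetric algebra of the superspace $U\otimes V\oplus V^*\otimes W$, i.e. the free supercommutative superalgebra on it (the quotient of the tensor algebra by the relations $xy=(-1)^{|x||y|}yx$ for homogeneous $x,y$). The Lie superalgebra $\mathfrak{gl}(V)$ acts on it by superderivations extending $$X(u\otimes v)=(-1)^{|X||u|}\,u\otimes Xv,\qquad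 X(f\otimes w)=Xf\otimes w,\qquad (Xf)(v)=-(-1)^{|X||f|}f(Xv)$$ for homogeneous $X\in\mathfrak{gl}(V)$, $u\in U$, $f\in V^*$, and all $v\in V$, $w\in W$. An element of $\mathfrak A^{p,q}_{k,l}$ is called $\mathfrak{gl}(V)$-invariant if it is annihilated by all even and all odd $X\in\mathfrak{gl}(V)$. **Theorem 2.1** (first fundamental theorem for $\mathfrak{gl}(V)$). The $\mathfrak{gl}(V)$-invariant elements form a subalgebra of $\mathfrak A^{p,q}_{k,l}$, and this subalgebra is generated, as a unital $\mathbb C$-algebra, by the scalar products $$(v_r^*,v_s)=\sum_{i\in R_V}(u_r\otimes e_i)(e_i^*\otimes w_s),\qquad r\in R_U,\ s\in R_W.$$ -/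

import Mathlib

open scoped TensorProduct

noncomputable section

namespace SuperFFT

/-- A superspace over `ℂ`: a complex vector space with a `ℤ/2`-grading `V = V₀ ⊕ V₁`;
`part c` is the space of homogeneous elements of parity `c`. -/
class Superspace (V : Type*) [AddCommGroup V] [Module ℂ V] where
  part : ZMod 2 → Submodule ℂ V
  isCompl : IsCompl (part 0) (part 1)

open Superspace

/-- The sign `(-1) ^ (a * b)` of the sign rule. -/
def sgn (a b : ZMod 2) : ℂ := (-1) ^ (a.val * b.val)

theorem zmod_two_cases (a : ZMod 2) : a = 0 ∨ a = 1 := by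
  fin_cases a
  · exact Or.inl rfl
  · exact Or.inr rfl

@[simp] theorem sgn_zero_left (b : ZMod 2) : sgn 0 b = 1 := by simp [sgn]

@[simp] theorem sgn_zero_right (b : ZMod 2) : sgn b 0 = 1 := by simp [sgn]

@[simp] theorem sgn_one_one : sgn 1 1 = -1 := by
  have h : (1 : ZMod 2).val = 1 := rfl
  simp [sgn, h]

theorem one_add_one : (1 : ZMod 2) + 1 = 0 := rfl

theorem sgn_add_left (a b c : ZMod 2) : sgn (a + b) c = sgn a c * sgn b c := by
  rcases zmod_two_cases a with rfl | rfl <;> rcases zmod_two_cases b with rfl | rfl <;>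
    rcases zmod_two_cases c with rfl | rfl <;> simp [one_add_one]

/-- A basis in the standard format: the even vectors come first, followed by the odd ones.
A superspace that has one indexed by `Fin n ⊕ Fin m` has dimension `(n|m)`. -/
def IsStandardFormat {V : Type*} [AddCommGroup V] [Module ℂ V] [Superspace V] {n m : ℕ}
    (e : Module.Basis (Fin n ⊕ Fin m) ℂ V) : Prop :=
  (∀ i : Fin n, e (Sum.inl i) ∈ part (V := V) 0) ∧ ∀ j : Fin m, e (Sum.inr j) ∈ part (V := V) 1

theorem isCompl_of_sign {V : Type*} [AddCommGroup V] [Module ℂ V] {P Q : Submodule ℂ V}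
    (T : V →ₗ[ℂ] V) (hP : ∀ x ∈ P, T x = x) (hQ : ∀ x ∈ Q, T x = -x)
    (h : ∀ v, ∃ x ∈ P, ∃ y ∈ Q, x + y = v) : IsCompl P Q := by
  refine ⟨Submodule.disjoint_def.2 fun x hx hy => ?_, codisjoint_iff.2 ?_⟩
  · have h2 := (hP x hx).symm.trans (hQ x hy)
    have h3 : (2 : ℂ) • x = 0 := by
      rw [two_smul]
      exact eq_neg_iff_add_eq_zero.1 h2
    exact (smul_eq_zero.1 h3).resolve_left two_ne_zero
  · exact (Submodule.eq_top_iff').2 fun v => Submodule.mem_sup.2 (h v)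

section Twist

variable {V : Type*} [AddCommGroup V] [Module ℂ V] [Superspace V]

theorem exists_add (v : V) : ∃ x ∈ part (V := V) 0, ∃ y ∈ part (V := V) 1, x + y = v := by
  have h : v ∈ part (V := V) 0 ⊔ part 1 := by
    rw [(isCompl (V := V)).sup_eq_top]
    trivial
  exact Submodule.mem_sup.1 h

/-- The projection of a superspace to its homogeneous component of parity `c`. -/
def component (c : ZMod 2) : V →ₗ[ℂ] V :=
  if c = 0 then (part 0).projection (part 1) isCompl
  else (part 1).projection (part 0) isCompl.symm

variable (V) in
/-- The operator that multiplies each homogeneous vector `v` by `(-1) ^ (c * p(v))`. -/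
def twist (c : ZMod 2) : V →ₗ[ℂ] V := component 0 + sgn c 1 • component 1

theorem component_mem (c : ZMod 2) (v : V) : component c v ∈ part (V := V) c := by
  rcases zmod_two_cases c with rfl | rfl
  · simp [component]
  · simp [component]

theorem component_add (v : V) : component 0 v + component 1 v = v := by
  simpa [component] using Submodule.projection_add_projection_eq_self (isCompl (V := V)) v

theorem component_of_mem {a : ZMod 2} {v : V} (hv : v ∈ part (V := V) a) : component a v = v := by
  rcases zmod_two_cases a with rfl | rfl
  · simpa [component] using Submodule.projection_apply_of_mem_left (isCompl (V := V)) hv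
  · simpa [component] using Submodule.projection_apply_of_mem_left (isCompl (V := V)).symm hv

theorem component_of_mem' {a : ZMod 2} {v : V} (hv : v ∈ part (V := V) a) :
    component (a + 1) v = 0 := by
  rcases zmod_two_cases a with rfl | rfl
  · simpa [component] using (Submodule.projection_apply_eq_zero_iff (isCompl (V := V)).symm).2 hv
  · simpa [component, one_add_one] using
      (Submodule.projection_apply_eq_zero_iff (isCompl (V := V))).2 hv

theorem twist_of_mem {a : ZMod 2} (c : ZMod 2) {v : V} (hv : v ∈ part (V := V) a) :
    twist V c v = sgn c a • v := by
  have h0 := component_of_mem hv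
  have h1 := component_of_mem' hv
  rcases zmod_two_cases a with rfl | rfl
  · rw [zero_add] at h1
    simp [twist, h0, h1]
  · rw [one_add_one] at h1
    simp [twist, h0, h1]

theorem twist_mem {a : ZMod 2} (c : ZMod 2) {v : V} (hv : v ∈ part (V := V) a) :
    twist V c v ∈ part (V := V) a := by
  rw [twist_of_mem c hv]
  exact Submodule.smul_mem _ _ hv

end Twist

section Instances

variable {V W : Type*} [AddCommGroup V] [Module ℂ V] [Superspace V]
  [AddCommGroup W] [Module ℂ W] [Superspace W]

/-- The ground field is purely even. -/
instance : Superspace ℂ where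
  part c := if c = 0 then ⊤ else ⊥
  isCompl := by simpa using isCompl_top_bot

/-- The direct sum of two superspaces. -/
instance : Superspace (V × W) where
  part c := (part (V := V) c).prod (part (V := W) c)
  isCompl := ⟨by
      rw [Submodule.disjoint_def]
      rintro ⟨x, y⟩ ⟨hx, hy⟩ ⟨hx', hy'⟩
      exact Prod.ext (Submodule.disjoint_def.1 isCompl.disjoint x hx hx')
        (Submodule.disjoint_def.1 isCompl.disjoint y hy hy'), by
      rw [codisjoint_iff, Submodule.prod_sup_prod, isCompl.sup_eq_top, isCompl.sup_eq_top,
        Submodule.prod_top]⟩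

/-- The parity of the linear maps between superspaces: `f` has parity `c` if it sends `V_a` to
`W_{a + c}`. The cases `W = V` and `W = ℂ` are `gl(V)` and the dual superspace `V*`. -/
instance instHom : Superspace (V →ₗ[ℂ] W) where
  part c :=
    { carrier := {f | ∀ a : ZMod 2, ∀ v ∈ part (V := V) a, f v ∈ part (V := W) (a + c)}
      add_mem' := fun hf hg a v hv => Submodule.add_mem _ (hf a v hv) (hg a v hv)
      zero_mem' := fun a v _ => Submodule.zero_mem _
      smul_mem' := fun t f hf a v hv => Submodule.smul_mem _ t (hf a v hv) }
  isCompl := by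
    have key : ∀ (c d : ZMod 2) (f : V →ₗ[ℂ] W) (a : ZMod 2), ∀ v ∈ part (V := V) a,
        (component (d + c) ∘ₗ f ∘ₗ component d) v ∈ part (V := W) (a + c) := by
      intro c d f a v hv
      by_cases h : d = a
      · subst h
        exact component_mem _ _
      · have hd : d = a + 1 := by
          clear hv v
          revert h
          revert a d
          decide
        have h0 : component d v = 0 := by
          rw [hd]
          exact component_of_mem' hv
        simp [h0]
    refine isCompl_of_sign
      { toFun := fun f => twist W 1 ∘ₗ f ∘ₗ twist V 1
        map_add' := fun f g => by
          ext v
          simp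
        map_smul' := fun t f => by
          ext v
          simp } ?_ ?_ ?_
    · intro f hf
      ext v
      obtain ⟨x, hx, y, hy, rfl⟩ := exists_add v
      have h0 := twist_of_mem 1 (hf 0 x hx)
      have h1 := twist_of_mem 1 (hf 1 y hy)
      simp only [add_zero] at h0 h1
      simp [twist_of_mem 1 hx, twist_of_mem 1 hy, h0, h1]
    · intro f hf
      ext v
      obtain ⟨x, hx, y, hy, rfl⟩ := exists_add v
      have h0 := twist_of_mem 1 (hf 0 x hx)
      have h1 := twist_of_mem 1 (hf 1 y hy)
      simp only [zero_add, one_add_one] at h0 h1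
      simp [twist_of_mem 1 hx, twist_of_mem 1 hy, h0, h1]
      abel
    · intro f
      refine ⟨component 0 ∘ₗ f ∘ₗ component 0 + component 1 ∘ₗ f ∘ₗ component 1, ?_,
        component 1 ∘ₗ f ∘ₗ component 0 + component 0 ∘ₗ f ∘ₗ component 1, ?_, ?_⟩
      · exact fun a v hv => Submodule.add_mem _ (key 0 0 f a v hv) (key 0 1 f a v hv)
      · exact fun a v hv => Submodule.add_mem _ (key 1 0 f a v hv) (key 1 1 f a v hv)
      · ext v
        have h0 := component_add (f (component 0 v))
        have h1 := component_add (f (component 1 v))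
        have h2 : f (component 0 v) + f (component 1 v) = f v := by
          rw [← map_add, component_add]
        simp only [LinearMap.add_apply, LinearMap.comp_apply]
        rw [← h2]
        refine Eq.trans ?_ (congrArg₂ (· + ·) h0 h1)
        abel

/-- The tensor product of two superspaces: `p(v ⊗ w) = p(v) + p(w)`. -/
instance instTensor : Superspace (V ⊗[ℂ] W) where
  part c := Submodule.span ℂ
    {t | ∃ a b : ZMod 2, a + b = c ∧ ∃ v ∈ part (V := V) a, ∃ w ∈ part (V := W) b, v ⊗ₜ[ℂ] w = t}
  isCompl := by
    refine isCompl_of_sign (TensorProduct.map (twist V 1) (twist W 1)) ?_ ?_ ?_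
    · intro t ht
      induction ht using Submodule.span_induction with
      | mem t ht =>
        obtain ⟨a, b, hab, v, hv, w, hw, rfl⟩ := ht
        obtain rfl : a = b := by
          clear hv hw
          revert hab
          revert a b
          decide
        rcases zmod_two_cases a with rfl | rfl <;>
          simp [twist_of_mem 1 hv, twist_of_mem 1 hw, TensorProduct.neg_tmul,
            TensorProduct.tmul_neg]
      | zero => exact map_zero _
      | add x y _ _ hx hy => rw [map_add, hx, hy]
      | smul r x _ hx => rw [map_smul, hx]
    · intro t ht
      induction ht using Submodule.span_induction with
      | mem t ht =>
        obtain ⟨a, b, hab, v, hv, w, hw, rfl⟩ := ht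
        obtain rfl : b = a + 1 := by
          clear hv hw
          revert hab
          revert a b
          decide
        have hw' := twist_of_mem 1 hw
        rcases zmod_two_cases a with rfl | rfl <;>
          simp_all [twist_of_mem 1 hv, TensorProduct.neg_tmul,
            TensorProduct.tmul_neg, one_add_one]
      | zero => simp
      | add x y _ _ hx hy =>
        rw [map_add, hx, hy]
        abel
      | smul r x _ hx => rw [map_smul, hx, smul_neg]
    · intro t
      induction t using TensorProduct.induction_on with
      | zero => exact ⟨0, Submodule.zero_mem _, 0, Submodule.zero_mem _, add_zero 0⟩
      | tmul v w =>
        obtain ⟨v0, hv0, v1, hv1, rfl⟩ := exists_add v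
        obtain ⟨w0, hw0, w1, hw1, rfl⟩ := exists_add w
        refine ⟨v0 ⊗ₜ w0 + v1 ⊗ₜ w1, Submodule.add_mem _ ?_ ?_, v0 ⊗ₜ w1 + v1 ⊗ₜ w0,
          Submodule.add_mem _ ?_ ?_, ?_⟩
        · exact Submodule.subset_span ⟨0, 0, rfl, v0, hv0, w0, hw0, rfl⟩
        · exact Submodule.subset_span ⟨1, 1, rfl, v1, hv1, w1, hw1, rfl⟩
        · exact Submodule.subset_span ⟨0, 1, rfl, v0, hv0, w1, hw1, rfl⟩
        · exact Submodule.subset_span ⟨1, 0, rfl, v1, hv1, w0, hw0, rfl⟩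
        · simp only [TensorProduct.add_tmul, TensorProduct.tmul_add]
          abel
      | add s t hs ht =>
        obtain ⟨x, hx, y, hy, rfl⟩ := hs
        obtain ⟨x', hx', y', hy', rfl⟩ := ht
        exact ⟨x + x', Submodule.add_mem _ hx hx', y + y', Submodule.add_mem _ hy hy', by abel⟩

theorem mem_part_hom {c : ZMod 2} {f : V →ₗ[ℂ] W} : f ∈ part (V := V →ₗ[ℂ] W) c ↔
    ∀ a : ZMod 2, ∀ v ∈ part (V := V) a, f v ∈ part (V := W) (a + c) := Iff.rfl

theorem tmul_mem_part {a b : ZMod 2} {v : V} {w : W} (hv : v ∈ part (V := V) a)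
    (hw : w ∈ part (V := W) b) : v ⊗ₜ[ℂ] w ∈ part (V := V ⊗[ℂ] W) (a + b) :=
  Submodule.subset_span ⟨a, b, rfl, v, hv, w, hw, rfl⟩

/-- The operators of parity `c` on a superspace `V`. For `c = 0` and `c = 1` these are the even
and the odd part of the Lie superalgebra `gl(V)`. -/
abbrev EndPart (V : Type*) [AddCommGroup V] [Module ℂ V] [Superspace V] (c : ZMod 2) :
    Submodule ℂ (Module.End ℂ V) := part (V := V →ₗ[ℂ] V) c

end Instances

section SymmetricAlgebra

variable (M : Type*) [AddCommGroup M] [Module ℂ M] [Superspace M]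

/-- The relations `x y = (-1) ^ (p(x) p(y)) y x` for homogeneous `x`, `y`. -/
inductive SuperCommRel : TensorAlgebra ℂ M → TensorAlgebra ℂ M → Prop
  | swap {a b : ZMod 2} {x y : M} (hx : x ∈ part (V := M) a) (hy : y ∈ part (V := M) b) :
      SuperCommRel (TensorAlgebra.ι ℂ x * TensorAlgebra.ι ℂ y)
        (sgn a b • (TensorAlgebra.ι ℂ y * TensorAlgebra.ι ℂ x))

/-- The symmetric algebra `S(M)` of a superspace `M`: the free supercommutative
superalgebra on `M`. -/
def SuperSym : Type _ := RingQuot (SuperCommRel M)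

instance : Ring (SuperSym M) := inferInstanceAs (Ring (RingQuot (SuperCommRel M)))

instance : Algebra ℂ (SuperSym M) := inferInstanceAs (Algebra ℂ (RingQuot (SuperCommRel M)))

/-- The quotient map from the tensor algebra onto `S(M)`. -/
def SuperSym.mk : TensorAlgebra ℂ M →ₐ[ℂ] SuperSym M := RingQuot.mkAlgHom ℂ (SuperCommRel M)

end SymmetricAlgebra

namespace SuperSym

variable {M : Type*} [AddCommGroup M] [Module ℂ M] [Superspace M]

/-- The inclusion of `M` into `S(M)`. -/
def ι : M →ₗ[ℂ] SuperSym M :=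
  (mk M).toLinearMap ∘ₗ TensorAlgebra.ι ℂ

theorem ι_mul_ι {a b : ZMod 2} {x y : M} (hx : x ∈ part (V := M) a) (hy : y ∈ part (V := M) b) :
    ι x * ι y = sgn a b • (ι y * ι x) := by
  have h : mk M (TensorAlgebra.ι ℂ x * TensorAlgebra.ι ℂ y) =
      mk M (sgn a b • (TensorAlgebra.ι ℂ y * TensorAlgebra.ι ℂ x)) :=
    RingQuot.mkAlgHom_rel ℂ (SuperCommRel.swap hx hy)
  simpa [ι] using h

/-- The universal property of `S(M)`. -/
def lift {B : Type*} [Ring B] [Algebra ℂ B] (f : M →ₗ[ℂ] B)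
    (hf : ∀ (a b : ZMod 2) (x y : M), x ∈ part (V := M) a → y ∈ part (V := M) b →
      f x * f y = sgn a b • (f y * f x)) : SuperSym M →ₐ[ℂ] B :=
  RingQuot.liftAlgHom ℂ ⟨TensorAlgebra.lift ℂ f, by
    intro s t h
    cases h with
    | swap hx hy => simpa using hf _ _ _ _ hx hy⟩

theorem lift_ι {B : Type*} [Ring B] [Algebra ℂ B] (f : M →ₗ[ℂ] B)
    (hf : ∀ (a b : ZMod 2) (x y : M), x ∈ part (V := M) a → y ∈ part (V := M) b →
      f x * f y = sgn a b • (f y * f x)) (x : M) : lift f hf (ι x) = f x := by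
  change RingQuot.liftAlgHom ℂ _ (RingQuot.mkAlgHom ℂ (SuperCommRel M) (TensorAlgebra.ι ℂ x)) = f x
  rw [RingQuot.liftAlgHom_mkAlgHom_apply, TensorAlgebra.lift_ι_apply]

theorem induction {P : SuperSym M → Prop} (h0 : ∀ r, P (algebraMap ℂ _ r)) (h1 : ∀ x, P (ι x))
    (hm : ∀ a b, P a → P b → P (a * b)) (ha : ∀ a b, P a → P b → P (a + b))
    (s : SuperSym M) : P s := by
  obtain ⟨t, rfl⟩ : ∃ t, mk M t = s := RingQuot.mkAlgHom_surjective ℂ (SuperCommRel M) s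
  induction t using TensorAlgebra.induction with
  | algebraMap r =>
    rw [AlgHom.commutes]
    exact h0 r
  | ι x => exact h1 x
  | mul a b iha ihb =>
    rw [map_mul]
    exact hm _ _ iha ihb
  | add a b iha ihb =>
    rw [map_add]
    exact ha _ _ iha ihb

variable (M) in
/-- The automorphism of `S(M)` that multiplies each homogeneous element `f` by
`(-1) ^ (c * p(f))`. -/
def twistHom (c : ZMod 2) : SuperSym M →ₐ[ℂ] SuperSym M :=
  lift (ι ∘ₗ twist M c) fun a b x y hx hy => by
    simpa using ι_mul_ι (twist_mem c hx) (twist_mem c hy)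

/-- The algebra homomorphism `f ↦ !![(-1) ^ (c * p(f)) f, D f; 0, f]`, where `D` is the
superderivation of parity `c` that extends the operator `T` of parity `c`. -/
def derivHom {c : ZMod 2} (T : EndPart M c) :
    SuperSym M →ₐ[ℂ] Matrix (Fin 2) (Fin 2) (SuperSym M) :=
  lift
    { toFun := fun x => !![ι (twist M c x), ι ((T : Module.End ℂ M) x); 0, ι x]
      map_add' := fun x y => by
        ext i j
        fin_cases i <;> fin_cases j <;> simp
      map_smul' := fun r x => by
        ext i j
        fin_cases i <;> fin_cases j <;> simp }
    fun a b x y hx hy => by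
      have hTx : (T : Module.End ℂ M) x ∈ part (V := M) (a + c) := T.2 a x hx
      have hTy : (T : Module.End ℂ M) y ∈ part (V := M) (b + c) := T.2 b y hy
      have h1 := ι_mul_ι hx hy
      have h2 := ι_mul_ι hTx hy
      have h3 := ι_mul_ι hx hTy
      have e1 : sgn (a + c) b = sgn a b * sgn c b := sgn_add_left a c b
      have e2 : sgn c a * sgn a (b + c) = sgn a b := by
        rcases zmod_two_cases a with rfl | rfl <;> rcases zmod_two_cases b with rfl | rfl <;>
          rcases zmod_two_cases c with rfl | rfl <;> simp [one_add_one]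
      have h4 : ι (twist M c x) * ι (twist M c y) =
          sgn a b • (ι (twist M c y) * ι (twist M c x)) :=
        ι_mul_ι (twist_mem c hx) (twist_mem c hy)
      have h5 : ι (twist M c x) * ι ((T : Module.End ℂ M) y) + ι ((T : Module.End ℂ M) x) * ι y =
          sgn a b • (ι (twist M c y) * ι ((T : Module.End ℂ M) x) +
            ι ((T : Module.End ℂ M) y) * ι x) := by
        rw [twist_of_mem c hx, twist_of_mem c hy, map_smul, map_smul, smul_mul_assoc,
          smul_mul_assoc, h2, h3, smul_smul, e1, e2, smul_add, smul_smul]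
        exact add_comm _ _
      ext i j
      fin_cases i <;> fin_cases j <;> simp [Matrix.mul_apply, Fin.sum_univ_two, h1, h4, h5]

/-- The superderivation of parity `c` of `S(M)` that extends an operator `T` of parity `c`
on `M`. -/
def superDeriv {c : ZMod 2} (T : EndPart M c) : SuperSym M →ₗ[ℂ] SuperSym M where
  toFun f := derivHom T f 0 1
  map_add' f g := by simp
  map_smul' r f := by simp

theorem superDeriv_ι {c : ZMod 2} (T : EndPart M c) (x : M) :
    superDeriv T (ι x) = ι ((T : Module.End ℂ M) x) := by
  simp [superDeriv, derivHom, lift_ι]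

theorem derivHom_apply {c : ZMod 2} (T : EndPart M c) (f : SuperSym M) :
    derivHom T f 0 0 = twistHom M c f ∧ derivHom T f 1 0 = 0 ∧ derivHom T f 1 1 = f := by
  induction f using SuperSym.induction with
  | h0 r => simp [Matrix.algebraMap_matrix_apply]
  | h1 x => simp [derivHom, twistHom, lift_ι]
  | hm a b iha ihb =>
    obtain ⟨a0, a1, a2⟩ := iha
    obtain ⟨b0, b1, b2⟩ := ihb
    simp [Matrix.mul_apply, Fin.sum_univ_two, a0, a1, a2, b0, b1, b2]
  | ha a b iha ihb =>
    obtain ⟨a0, a1, a2⟩ := iha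
    obtain ⟨b0, b1, b2⟩ := ihb
    simp [a0, a1, a2, b0, b1, b2]

theorem superDeriv_algebraMap {c : ZMod 2} (T : EndPart M c) (r : ℂ) :
    superDeriv T (algebraMap ℂ _ r) = 0 := by
  simp [superDeriv, Matrix.algebraMap_matrix_apply]

/-- The super Leibniz rule `D(f g) = D(f) g + (-1) ^ (p(D) p(f)) f D(g)`. -/
theorem superDeriv_mul {c : ZMod 2} (T : EndPart M c) (f g : SuperSym M) :
    superDeriv T (f * g) = superDeriv T f * g + twistHom M c f * superDeriv T g := by
  obtain ⟨h00, -, -⟩ := derivHom_apply T f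
  obtain ⟨-, -, h11⟩ := derivHom_apply T g
  simp only [superDeriv, LinearMap.coe_mk, AddHom.coe_mk, map_mul, Matrix.mul_apply,
    Fin.sum_univ_two, h00, h11]
  abel

/-- The kernel of a superderivation, which is a subalgebra. -/
def derivKer {c : ZMod 2} (T : EndPart M c) : Subalgebra ℂ (SuperSym M) where
  carrier := {f | superDeriv T f = 0}
  algebraMap_mem' r := superDeriv_algebraMap T r
  add_mem' {f g} hf hg := by
    have hf' : superDeriv T f = 0 := hf
    have hg' : superDeriv T g = 0 := hg
    change superDeriv T (f + g) = 0
    rw [map_add, hf', hg', add_zero]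
  mul_mem' {f g} hf hg := by
    have hf' : superDeriv T f = 0 := hf
    have hg' : superDeriv T g = 0 := hg
    change superDeriv T (f * g) = 0
    rw [superDeriv_mul, hf', hg', zero_mul, mul_zero, add_zero]

end SuperSym

section Invariants

variable (U V W : Type*) [AddCommGroup U] [Module ℂ U] [Superspace U]
  [AddCommGroup V] [Module ℂ V] [Superspace V] [AddCommGroup W] [Module ℂ W] [Superspace W]

/-- The superspace `U ⊗ V ⊕ V* ⊗ W`. -/
abbrev Gens : Type _ := (U ⊗[ℂ] V) × (Module.Dual ℂ V ⊗[ℂ] W)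

variable {V} in
/-- The action on `V*` of an element `X` of `gl(V)` of parity `c`:
`(X f)(v) = - (-1) ^ (p(X) p(f)) f (X v)`. -/
def dualAct (c : ZMod 2) (X : Module.End ℂ V) : Module.End ℂ (Module.Dual ℂ V) :=
  -((Module.Dual.transpose X) ∘ₗ twist (Module.Dual ℂ V) c)

variable {V} in
theorem dualAct_mem {a : ZMod 2} (c : ZMod 2) (X : EndPart V c)
    {f : Module.Dual ℂ V} (hf : f ∈ part (V := V →ₗ[ℂ] ℂ) a) :
    dualAct c (X : Module.End ℂ V) f ∈ part (V := V →ₗ[ℂ] ℂ) (a + c) := by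
  have h : dualAct c (X : Module.End ℂ V) f = -(sgn c a • (f ∘ₗ (X : Module.End ℂ V))) := by
    ext v
    have h1 := twist_of_mem (V := V →ₗ[ℂ] ℂ) c hf
    simp [dualAct, h1, Module.Dual.transpose_apply]
  rw [h]
  refine Submodule.neg_mem _ (Submodule.smul_mem _ _ fun b v hv => ?_)
  have h2 := hf _ _ (X.2 b v hv)
  rwa [add_assoc, add_comm c a] at h2

variable {V} in
/-- The action on `U ⊗ V ⊕ V* ⊗ W` of an element `X` of `gl(V)` of parity `c`:
`X (u ⊗ v) = (-1) ^ (p(X) p(u)) u ⊗ X v` and `X (f ⊗ w) = X f ⊗ w`. -/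
def gensAct (c : ZMod 2) (X : Module.End ℂ V) : Module.End ℂ (Gens U V W) :=
  LinearMap.prodMap (TensorProduct.map (twist U c) X)
    (TensorProduct.map (dualAct c X) LinearMap.id)

variable {V} in
theorem gensAct_mem (c : ZMod 2) (X : EndPart V c) :
    gensAct U W c (X : Module.End ℂ V) ∈ EndPart (Gens U V W) c := by
  rintro a ⟨s, t⟩ ⟨hs, ht⟩
  refine ⟨?_, ?_⟩
  · change TensorProduct.map (twist U c) (X : Module.End ℂ V) s ∈ part (V := U ⊗[ℂ] V) (a + c)
    change s ∈ part (V := U ⊗[ℂ] V) a at hs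
    clear ht
    induction hs using Submodule.span_induction with
    | mem s hs =>
      obtain ⟨i, j, rfl, x, hx, y, hy, rfl⟩ := hs
      rw [add_assoc]
      exact tmul_mem_part (twist_mem c hx) (X.2 j y hy)
    | zero =>
      rw [map_zero]
      exact Submodule.zero_mem _
    | add x y _ _ hx hy =>
      rw [map_add]
      exact Submodule.add_mem _ hx hy
    | smul r x _ hx =>
      rw [map_smul]
      exact Submodule.smul_mem _ _ hx
  · change TensorProduct.map (dualAct c (X : Module.End ℂ V)) LinearMap.id t ∈
      part (V := Module.Dual ℂ V ⊗[ℂ] W) (a + c)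
    change t ∈ part (V := Module.Dual ℂ V ⊗[ℂ] W) a at ht
    clear hs
    induction ht using Submodule.span_induction with
    | mem t ht =>
      obtain ⟨i, j, rfl, f, hf, y, hy, rfl⟩ := ht
      rw [add_right_comm]
      exact tmul_mem_part (dualAct_mem c X hf) hy
    | zero =>
      rw [map_zero]
      exact Submodule.zero_mem _
    | add x y _ _ hx hy =>
      rw [map_add]
      exact Submodule.add_mem _ hx hy
    | smul r x _ hx =>
      rw [map_smul]
      exact Submodule.smul_mem _ _ hx

variable {V} in
/-- `gensAct`, as an operator of parity `c`. -/
def glGens (c : ZMod 2) (X : EndPart V c) : EndPart (Gens U V W) c :=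
  ⟨gensAct U W c X, gensAct_mem U W c X⟩

variable {V} in
/-- The action on `S(U ⊗ V ⊕ V* ⊗ W)` of an element `X` of `gl(V)` of parity `c`, by a
superderivation. -/
def glAct (c : ZMod 2) (X : EndPart V c) :
    SuperSym (Gens U V W) →ₗ[ℂ] SuperSym (Gens U V W) :=
  SuperSym.superDeriv (glGens U W c X)

/-- The algebra of `gl(V)`-invariants: the elements of `S(U ⊗ V ⊕ V* ⊗ W)` that all the
homogeneous elements, even and odd, of `gl(V)` send to `0`. -/
def invariants : Subalgebra ℂ (SuperSym (Gens U V W)) where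
  carrier := {f | ∀ (c : ZMod 2) (X : EndPart V c), glAct U W c X f = 0}
  algebraMap_mem' r c X := (SuperSym.derivKer (glGens U W c X)).algebraMap_mem r
  add_mem' hf hg c X := (SuperSym.derivKer (glGens U W c X)).add_mem (hf c X) (hg c X)
  mul_mem' hf hg c X := (SuperSym.derivKer (glGens U W c X)).mul_mem (hf c X) (hg c X)

variable {U V W}

/-- The generator `x_{ri} = u_r ⊗ e_i`. -/
def coordU {k l n m : ℕ} (W : Type*) [AddCommGroup W] [Module ℂ W] [Superspace W]
    (u : Module.Basis (Fin k ⊕ Fin l) ℂ U) (e : Module.Basis (Fin n ⊕ Fin m) ℂ V)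
    (r : Fin k ⊕ Fin l) (i : Fin n ⊕ Fin m) : SuperSym (Gens U V W) :=
  SuperSym.ι ((u r ⊗ₜ[ℂ] e i, 0) : Gens U V W)

/-- The generator `x*_{is} = e_i* ⊗ w_s`, where `e_i*` is the dual basis. -/
def coordW {p q n m : ℕ} (U : Type*) [AddCommGroup U] [Module ℂ U] [Superspace U]
    (e : Module.Basis (Fin n ⊕ Fin m) ℂ V) (w : Module.Basis (Fin p ⊕ Fin q) ℂ W)
    (i : Fin n ⊕ Fin m) (s : Fin p ⊕ Fin q) : SuperSym (Gens U V W) :=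
  SuperSym.ι ((0, e.dualBasis i ⊗ₜ[ℂ] w s) : Gens U V W)

/-- The scalar product `(v_r*, v_s) = ∑ i, x_{ri} x*_{is}`. -/
def scalarProduct {k l n m p q : ℕ} (u : Module.Basis (Fin k ⊕ Fin l) ℂ U)
    (e : Module.Basis (Fin n ⊕ Fin m) ℂ V) (w : Module.Basis (Fin p ⊕ Fin q) ℂ W)
    (r : Fin k ⊕ Fin l) (s : Fin p ⊕ Fin q) : SuperSym (Gens U V W) :=
  ∑ i, coordU W u e r i * coordW U e w i s

end Invariants

end SuperFFT

end

open scoped TensorProduct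

set_option linter.unusedSectionVars false

noncomputable section

namespace SuperFFT

open Superspace

/-! Homogeneous bases identify the algebra with the free supercommutative algebra on the entries of
two generic matrices x and y (`toModel`, `ofModel`), so an element f becomes a function f(X, Y) of
pairs of even matrices over any supercommutative algebra. The scalar products are the entries of xy,
and their invariance is a direct computation (`sum_mul_mem_invariants`).

For the converse, invariance is integrated. Being killed by all even and odd operators means that f
is constant along every path with X' = Xw and Y' = -wY, where w is an even matrix
(`deriv_eval_eq_zero`). The path X(1 + εtz), (1 + εtz)⁻¹(1 + εz)Y, compared at t = 1 and t = 0,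
followed by ε = 1, yields f(Xz, Y) = f(X, zY) for every even z, invertible or not
(`isBalanced_of_mem_invariants`).

It remains to see that a balanced f is a polynomial in xy. Suppose that f is multilinear in N even
rows of x, and that a functional η kills the polynomials in xy. Let z have as its row i the sum of
θ_t x_t over the t with d t = i, the θ_t being auxiliary parameters. Then zy involves x only through
xy, so η kills f(X, zy) = f(Xz, y). The coefficient of θ_1⋯θ_N in the latter gives ∑_σ η(σf) σ⁻¹m =
0 for every multilinear m (`contract_apply`). With m = τf this says that a = ∑ η(σf)σ satisfies a
ℂ[S_N] a = 0; positivity of a*a forces a = 0 (`functional_eq_zero`), hence η(f) = 0. So f is a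
polynomial in xy (`mem_range_of_mem_multSpan`).

Polarization and restitution, with parameters τ_a carrying the parities of the rows, reduce an
arbitrary balanced element to the multilinear case (`restitute_polarize`, `degreePart_self`). -/

theorem sgn_add_right (a b c : ZMod 2) : sgn a (b + c) = sgn a b * sgn a c := by
  rcases zmod_two_cases a with rfl | rfl <;> rcases zmod_two_cases b with rfl | rfl <;>
    rcases zmod_two_cases c with rfl | rfl <;> simp [one_add_one]

theorem sgn_comm (a b : ZMod 2) : sgn a b = sgn b a := by
  rcases zmod_two_cases a with rfl | rfl <;> rcases zmod_two_cases b with rfl | rfl <;> simp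

@[simp] theorem sgn_mul_self (a b : ZMod 2) : sgn a b * sgn a b = 1 := by
  rcases zmod_two_cases a with rfl | rfl <;> rcases zmod_two_cases b with rfl | rfl <;> simp

theorem sgn_ne_zero (a b : ZMod 2) : sgn a b ≠ 0 := by
  intro h
  have := sgn_mul_self a b
  simp [h] at this

@[simp] theorem zmod_two_add_self (a : ZMod 2) : a + a = 0 := by
  rcases zmod_two_cases a with rfl | rfl <;> rfl

/-- The parity `a + c` composed with the parity `c + b` is the parity `a + b`. -/
theorem parity_trans (a b c : ZMod 2) : a + c + (c + b) = a + b := by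
  rw [add_assoc, ← add_assoc c, zmod_two_add_self, zero_add]

/-- Supercommutative algebras over `ℂ`. -/
class SCAlg (B : Type*) [Ring B] [Algebra ℂ B] where
  pt : ZMod 2 → Submodule ℂ B
  one_mem : 1 ∈ pt 0
  mul_mem {a b : ZMod 2} {x y : B} : x ∈ pt a → y ∈ pt b → x * y ∈ pt (a + b)
  comm {a b : ZMod 2} {x y : B} : x ∈ pt a → y ∈ pt b → x * y = sgn a b • (y * x)

open SCAlg

/-! ### Signs in products of homogeneous elements. -/

section Lists

variable {B : Type*} [Ring B] [Algebra ℂ B] [SCAlg B]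

theorem list_prod_mem {κ : Type*} (par : κ → ZMod 2) (g : κ → B)
    (hg : ∀ k, g k ∈ pt (B := B) (par k)) (l : List κ) :
    (l.map g).prod ∈ pt (B := B) (l.map par).sum := by
  induction l with
  | nil => simpa using SCAlg.one_mem
  | cons k l ih => simpa using mul_mem (hg k) ih

/-- Even elements commute with homogeneous ones. -/
theorem even_comm {a : ZMod 2} {x y : B} (hx : x ∈ pt (B := B) 0) (hy : y ∈ pt (B := B) a) :
    x * y = y * x := by
  simpa using comm hx hy

/-- Reordering a product of homogeneous elements changes it by a sign. -/
theorem exists_prod_perm {κ : Type*} (par : κ → ZMod 2) (g : κ → B)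
    (hg : ∀ k, g k ∈ pt (B := B) (par k)) {l l' : List κ} (h : l.Perm l') :
    ∃ c : ℂ, c * c = 1 ∧ (l.map g).prod = c • (l'.map g).prod := by
  induction h with
  | nil => exact ⟨1, by simp⟩
  | cons k _ ih =>
    obtain ⟨c, hc1, hc⟩ := ih
    exact ⟨c, hc1, by simp [hc]⟩
  | swap a b l =>
    refine ⟨sgn (par b) (par a), sgn_mul_self _ _, ?_⟩
    simp only [List.map_cons, List.prod_cons, ← mul_assoc]
    rw [comm (hg b) (hg a), smul_mul_assoc]
  | trans _ _ ih1 ih2 =>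
    obtain ⟨c, hc1, hc⟩ := ih1
    obtain ⟨d, hd1, hd⟩ := ih2
    exact ⟨c * d, by rw [mul_mul_mul_comm, hc1, hd1, one_mul], by rw [hc, hd, smul_smul]⟩

/-- The sign produced when the product of the `θ_b x_b` is rewritten as the product of the `θ_b`
times the product of the `x_b`, in terms of the parities of the `θ_b` and `x_b`. -/
def unzipSign : List (ZMod 2 × ZMod 2) → ℂ
  | [] => 1
  | a :: l => sgn a.2 (l.map Prod.fst).sum * unzipSign l

theorem unzipSign_ne_zero (l : List (ZMod 2 × ZMod 2)) : unzipSign l ≠ 0 := by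
  induction l with
  | nil => simp [unzipSign]
  | cons a l ih => exact mul_ne_zero (sgn_ne_zero _ _) ih

/-- When both parities in each pair agree, the sign is the product of `sgn` over all pairs of
positions, which is symmetric. -/
theorem unzipSign_perm {l l' : List (ZMod 2)} (h : l.Perm l') :
    unzipSign (l.map fun a => (a, a)) = unzipSign (l'.map fun a => (a, a)) := by
  induction h with
  | nil => rfl
  | cons a h ih =>
    simp only [List.map_cons, unzipSign, List.map_map, Function.comp_def, List.map_id'] at ih ⊢
    rw [ih, h.sum_eq]
  | swap a b l =>
    simp only [List.map_cons, unzipSign, List.map_map, Function.comp_def, List.map_id',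
      List.sum_cons, sgn_add_right]
    rw [sgn_comm b a]
    ring
  | trans _ _ ih1 ih2 => rw [ih1, ih2]

/-- The sign is multiplicative in the second parities, and q + (p + q) = p. The two factors arise in
polarization and in restitution; the product no longer depends on `q`, that is, on the columns. -/
theorem unzipSign_mul {κ : Type*} (p q : κ → ZMod 2) (l : List κ) :
    unzipSign (l.map fun k => (p k, q k)) * unzipSign (l.map fun k => (p k, p k + q k)) =
      unzipSign (l.map fun k => (p k, p k)) := by
  induction l with
  | nil => simp [unzipSign]
  | cons k l ih =>
    have h : ∀ q' : κ → ZMod 2, (l.map fun k => (p k, q' k)).map Prod.fst = l.map p := fun q' => by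
      simp [Function.comp_def]
    simp only [List.map_cons, unzipSign, h, sgn_add_left]
    rw [← ih]
    have h2 := sgn_mul_self (q k) (l.map p).sum
    linear_combination (sgn (p k) (l.map p).sum *
      unzipSign (l.map fun k => (p k, q k)) * unzipSign (l.map fun k => (p k, p k + q k))) * h2

theorem prod_mul_eq {κ : Type*} (p q : κ → ZMod 2) (g h : κ → B)
    (hg : ∀ k, g k ∈ pt (B := B) (p k)) (hh : ∀ k, h k ∈ pt (B := B) (q k)) (l : List κ) :
    (l.map fun k => g k * h k).prod =
      unzipSign (l.map fun k => (p k, q k)) • ((l.map g).prod * (l.map h).prod) := by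
  induction l with
  | nil => simp [unzipSign]
  | cons k l ih =>
    have h1 := comm (hh k) (list_prod_mem p g hg l)
    have h2 : (l.map fun k => (p k, q k)).map Prod.fst = l.map p := by simp [Function.comp_def]
    simp only [List.map_cons, List.prod_cons, ih, unzipSign, h2]
    rw [mul_smul_comm, mul_smul, smul_comm]
    congr 1
    calc g k * h k * ((l.map g).prod * (l.map h).prod)
        = g k * (h k * (l.map g).prod) * (l.map h).prod := by simp only [mul_assoc]
      _ = _ := by
        rw [h1]
        simp only [mul_assoc, mul_smul_comm, smul_mul_assoc]

end Lists

/-! ### Free supercommutative algebras. -/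

section FreeAlg

variable {κ : Type*} (par : κ → ZMod 2)

/-- The relations of the free supercommutative algebra. -/
inductive FSRel : FreeAlgebra ℂ κ → FreeAlgebra ℂ κ → Prop
  | swap (a b : κ) : FSRel (FreeAlgebra.ι ℂ a * FreeAlgebra.ι ℂ b)
      (sgn (par a) (par b) • (FreeAlgebra.ι ℂ b * FreeAlgebra.ι ℂ a))

/-- The free supercommutative algebra on generators of given parities. -/
def FS : Type _ := RingQuot (FSRel par)

instance : Ring (FS par) := inferInstanceAs (Ring (RingQuot (FSRel par)))

instance : Algebra ℂ (FS par) := inferInstanceAs (Algebra ℂ (RingQuot (FSRel par)))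

namespace FS

/-- The generators of the free supercommutative algebra. -/
def X (k : κ) : FS par := RingQuot.mkAlgHom ℂ (FSRel par) (FreeAlgebra.ι ℂ k)

theorem X_mul_X (a b : κ) : X par a * X par b = sgn (par a) (par b) • (X par b * X par a) := by
  have h := RingQuot.mkAlgHom_rel ℂ (FSRel.swap (par := par) a b)
  rw [map_mul, map_smul, map_mul] at h
  exact h

variable {par}

/-- The universal property of the free supercommutative algebra. -/
def lift {B : Type*} [Ring B] [Algebra ℂ B] (g : κ → B)
    (hg : ∀ a b, g a * g b = sgn (par a) (par b) • (g b * g a)) : FS par →ₐ[ℂ] B :=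
  RingQuot.liftAlgHom ℂ ⟨FreeAlgebra.lift ℂ g, by
    intro s t h
    cases h with
    | swap a b => simpa using hg a b⟩

@[simp] theorem lift_X {B : Type*} [Ring B] [Algebra ℂ B] (g : κ → B)
    (hg : ∀ a b, g a * g b = sgn (par a) (par b) • (g b * g a)) (k : κ) :
    lift g hg (X par k) = g k := by
  change RingQuot.liftAlgHom ℂ _ (RingQuot.mkAlgHom ℂ (FSRel par) (FreeAlgebra.ι ℂ k)) = g k
  rw [RingQuot.liftAlgHom_mkAlgHom_apply, FreeAlgebra.lift_ι_apply]

theorem induction {P : FS par → Prop} (h0 : ∀ r, P (algebraMap ℂ _ r)) (h1 : ∀ k, P (X par k))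
    (hm : ∀ a b, P a → P b → P (a * b)) (ha : ∀ a b, P a → P b → P (a + b))
    (s : FS par) : P s := by
  obtain ⟨t, rfl⟩ := RingQuot.mkAlgHom_surjective ℂ (FSRel par) s
  induction t using FreeAlgebra.induction with
  | grade0 r =>
    rw [AlgHom.commutes]
    exact h0 r
  | grade1 x => exact h1 x
  | mul a b iha ihb =>
    rw [map_mul]
    exact hm _ _ iha ihb
  | add a b iha ihb =>
    rw [map_add]
    exact ha _ _ iha ihb

theorem hom_ext {B : Type*} [Ring B] [Algebra ℂ B] {f g : FS par →ₐ[ℂ] B}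
    (h : ∀ k, f (X par k) = g (X par k)) : f = g := by
  refine AlgHom.ext fun s => ?_
  induction s using FS.induction with
  | h0 r => simp
  | h1 k => exact h k
  | hm a b ha hb => simp [ha, hb]
  | ha a b ha hb => simp [ha, hb]

theorem word_comm (l l' : List κ) :
    (l.map (X par)).prod * (l'.map (X par)).prod =
      sgn (l.map par).sum (l'.map par).sum • ((l'.map (X par)).prod * (l.map (X par)).prod) := by
  have key : ∀ (k : κ) (l' : List κ), X par k * (l'.map (X par)).prod =
      sgn (par k) (l'.map par).sum • ((l'.map (X par)).prod * X par k) := by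
    intro k l'
    induction l' with
    | nil => simp
    | cons m l' ih =>
      simp only [List.map_cons, List.prod_cons, List.sum_cons, sgn_add_right]
      rw [← mul_assoc, X_mul_X, smul_mul_assoc, mul_assoc, ih, mul_smul_comm, smul_smul, mul_assoc]
  induction l with
  | nil => simp
  | cons k l ih =>
    simp only [List.map_cons, List.prod_cons, List.sum_cons, sgn_add_left]
    rw [mul_assoc, ih, mul_smul_comm, ← mul_assoc, key, smul_mul_assoc, smul_smul, mul_assoc,
      mul_comm (sgn _ _)]

instance : SCAlg (FS par) where
  pt c := Submodule.span ℂ {t | ∃ l : List κ, (l.map par).sum = c ∧ (l.map (X par)).prod = t}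
  one_mem := Submodule.subset_span ⟨[], by simp, by simp⟩
  mul_mem {a b x y} hx hy := by
    induction hx, hy using Submodule.span_induction₂ with
    | mem_mem x y hx hy =>
      obtain ⟨l, rfl, rfl⟩ := hx
      obtain ⟨l', rfl, rfl⟩ := hy
      exact Submodule.subset_span ⟨l ++ l', by simp, by simp⟩
    | zero_left y hy => simp
    | zero_right x hx => simp
    | add_left x y z _ _ _ h1 h2 => rw [add_mul]; exact Submodule.add_mem _ h1 h2
    | add_right x y z _ _ _ h1 h2 => rw [mul_add]; exact Submodule.add_mem _ h1 h2
    | smul_left r x y _ _ h => rw [smul_mul_assoc]; exact Submodule.smul_mem _ _ h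
    | smul_right r x y _ _ h => rw [mul_smul_comm]; exact Submodule.smul_mem _ _ h
  comm {a b x y} hx hy := by
    induction hx, hy using Submodule.span_induction₂ with
    | mem_mem x y hx hy =>
      obtain ⟨l, rfl, rfl⟩ := hx
      obtain ⟨l', rfl, rfl⟩ := hy
      exact word_comm l l'
    | zero_left y hy => simp
    | zero_right x hx => simp
    | add_left x y z _ _ _ h1 h2 => rw [add_mul, mul_add, h1, h2, smul_add]
    | add_right x y z _ _ _ h1 h2 => rw [add_mul, mul_add, h1, h2, smul_add]
    | smul_left r x y _ _ h => rw [smul_mul_assoc, mul_smul_comm, h, smul_comm]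
    | smul_right r x y _ _ h => rw [smul_mul_assoc, mul_smul_comm, h, smul_comm]

theorem X_mem (k : κ) : X par k ∈ pt (B := FS par) (par k) :=
  Submodule.subset_span ⟨[k], by simp, by simp⟩

/-- A free supercommutative algebra is spanned by words. -/
theorem mem_span_words (f : FS par) :
    f ∈ Submodule.span ℂ (Set.range fun l : List κ => (l.map (X par)).prod) := by
  induction f using FS.induction with
  | h0 r =>
    rw [Algebra.algebraMap_eq_smul_one]
    exact Submodule.smul_mem _ _ (Submodule.subset_span ⟨[], by simp⟩)
  | h1 k => exact Submodule.subset_span ⟨[k], by simp⟩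
  | hm a b ha hb =>
    induction ha, hb using Submodule.span_induction₂ with
    | mem_mem x y hx hy =>
      obtain ⟨l, rfl⟩ := hx
      obtain ⟨l', rfl⟩ := hy
      exact Submodule.subset_span ⟨l ++ l', by simp⟩
    | zero_left y hy => simp
    | zero_right x hx => simp
    | add_left x y z _ _ _ h1 h2 => rw [add_mul]; exact Submodule.add_mem _ h1 h2
    | add_right x y z _ _ _ h1 h2 => rw [mul_add]; exact Submodule.add_mem _ h1 h2
    | smul_left r x y _ _ h => rw [smul_mul_assoc]; exact Submodule.smul_mem _ _ h
    | smul_right r x y _ _ h => rw [mul_smul_comm]; exact Submodule.smul_mem _ _ h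
  | ha a b ha hb => exact Submodule.add_mem _ ha hb

/-- The homomorphism to a supercommutative algebra that substitutes elements of the right
parities for the generators. -/
def subst {B : Type*} [Ring B] [Algebra ℂ B] [SCAlg B] (g : κ → B)
    (hg : ∀ k, g k ∈ pt (B := B) (par k)) : FS par →ₐ[ℂ] B :=
  lift g fun a b => comm (hg a) (hg b)

@[simp] theorem subst_X {B : Type*} [Ring B] [Algebra ℂ B] [SCAlg B] (g : κ → B)
    (hg : ∀ k, g k ∈ pt (B := B) (par k)) (k : κ) : subst g hg (X par k) = g k := lift_X _ _ _

theorem subst_mem {B : Type*} [Ring B] [Algebra ℂ B] [SCAlg B] (g : κ → B)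
    (hg : ∀ k, g k ∈ pt (B := B) (par k)) {c : ZMod 2} {f : FS par} (hf : f ∈ pt (B := FS par) c) :
    subst g hg f ∈ pt (B := B) c := by
  induction hf using Submodule.span_induction with
  | mem x hx =>
    obtain ⟨l, rfl, rfl⟩ := hx
    rw [map_list_prod, List.map_map]
    simpa [Function.comp_def] using list_prod_mem par g hg l
  | zero => simp
  | add x y _ _ h1 h2 => rw [map_add]; exact Submodule.add_mem _ h1 h2
  | smul r x _ h => rw [map_smul]; exact Submodule.smul_mem _ _ h

variable (par) in
/-- The automorphism that multiplies an element `f` of parity `p` by `(-1) ^ (c * p)`. -/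
def twistHom (c : ZMod 2) : FS par →ₐ[ℂ] FS par :=
  subst (fun k => sgn c (par k) • X par k) fun k => Submodule.smul_mem _ _ (X_mem k)

theorem twistHom_X (c : ZMod 2) (k : κ) : twistHom par c (X par k) = sgn c (par k) • X par k := by
  simp [twistHom]

end FS

end FreeAlg

/-! ### Even matrices over supercommutative algebras. -/

section Matrices

variable {B : Type*} [Ring B] [Algebra ℂ B] [SCAlg B] {ρ I S : Type*}

/-- A matrix over a supercommutative algebra that represents an even map. -/
def IsEvenMatrix (pρ : ρ → ZMod 2) (pI : I → ZMod 2) (M : Matrix ρ I B) : Prop :=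
  ∀ r i, M r i ∈ pt (B := B) (pρ r + pI i)

theorem IsEvenMatrix.mul [Fintype I] {pρ : ρ → ZMod 2} {pI : I → ZMod 2} {pS : S → ZMod 2}
    {M : Matrix ρ I B} {N : Matrix I S B} (hM : IsEvenMatrix pρ pI M)
    (hN : IsEvenMatrix pI pS N) : IsEvenMatrix pρ pS (M * N) := by
  intro r s
  rw [Matrix.mul_apply]
  refine Submodule.sum_mem _ fun i _ => ?_
  rw [← parity_trans _ _ (pI i)]
  exact mul_mem (hM r i) (hN i s)

theorem IsEvenMatrix.one [DecidableEq I] (pI : I → ZMod 2) :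
    IsEvenMatrix pI pI (1 : Matrix I I B) := by
  intro i j
  rw [Matrix.one_apply]
  split_ifs with h
  · subst h
    simpa using SCAlg.one_mem
  · exact Submodule.zero_mem _

theorem IsEvenMatrix.add {pρ : ρ → ZMod 2} {pI : I → ZMod 2}
    {M N : Matrix ρ I B} (hM : IsEvenMatrix pρ pI M)
    (hN : IsEvenMatrix pρ pI N) : IsEvenMatrix pρ pI (M + N) :=
  fun r s => Submodule.add_mem _ (hM r s) (hN r s)

theorem IsEvenMatrix.neg {pρ : ρ → ZMod 2} {pI : I → ZMod 2}
    {M : Matrix ρ I B} (hM : IsEvenMatrix pρ pI M) : IsEvenMatrix pρ pI (-M) :=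
  fun r s => Submodule.neg_mem _ (hM r s)

theorem IsEvenMatrix.pow [Fintype I] [DecidableEq I] {pI : I → ZMod 2} {M : Matrix I I B}
    (hM : IsEvenMatrix pI pI M) (k : ℕ) : IsEvenMatrix pI pI (M ^ k) := by
  induction k with
  | zero => simpa using IsEvenMatrix.one pI
  | succ k ih => simpa [pow_succ] using ih.mul hM

end Matrices

/-! ### Polynomials and power series in an even variable. -/

section Series

variable {B : Type*} [Ring B] [Algebra ℂ B] [SCAlg B]

instance : SCAlg (Polynomial B) where
  pt c :=
    { carrier := {f | ∀ n, f.coeff n ∈ pt (B := B) c}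
      add_mem' := fun hf hg n => by
        rw [Polynomial.coeff_add]; exact Submodule.add_mem _ (hf n) (hg n)
      zero_mem' := fun n => by simp
      smul_mem' := fun r f hf n => by
        rw [Polynomial.coeff_smul]; exact Submodule.smul_mem _ _ (hf n) }
  one_mem n := by
    rw [Polynomial.coeff_one]
    split_ifs
    · exact SCAlg.one_mem
    · exact Submodule.zero_mem _
  mul_mem {a b x y} hx hy n := by
    rw [Polynomial.coeff_mul]
    exact Submodule.sum_mem _ fun i _ => SCAlg.mul_mem (hx _) (hy _)
  comm {a b x y} hx hy := by
    ext n
    rw [Polynomial.coeff_smul, Polynomial.coeff_mul, Polynomial.coeff_mul,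
      ← Finset.Nat.sum_antidiagonal_swap, Finset.smul_sum]
    exact Finset.sum_congr rfl fun i _ => SCAlg.comm (hx _) (hy _)

instance : SCAlg (PowerSeries B) where
  pt c :=
    { carrier := {f | ∀ n, PowerSeries.coeff n f ∈ pt (B := B) c}
      add_mem' := fun hf hg n => by
        rw [map_add]; exact Submodule.add_mem _ (hf n) (hg n)
      zero_mem' := fun n => by simp
      smul_mem' := fun r f hf n => by
        change r • PowerSeries.coeff n f ∈ _
        exact Submodule.smul_mem _ _ (hf n) }
  one_mem n := by
    rw [PowerSeries.coeff_one]
    split_ifs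
    · exact SCAlg.one_mem
    · exact Submodule.zero_mem _
  mul_mem {a b x y} hx hy n := by
    rw [PowerSeries.coeff_mul]
    exact Submodule.sum_mem _ fun i _ => SCAlg.mul_mem (hx _) (hy _)
  comm {a b x y} hx hy := by
    ext n
    change _ = sgn a b • PowerSeries.coeff n (y * x)
    rw [PowerSeries.coeff_mul, PowerSeries.coeff_mul,
      ← Finset.Nat.sum_antidiagonal_swap, Finset.smul_sum]
    exact Finset.sum_congr rfl fun i _ => SCAlg.comm (hx _) (hy _)

theorem polynomial_mem_pt_iff {c : ZMod 2} {f : Polynomial B} :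
    f ∈ pt (B := Polynomial B) c ↔ ∀ n, f.coeff n ∈ pt (B := B) c := Iff.rfl

theorem powerSeries_mem_pt_iff {c : ZMod 2} {f : PowerSeries B} :
    f ∈ pt (B := PowerSeries B) c ↔ ∀ n, PowerSeries.coeff n f ∈ pt (B := B) c := Iff.rfl

end Series

/-! ### Homogeneous bases, dual bases and matrix units. -/

section HomogeneousBases

variable {V : Type*} [AddCommGroup V] [Module ℂ V] [Superspace V]

/-- A basis of homogeneous vectors of given parities. -/
def IsHomogeneous {I : Type*} (e : Module.Basis I ℂ V) (pI : I → ZMod 2) : Prop :=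
  ∀ i, e i ∈ part (V := V) (pI i)

theorem zmod_two_eq_add_one {a b : ZMod 2} (h : a ≠ b) : a = b + 1 := by
  revert a b
  decide

/-- The coordinate `e.coord i` factors through the projection to parity `pI i`, as can be checked on
the basis. -/
theorem IsHomogeneous.coord_eq_zero {I : Type*} {e : Module.Basis I ℂ V} {pI : I → ZMod 2}
    (he : IsHomogeneous e pI) {a : ZMod 2} {v : V} (hv : v ∈ part (V := V) a) {i : I}
    (hi : pI i ≠ a) : e.coord i v = 0 := by
  have h : e.coord i ∘ₗ component (pI i) = e.coord i := by
    refine e.ext fun j => ?_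
    by_cases hj : pI i = pI j
    · rw [LinearMap.comp_apply, hj, component_of_mem (he j)]
    · rw [LinearMap.comp_apply, zmod_two_eq_add_one hj, component_of_mem' (he j), map_zero]
      have : j ≠ i := fun h => hj (by rw [h])
      simp [this]
  rw [← h, LinearMap.comp_apply, zmod_two_eq_add_one hi, component_of_mem' hv, map_zero]

theorem IsHomogeneous.dualBasis {I : Type*} [Fintype I] [DecidableEq I]
    {e : Module.Basis I ℂ V} {pI : I → ZMod 2}
    (he : IsHomogeneous e pI) : IsHomogeneous (V := Module.Dual ℂ V) e.dualBasis pI := by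
  intro i a v hv
  by_cases h : pI i = a
  · subst h
    rw [zmod_two_add_self]
    change _ ∈ (if (0 : ZMod 2) = 0 then (⊤ : Submodule ℂ ℂ) else ⊥)
    simp
  · have h0 := he.coord_eq_zero hv h
    have h1 : (e.dualBasis i : V →ₗ[ℂ] ℂ) v = 0 := by
      rw [Module.Basis.coe_dualBasis]
      exact h0
    rw [h1]
    exact Submodule.zero_mem _

/-- In a tensor of homogeneous vectors only basis tensors of matching parities have nonzero
coefficients. This makes the comparison map on generators parity preserving. -/
theorem IsHomogeneous.constr_mem {V' : Type*} [AddCommGroup V'] [Module ℂ V'] [Superspace V']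
    {I J : Type*} [Fintype I] [Fintype J] {e : Module.Basis I ℂ V} {pI : I → ZMod 2}
    {e' : Module.Basis J ℂ V'} {pJ : J → ZMod 2} (he : IsHomogeneous e pI)
    (he' : IsHomogeneous e' pJ) {B : Type*} [Ring B] [Algebra ℂ B] [SCAlg B] (g : I × J → B)
    (hg : ∀ a, g a ∈ pt (B := B) (pI a.1 + pJ a.2)) {c : ZMod 2} {t : V ⊗[ℂ] V'}
    (ht : t ∈ part (V := V ⊗[ℂ] V') c) :
    (e.tensorProduct e').constr ℂ g t ∈ pt (B := B) c := by
  induction ht using Submodule.span_induction with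
  | mem t ht =>
    obtain ⟨a, b, rfl, v, hv, w, hw, rfl⟩ := ht
    rw [Module.Basis.constr_apply_fintype]
    refine Submodule.sum_mem _ fun k _ => ?_
    obtain ⟨i, j⟩ := k
    rw [Module.Basis.equivFun_apply, Module.Basis.tensorProduct_repr_tmul_apply]
    by_cases h1 : pI i = a
    · by_cases h2 : pJ j = b
      · rw [← h1, ← h2]
        exact Submodule.smul_mem _ _ (hg (i, j))
      · have h3 : e'.repr w j = 0 := he'.coord_eq_zero hw h2
        simp [h3]
    · have h3 : e.repr v i = 0 := he.coord_eq_zero hv h1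
      simp [h3]
  | zero => simp
  | add x y _ _ h1 h2 => rw [map_add]; exact Submodule.add_mem _ h1 h2
  | smul r x _ h => rw [map_smul]; exact Submodule.smul_mem _ _ h

/-- The matrix unit that sends `e j` to `e i`. -/
def matrixUnit {I : Type*} {e : Module.Basis I ℂ V} {pI : I → ZMod 2} (he : IsHomogeneous e pI)
    (i j : I) : EndPart V (pI i + pI j) :=
  ⟨(e.coord j).smulRight (e i), fun a v hv => by
    by_cases h : pI j = a
    · subst h
      rw [add_comm (pI i), ← add_assoc, zmod_two_add_self, zero_add]
      exact Submodule.smul_mem _ _ (he i)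
    · simp only [LinearMap.smulRight_apply, he.coord_eq_zero hv h, zero_smul]
      exact Submodule.zero_mem _⟩

end HomogeneousBases

/-! ### The coordinate algebra of pairs of matrices and its points. -/

section Model

variable {ρ I S : Type*} (pρ : ρ → ZMod 2) (pI : I → ZMod 2) (pS : S → ZMod 2)

/-- The parities of the generators `x_{ri}` and `y_{is}`. -/
abbrev genParity : (ρ × I) ⊕ (I × S) → ZMod 2 :=
  Sum.elim (fun a => pρ a.1 + pI a.2) (fun a => pI a.1 + pS a.2)

/-- The coordinate algebra of pairs of matrices: the free supercommutative algebra on the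
generators `x_{ri}` and `y_{is}`. -/
abbrev MatAlg : Type _ := FS (genParity pρ pI pS)

/-- The matrix of the generators `x_{ri}`. -/
def genU : Matrix ρ I (MatAlg pρ pI pS) := fun r i => FS.X _ (Sum.inl (r, i))

/-- The matrix of the generators `y_{is}`. -/
def genW : Matrix I S (MatAlg pρ pI pS) := fun i s => FS.X _ (Sum.inr (i, s))

theorem genU_even : IsEvenMatrix pρ pI (genU pρ pI pS) := fun r i => FS.X_mem (Sum.inl (r, i))

theorem genW_even : IsEvenMatrix pI pS (genW pρ pI pS) := fun i s => FS.X_mem (Sum.inr (i, s))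

variable {pρ pI pS}

/-- The evaluation at a pair of matrices. -/
def ev {B : Type*} [Ring B] [Algebra ℂ B] [SCAlg B] (X : Matrix ρ I B) (Y : Matrix I S B)
    (hX : IsEvenMatrix pρ pI X) (hY : IsEvenMatrix pI pS Y) : MatAlg pρ pI pS →ₐ[ℂ] B :=
  FS.subst (Sum.elim (fun a => X a.1 a.2) (fun a => Y a.1 a.2)) (by
    rintro (a | a)
    · exact hX _ _
    · exact hY _ _)

@[simp] theorem ev_genU {B : Type*} [Ring B] [Algebra ℂ B] [SCAlg B] {X : Matrix ρ I B}
    {Y : Matrix I S B} (hX : IsEvenMatrix pρ pI X) (hY : IsEvenMatrix pI pS Y) (r : ρ) (i : I) :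
    ev X Y hX hY (genU pρ pI pS r i) = X r i := by
  simp [ev, genU]

@[simp] theorem ev_genW {B : Type*} [Ring B] [Algebra ℂ B] [SCAlg B] {X : Matrix ρ I B}
    {Y : Matrix I S B} (hX : IsEvenMatrix pρ pI X) (hY : IsEvenMatrix pI pS Y) (i : I) (s : S) :
    ev X Y hX hY (genW pρ pI pS i s) = Y i s := by
  simp [ev, genW]

theorem matAlg_hom_ext {B : Type*} [Ring B] [Algebra ℂ B] {f g : MatAlg pρ pI pS →ₐ[ℂ] B}
    (h1 : ∀ r i, f (genU pρ pI pS r i) = g (genU pρ pI pS r i))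
    (h2 : ∀ i s, f (genW pρ pI pS i s) = g (genW pρ pI pS i s)) : f = g :=
  FS.hom_ext fun k => by
    rcases k with ⟨r, i⟩ | ⟨i, s⟩
    · exact h1 r i
    · exact h2 i s

theorem ev_congr {B : Type*} [Ring B] [Algebra ℂ B] [SCAlg B] {X X' : Matrix ρ I B}
    {Y Y' : Matrix I S B} (hX : IsEvenMatrix pρ pI X) (hY : IsEvenMatrix pI pS Y)
    (h1 : X = X') (h2 : Y = Y') (f : MatAlg pρ pI pS) :
    ev X Y hX hY f = ev X' Y' (h1 ▸ hX) (h2 ▸ hY) f := by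
  subst h1 h2
  rfl

/-- Elements with `f(X z, Y) = f(X, z Y)` for all even matrices over free supercommutative
algebras. -/
def IsBalanced [Fintype I] (f : MatAlg pρ pI pS) : Prop :=
  ∀ (β : Type) (pβ : β → ZMod 2) (X : Matrix ρ I (FS pβ)) (Y : Matrix I S (FS pβ))
    (z : Matrix I I (FS pβ)) (hX : IsEvenMatrix pρ pI X) (hY : IsEvenMatrix pI pS Y)
    (hz : IsEvenMatrix pI pI z), ev (X * z) Y (hX.mul hz) hY f = ev X (z * Y) hX (hz.mul hY) f

end Model

/-! ### Comparison of the symmetric algebra with the coordinate algebra. -/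

section Comparison

variable {U V W : Type*} [AddCommGroup U] [Module ℂ U] [Superspace U]
  [AddCommGroup V] [Module ℂ V] [Superspace V] [AddCommGroup W] [Module ℂ W] [Superspace W]
  {ρ I S : Type*} [Fintype ρ] [Fintype I] [Fintype S] [DecidableEq I]
  {pρ : ρ → ZMod 2} {pI : I → ZMod 2} {pS : S → ZMod 2}
  {u : Module.Basis ρ ℂ U} {e : Module.Basis I ℂ V} {w : Module.Basis S ℂ W}

theorem gens_ext (u : Module.Basis ρ ℂ U) (e : Module.Basis I ℂ V) (w : Module.Basis S ℂ W)
    {N : Type*} [AddCommGroup N] [Module ℂ N] {f g : Gens U V W →ₗ[ℂ] N}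
    (h1 : ∀ r i, f (u r ⊗ₜ e i, 0) = g (u r ⊗ₜ e i, 0))
    (h2 : ∀ i s, f (0, e.dualBasis i ⊗ₜ w s) = g (0, e.dualBasis i ⊗ₜ w s)) : f = g := by
  refine LinearMap.prod_ext ((u.tensorProduct e).ext fun a => ?_)
    ((e.dualBasis.tensorProduct w).ext fun a => ?_)
  · simpa [Module.Basis.tensorProduct_apply'] using h1 a.1 a.2
  · simpa [Module.Basis.tensorProduct_apply'] using h2 a.1 a.2

/-- The comparison map from `S(U ⊗ V ⊕ V* ⊗ W)` to the algebra of polynomials in coordinates. -/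
def toModel (hu : IsHomogeneous u pρ) (he : IsHomogeneous e pI) (hw : IsHomogeneous w pS) :
    SuperSym (Gens U V W) →ₐ[ℂ] MatAlg pρ pI pS :=
  SuperSym.lift
    (LinearMap.coprod
      ((u.tensorProduct e).constr ℂ fun a => genU pρ pI pS a.1 a.2)
      ((e.dualBasis.tensorProduct w).constr ℂ fun a => genW pρ pI pS a.1 a.2))
    (by
      -- The map on generators preserves parity, so the defining relations follow from
      -- supercommutativity of the target.
      have key : ∀ (a : ZMod 2) (x : Gens U V W), x ∈ part (V := Gens U V W) a →
          (LinearMap.coprod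
            ((u.tensorProduct e).constr ℂ fun a => genU pρ pI pS a.1 a.2)
            ((e.dualBasis.tensorProduct w).constr ℂ fun a => genW pρ pI pS a.1 a.2)) x ∈
              pt (B := MatAlg pρ pI pS) a := by
        rintro a ⟨s, t⟩ ⟨hs, ht⟩
        rw [LinearMap.coprod_apply]
        exact Submodule.add_mem _
          (hu.constr_mem he _ (fun a => genU_even pρ pI pS a.1 a.2) hs)
          (he.dualBasis.constr_mem hw _ (fun a => genW_even pρ pI pS a.1 a.2) ht)
      exact fun a b x y hx hy => SCAlg.comm (key a x hx) (key b y hy))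

theorem toModel_x (hu : IsHomogeneous u pρ) (he : IsHomogeneous e pI) (hw : IsHomogeneous w pS)
    (r : ρ) (i : I) : toModel hu he hw (SuperSym.ι (u r ⊗ₜ e i, 0)) = genU pρ pI pS r i := by
  rw [toModel, SuperSym.lift_ι, LinearMap.coprod_apply, map_zero, add_zero,
    ← Module.Basis.tensorProduct_apply, Module.Basis.constr_basis]

theorem toModel_y (hu : IsHomogeneous u pρ) (he : IsHomogeneous e pI) (hw : IsHomogeneous w pS)
    (i : I) (s : S) :
    toModel hu he hw (SuperSym.ι (0, e.dualBasis i ⊗ₜ w s)) = genW pρ pI pS i s := by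
  rw [toModel, SuperSym.lift_ι, LinearMap.coprod_apply, map_zero, zero_add,
    ← Module.Basis.tensorProduct_apply, Module.Basis.constr_basis]

theorem x_mem (hu : IsHomogeneous u pρ) (he : IsHomogeneous e pI) (r : ρ) (i : I) :
    ((u r ⊗ₜ e i, 0) : Gens U V W) ∈ part (V := Gens U V W) (pρ r + pI i) :=
  ⟨tmul_mem_part (hu r) (he i), Submodule.zero_mem _⟩

theorem y_mem (he : IsHomogeneous e pI) (hw : IsHomogeneous w pS) (i : I) (s : S) :
    ((0, e.dualBasis i ⊗ₜ w s) : Gens U V W) ∈ part (V := Gens U V W) (pI i + pS s) :=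
  ⟨Submodule.zero_mem _, tmul_mem_part (he.dualBasis i) (hw s)⟩

/-- The inverse of `toModel`. -/
def ofModel (hu : IsHomogeneous u pρ) (he : IsHomogeneous e pI) (hw : IsHomogeneous w pS) :
    MatAlg pρ pI pS →ₐ[ℂ] SuperSym (Gens U V W) :=
  FS.lift (Sum.elim (fun a => SuperSym.ι (u a.1 ⊗ₜ e a.2, 0))
    (fun a => SuperSym.ι (0, e.dualBasis a.1 ⊗ₜ w a.2))) (by
      rintro (⟨r, i⟩ | ⟨i, s⟩) (⟨r', i'⟩ | ⟨i', s'⟩)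
      · exact SuperSym.ι_mul_ι (x_mem hu he r i) (x_mem hu he r' i')
      · exact SuperSym.ι_mul_ι (x_mem hu he r i) (y_mem he hw i' s')
      · exact SuperSym.ι_mul_ι (y_mem he hw i s) (x_mem hu he r' i')
      · exact SuperSym.ι_mul_ι (y_mem he hw i s) (y_mem he hw i' s'))

theorem ofModel_genU (hu : IsHomogeneous u pρ) (he : IsHomogeneous e pI) (hw : IsHomogeneous w pS)
    (r : ρ) (i : I) : ofModel hu he hw (genU pρ pI pS r i) = SuperSym.ι (u r ⊗ₜ e i, 0) := by
  simp [ofModel, genU]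

theorem ofModel_genW (hu : IsHomogeneous u pρ) (he : IsHomogeneous e pI) (hw : IsHomogeneous w pS)
    (i : I) (s : S) :
    ofModel hu he hw (genW pρ pI pS i s) = SuperSym.ι (0, e.dualBasis i ⊗ₜ w s) := by
  simp [ofModel, genW]

theorem ofModel_toModel (hu : IsHomogeneous u pρ) (he : IsHomogeneous e pI)
    (hw : IsHomogeneous w pS) (f : SuperSym (Gens U V W)) :
    ofModel hu he hw (toModel hu he hw f) = f := by
  induction f using SuperSym.induction with
  | h0 r => simp
  | h1 x =>
    have h : (ofModel hu he hw).toLinearMap ∘ₗ (toModel hu he hw).toLinearMap ∘ₗ SuperSym.ι =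
        SuperSym.ι := by
      refine gens_ext u e w (fun r i => ?_) (fun i s => ?_)
      · simp [toModel_x, ofModel_genU]
      · simp [toModel_y, ofModel_genW, -Module.Basis.coe_dualBasis]
    exact LinearMap.congr_fun h x
  | hm a b ha hb => rw [map_mul, map_mul, ha, hb]
  | ha a b ha hb => rw [map_add, map_add, ha, hb]

/-- The action of a homogeneous operator on the generators `x_{ri}`. -/
theorem glAct_x (hu : IsHomogeneous u pρ) {c : ZMod 2} (X : EndPart V c) (r : ρ) (v : V) :
    glAct U W c X (SuperSym.ι (u r ⊗ₜ v, 0)) =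
      sgn c (pρ r) • SuperSym.ι (u r ⊗ₜ (X : Module.End ℂ V) v, 0) := by
  rw [glAct, SuperSym.superDeriv_ι, ← map_smul]
  congr 1
  simp [glGens, gensAct, twist_of_mem c (hu r), TensorProduct.smul_tmul']

/-- The action of a homogeneous operator on the generators `y_{is}`. -/
theorem glAct_y (he : IsHomogeneous e pI) {c : ZMod 2} (X : EndPart V c) (i : I) (y : W) :
    glAct U W c X (SuperSym.ι (0, e.dualBasis i ⊗ₜ y)) =
      -sgn c (pI i) • ∑ j, e.coord i ((X : Module.End ℂ V) (e j)) •
        SuperSym.ι (0, e.dualBasis j ⊗ₜ y) := by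
  have h : dualAct c (X : Module.End ℂ V) (e.dualBasis i) =
      -sgn c (pI i) • ∑ j, e.coord i ((X : Module.End ℂ V) (e j)) • e.dualBasis j := by
    refine e.ext fun k => ?_
    have h1 := twist_of_mem (V := Module.Dual ℂ V) c (he.dualBasis i)
    simp [dualAct, h1, Module.Dual.transpose_apply, -Module.Basis.coe_dualBasis,
      LinearMap.sum_apply, Module.Basis.dualBasis_apply, Finsupp.single_apply]
  rw [glAct, SuperSym.superDeriv_ι]
  have h2 : ((glGens U W c X : EndPart (Gens U V W) c) : Module.End ℂ (Gens U V W))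
      (0, e.dualBasis i ⊗ₜ y) = -sgn c (pI i) • ∑ j, e.coord i ((X : Module.End ℂ V) (e j)) •
        ((0, e.dualBasis j ⊗ₜ y) : Gens U V W) := by
    have h3 : ((glGens U W c X : EndPart (Gens U V W) c) : Module.End ℂ (Gens U V W))
      (0, e.dualBasis i ⊗ₜ y) = (0, dualAct c (X : Module.End ℂ V) (e.dualBasis i) ⊗ₜ y) := by
      simp [glGens, gensAct]
    have h4 := congrArg (LinearMap.inr ℂ (U ⊗[ℂ] V) (Module.Dual ℂ V ⊗[ℂ] W) ∘ₗ
      (TensorProduct.mk ℂ (Module.Dual ℂ V) W).flip y) h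
    rw [map_smul, map_sum] at h4
    simp only [map_smul] at h4
    exact h3.trans h4
  rw [h2, map_smul, map_sum]
  simp only [map_smul]

end Comparison

/-! ### Invariance as constancy along paths of matrices. -/

section Infinitesimal

variable {U V W : Type*} [AddCommGroup U] [Module ℂ U] [Superspace U]
  [AddCommGroup V] [Module ℂ V] [Superspace V] [AddCommGroup W] [Module ℂ W] [Superspace W]
  {ρ I S : Type*} [Fintype ρ] [Fintype I] [Fintype S] [DecidableEq I]
  {pρ : ρ → ZMod 2} {pI : I → ZMod 2} {pS : S → ZMod 2}
  {u : Module.Basis ρ ℂ U} {e : Module.Basis I ℂ V} {w : Module.Basis S ℂ W}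

theorem glAct_matrixUnit_x (hu : IsHomogeneous u pρ) (he : IsHomogeneous e pI) (j i : I) (r : ρ)
    (l : I) : glAct U W _ (matrixUnit he j i) (SuperSym.ι (u r ⊗ₜ e l, 0)) =
      if i = l then sgn (pI j + pI i) (pρ r) • SuperSym.ι (u r ⊗ₜ e j, 0) else 0 := by
  rw [glAct_x hu]
  by_cases h : i = l
  · subst h
    simp [matrixUnit]
  · have h' : l ≠ i := fun h' => h h'.symm
    have h0 : ((matrixUnit he j i : EndPart V _) : Module.End ℂ V) (e l) = 0 := by
      simp [matrixUnit, h']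
    rw [h0, if_neg h]
    have h1 : ((u r ⊗ₜ[ℂ] (0 : V), 0) : Gens U V W) = 0 := by simp
    rw [h1, map_zero, smul_zero]

theorem glAct_matrixUnit_y (he : IsHomogeneous e pI) (j i : I) (l : I) (y : W) :
    glAct U W _ (matrixUnit he j i) (SuperSym.ι (0, e.dualBasis l ⊗ₜ y)) =
      if l = j then -sgn (pI j + pI i) (pI l) • SuperSym.ι (0, e.dualBasis i ⊗ₜ y) else 0 := by
  rw [glAct_y he, Finset.sum_eq_single i]
  · by_cases h : l = j
    · subst h
      simp [matrixUnit]
    · have h' : j ≠ l := fun h' => h h'.symm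
      simp [matrixUnit, h]
  · intro k _ hk
    simp [matrixUnit, hk]
  · simp

variable {R : Type*} [Ring R] [Algebra ℂ R] [SCAlg R]

/-- Moving a coefficient of parity `c` past a value costs exactly the sign of the twist. Hence such
a coefficient times a superderivation of parity `c` obeys the ordinary Leibniz rule. -/
theorem mul_twist_comm (hu : IsHomogeneous u pρ) (he : IsHomogeneous e pI)
    (hw : IsHomogeneous w pS) (γ : MatAlg pρ pI pS →ₐ[ℂ] R)
    (h1 : ∀ r i, γ (genU pρ pI pS r i) ∈ pt (B := R) (pρ r + pI i))
    (h2 : ∀ i s, γ (genW pρ pI pS i s) ∈ pt (B := R) (pI i + pS s)) {c : ZMod 2} {b : R}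
    (hb : b ∈ pt (B := R) c) (f : SuperSym (Gens U V W)) :
    b * γ (toModel hu he hw (SuperSym.twistHom (Gens U V W) c f)) =
      γ (toModel hu he hw f) * b := by
  induction f using SuperSym.induction with
  | h0 r => simp [Algebra.commutes]
  | h1 x =>
    have h : LinearMap.mulLeft ℂ b ∘ₗ (γ.comp (toModel hu he hw)).toLinearMap ∘ₗ
        (SuperSym.twistHom (Gens U V W) c).toLinearMap ∘ₗ SuperSym.ι =
        LinearMap.mulRight ℂ b ∘ₗ (γ.comp (toModel hu he hw)).toLinearMap ∘ₗ SuperSym.ι := by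
      refine gens_ext u e w (fun r i => ?_) (fun i s => ?_)
      · have ht := twist_of_mem c (x_mem (W := W) hu he r i)
        simp only [LinearMap.comp_apply, LinearMap.mulLeft_apply, LinearMap.mulRight_apply,
          AlgHom.toLinearMap_apply, AlgHom.comp_apply, SuperSym.twistHom, SuperSym.lift_ι]
        rw [ht, map_smul, map_smul, map_smul, toModel_x, mul_smul_comm, comm hb (h1 r i),
          smul_smul, sgn_mul_self, one_smul]
      · have ht := twist_of_mem c (y_mem (U := U) he hw i s)
        simp only [LinearMap.comp_apply, LinearMap.mulLeft_apply, LinearMap.mulRight_apply,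
          AlgHom.toLinearMap_apply, AlgHom.comp_apply, SuperSym.twistHom, SuperSym.lift_ι]
        rw [ht, map_smul, map_smul, map_smul, toModel_y, mul_smul_comm, comm hb (h2 i s),
          smul_smul, sgn_mul_self, one_smul]
    exact LinearMap.congr_fun h x
  | hm x y hx hy =>
    rw [map_mul, map_mul, map_mul, ← mul_assoc, hx, mul_assoc, hy, map_mul, map_mul, mul_assoc]
  | ha x y hx hy => rw [map_add, map_add, map_add, mul_add, hx, hy, map_add, map_add, add_mul]

/-- Along a path of pairs of matrices with `X' = X w` and `Y' = - w Y`, the derivative of a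
function is given by the action of `gl(V)`, so that invariants do not change. -/
theorem deriv_eval_eq_zero (hu : IsHomogeneous u pρ) (he : IsHomogeneous e pI)
    (hw : IsHomogeneous w pS) (d : R →ₗ[ℂ] R) (hd : ∀ a b, d (a * b) = d a * b + a * d b)
    {X : Matrix ρ I R} {Y : Matrix I S R} (hX : IsEvenMatrix pρ pI X) (hY : IsEvenMatrix pI pS Y)
    (z : Matrix I I R) (hz : IsEvenMatrix pI pI z)
    (hdX : ∀ r i, d (X r i) = (X * z) r i) (hdY : ∀ i s, d (Y i s) = -(z * Y) i s)
    {f : SuperSym (Gens U V W)} (hf : f ∈ invariants U V W) :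
    d (ev X Y hX hY (toModel hu he hw f)) = 0 := by
  set γ := ev X Y hX hY with hγ
  have hd1 : d 1 = 0 := by
    have h := hd 1 1
    simpa using h
  -- This is the chain rule. Both sides obey the same Leibniz rule along γ, so they need only be
  -- compared on generators. The sign depends on the matrix unit alone: for x it comes from moving
  -- `z j i` to the left together with the sign of the action past u, for y from the dual action.
  have key : ∀ f : SuperSym (Gens U V W), d (γ (toModel hu he hw f)) =
      ∑ j, ∑ i, sgn (pI j + pI i) (pI j) •
        (z j i * γ (toModel hu he hw (glAct U W _ (matrixUnit he j i) f))) := by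
    intro f
    induction f using SuperSym.induction with
    | h0 r =>
      have h0 : ∀ j i, glAct U W _ (matrixUnit he j i) (algebraMap ℂ _ r) = 0 :=
        fun j i => SuperSym.superDeriv_algebraMap _ r
      simp only [h0, map_zero, mul_zero, smul_zero, Finset.sum_const_zero, AlgHom.commutes]
      rw [Algebra.algebraMap_eq_smul_one, map_smul, hd1, smul_zero]
    | h1 x =>
      have h : d ∘ₗ γ.toLinearMap ∘ₗ (toModel hu he hw).toLinearMap ∘ₗ SuperSym.ι =
          ∑ j, ∑ i, sgn (pI j + pI i) (pI j) • (LinearMap.mulLeft ℂ (z j i) ∘ₗ γ.toLinearMap ∘ₗ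
            (toModel hu he hw).toLinearMap ∘ₗ glAct U W _ (matrixUnit he j i) ∘ₗ
              SuperSym.ι) := by
        refine gens_ext u e w (fun r l => ?_) (fun l s => ?_)
        · simp only [LinearMap.comp_apply, LinearMap.sum_apply, LinearMap.smul_apply,
            LinearMap.mulLeft_apply, AlgHom.toLinearMap_apply, glAct_matrixUnit_x hu he, toModel_x]
          rw [hγ, ev_genU, hdX, Matrix.mul_apply]
          refine Finset.sum_congr rfl fun j _ => ?_
          rw [Finset.sum_eq_single l]
          · rw [if_pos rfl, map_smul, map_smul, toModel_x, ev_genU, mul_smul_comm, smul_smul,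
              comm (hX r j) (hz j l), ← sgn_add_right, sgn_comm, add_comm (pρ r)]
          · intro i _ hi
            simp [hi]
          · simp
        · simp only [LinearMap.comp_apply, LinearMap.sum_apply, LinearMap.smul_apply,
            LinearMap.mulLeft_apply, AlgHom.toLinearMap_apply, glAct_matrixUnit_y he, toModel_y]
          rw [hγ, ev_genW, hdY, Matrix.mul_apply]
          refine Eq.trans ?_ (Finset.sum_eq_single l ?_ ?_).symm
          · rw [← Finset.sum_neg_distrib]
            refine Finset.sum_congr rfl fun i _ => ?_
            rw [if_pos rfl, map_smul, map_smul, toModel_y, ev_genW, mul_smul_comm, smul_smul,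
              mul_neg, sgn_mul_self, neg_one_smul]
          · intro j _ hj
            refine Finset.sum_eq_zero fun i _ => ?_
            rw [if_neg fun h => hj h.symm, map_zero, map_zero, mul_zero, smul_zero]
          · simp
      have h' := LinearMap.congr_fun h x
      simpa only [LinearMap.comp_apply, LinearMap.sum_apply, LinearMap.smul_apply,
            LinearMap.mulLeft_apply, AlgHom.toLinearMap_apply] using h'
    | hm a b ha hb =>
      rw [map_mul, map_mul, hd, ha, hb, Finset.sum_mul, Finset.mul_sum, ← Finset.sum_add_distrib]
      refine Finset.sum_congr rfl fun j _ => ?_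
      rw [Finset.sum_mul, Finset.mul_sum, ← Finset.sum_add_distrib]
      refine Finset.sum_congr rfl fun i _ => ?_
      have h1 : glAct U W _ (matrixUnit he j i) (a * b) =
          glAct U W _ (matrixUnit he j i) a * b +
            SuperSym.twistHom _ (pI j + pI i) a * glAct U W _ (matrixUnit he j i) b :=
        SuperSym.superDeriv_mul _ a b
      -- The twist in the super Leibniz rule is absorbed by moving `z j i` past the value of `a`.
      have h2 := mul_twist_comm hu he hw γ (fun r i => by rw [hγ, ev_genU]; exact hX r i)
        (fun i s => by rw [hγ, ev_genW]; exact hY i s) (hz j i) a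
      rw [h1, map_add, map_add, map_mul, map_mul, map_mul, map_mul, mul_add, ← mul_assoc (z j i),
        ← mul_assoc (z j i), h2, smul_add, smul_mul_assoc, mul_smul_comm, mul_assoc, mul_assoc]
    | ha a b ha hb =>
      rw [map_add, map_add, map_add, ha, hb, ← Finset.sum_add_distrib]
      refine Finset.sum_congr rfl fun j _ => ?_
      rw [← Finset.sum_add_distrib]
      refine Finset.sum_congr rfl fun i _ => ?_
      rw [map_add, map_add, map_add, mul_add, smul_add]
  rw [key]
  refine Finset.sum_eq_zero fun j _ => Finset.sum_eq_zero fun i _ => ?_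
  rw [hf _ (matrixUnit he j i)]
  simp

end Infinitesimal

/-! ### Invariance of the scalar products. -/

section EasyInclusion

variable {U V W : Type*} [AddCommGroup U] [Module ℂ U] [Superspace U]
  [AddCommGroup V] [Module ℂ V] [Superspace V] [AddCommGroup W] [Module ℂ W] [Superspace W]
  {ρ I S : Type*} [Fintype ρ] [Fintype I] [Fintype S] [DecidableEq I]
  {pρ : ρ → ZMod 2} {pI : I → ZMod 2} {pS : S → ZMod 2}
  {u : Module.Basis ρ ℂ U} {e : Module.Basis I ℂ V} {w : Module.Basis S ℂ W}

/-- The sign for passing X over e_i cancels the one in the dual action. What is left is a common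
sign times a difference of two double sums that are exchanged by swapping the summation indices. -/
theorem sum_mul_mem_invariants (hu : IsHomogeneous u pρ) (he : IsHomogeneous e pI) (r : ρ)
    (y : W) : ∑ i, SuperSym.ι ((u r ⊗ₜ e i, 0) : Gens U V W) *
      SuperSym.ι ((0, e.dualBasis i ⊗ₜ y) : Gens U V W) ∈ invariants U V W := by
  intro c X
  have h1 : ∀ i, SuperSym.ι ((u r ⊗ₜ (X : Module.End ℂ V) (e i), 0) : Gens U V W) =
      ∑ j, e.coord j ((X : Module.End ℂ V) (e i)) • SuperSym.ι (u r ⊗ₜ e j, 0) := by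
    intro i
    have h2 := congrArg (SuperSym.ι ∘ₗ LinearMap.inl ℂ (U ⊗[ℂ] V) (Module.Dual ℂ V ⊗[ℂ] W) ∘ₗ
      TensorProduct.mk ℂ U V (u r)) (e.sum_repr ((X : Module.End ℂ V) (e i)))
    rw [map_sum] at h2
    simp only [map_smul] at h2
    exact h2.symm
  have h3 : ∀ i, glAct U W c X (SuperSym.ι ((u r ⊗ₜ e i, 0) : Gens U V W) *
      SuperSym.ι ((0, e.dualBasis i ⊗ₜ y) : Gens U V W)) =
      sgn c (pρ r) • ((∑ j, e.coord j ((X : Module.End ℂ V) (e i)) •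
        (SuperSym.ι (u r ⊗ₜ e j, 0) * SuperSym.ι (0, e.dualBasis i ⊗ₜ y))) -
        ∑ j, e.coord i ((X : Module.End ℂ V) (e j)) •
        (SuperSym.ι (u r ⊗ₜ e i, 0) * SuperSym.ι (0, e.dualBasis j ⊗ₜ y))) := by
    intro i
    have h4 : glAct U W c X (SuperSym.ι ((u r ⊗ₜ e i, 0) : Gens U V W) *
        SuperSym.ι ((0, e.dualBasis i ⊗ₜ y) : Gens U V W)) =
        glAct U W c X (SuperSym.ι (u r ⊗ₜ e i, 0)) * SuperSym.ι (0, e.dualBasis i ⊗ₜ y) +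
        SuperSym.twistHom _ c (SuperSym.ι (u r ⊗ₜ e i, 0)) *
          glAct U W c X (SuperSym.ι (0, e.dualBasis i ⊗ₜ y)) := SuperSym.superDeriv_mul _ _ _
    rw [h4, glAct_x hu, glAct_y he, h1]
    simp only [SuperSym.twistHom, SuperSym.lift_ι, LinearMap.comp_apply,
      twist_of_mem c (x_mem (W := W) hu he r i), map_smul, sgn_add_right]
    rw [smul_sub, sub_eq_add_neg, smul_mul_assoc, Finset.sum_mul]
    congr 1
    · simp only [smul_mul_assoc]
    · rw [smul_mul_assoc, mul_smul_comm, smul_smul, Finset.mul_sum, mul_assoc, mul_neg,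
        sgn_mul_self, mul_neg_one, neg_smul]
      simp only [mul_smul_comm]
  rw [map_sum]
  simp only [h3]
  rw [← Finset.smul_sum, Finset.sum_sub_distrib, Finset.sum_comm, sub_self, smul_zero]

end EasyInclusion

/-! ### Power series in ε over polynomials in t, and the derivative in t. -/

section PowerSeriesPath

open Polynomial

variable {B : Type*} [Ring B] [Algebra ℂ B]

/-- The derivative in the polynomial variable of a power series with polynomial coefficients. -/
def coeffDeriv : PowerSeries B[X] →ₗ[ℂ] PowerSeries B[X] where
  toFun f := PowerSeries.mk fun n => derivative (PowerSeries.coeff n f)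
  map_add' f g := by ext1 n; simp only [map_add, PowerSeries.coeff_mk]
  map_smul' r f := by
    ext1 n
    rw [RingHom.id_apply, PowerSeries.coeff_mk]
    exact (derivative_smul r (PowerSeries.coeff n f)).trans (by
      change _ = r • PowerSeries.coeff n (PowerSeries.mk fun n => derivative (PowerSeries.coeff n
        f))
      rw [PowerSeries.coeff_mk])

theorem coeff_coeffDeriv (f : PowerSeries B[X]) (n : ℕ) :
    PowerSeries.coeff n (coeffDeriv f) = derivative (PowerSeries.coeff n f) := by
  simp [coeffDeriv]

theorem coeffDeriv_mul (f g : PowerSeries B[X]) :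
    coeffDeriv (f * g) = coeffDeriv f * g + f * coeffDeriv g := by
  ext1 n
  rw [map_add, coeff_coeffDeriv, PowerSeries.coeff_mul, PowerSeries.coeff_mul,
    PowerSeries.coeff_mul, map_sum, ← Finset.sum_add_distrib]
  refine Finset.sum_congr rfl fun i _ => ?_
  rw [derivative_mul, coeff_coeffDeriv, coeff_coeffDeriv]

/-- The evaluation of a polynomial at a complex number. -/
def evalAt (c : ℂ) : B[X] →ₐ[ℂ] B :=
  eval₂AlgHom (AlgHom.id ℂ B) (algebraMap ℂ B c) fun b => (Algebra.commutes c b).symm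

@[simp] theorem evalAt_X (c : ℂ) : evalAt (B := B) c X = algebraMap ℂ B c :=
  eval₂_X _ _

@[simp] theorem evalAt_C (c : ℂ) (b : B) : evalAt c (C b) = b :=
  eval₂_C _ _

/-- The evaluation of the coefficients of a power series at a complex number. -/
def evalCoeffs (c : ℂ) : PowerSeries B[X] →ₐ[ℂ] PowerSeries B :=
  PowerSeries.mapAlgHom (evalAt c)

/-- In characteristic zero a polynomial with zero derivative is constant, and this applies to each
coefficient. -/
theorem evalCoeffs_eq (c c' : ℂ) {f : PowerSeries B[X]} (hf : coeffDeriv f = 0) :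
    evalCoeffs c f = evalCoeffs c' f := by
  ext n
  have h := congrArg (PowerSeries.coeff n) hf
  rw [coeff_coeffDeriv, map_zero] at h
  have h2 : PowerSeries.coeff n f = C ((PowerSeries.coeff n f).coeff 0) := by
    ext k
    rcases k with _ | k
    · simp
    · have h3 := congrArg (fun p => Polynomial.coeff p k) h
      simp only [coeff_derivative, coeff_zero] at h3
      rw [coeff_C_succ]
      have h4 : ((k : ℂ) + 1) • (PowerSeries.coeff n f).coeff (k + 1) = 0 := by
        rw [Algebra.smul_def, ← h3, map_add, map_natCast, map_one]
        exact_mod_cast (Nat.cast_commute (k + 1) _).eq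
      exact (smul_eq_zero.1 h4).resolve_left (Nat.cast_add_one_ne_zero k)
  change evalAt c (PowerSeries.coeff n f) = evalAt c' (PowerSeries.coeff n f)
  rw [h2, evalAt_C, evalAt_C]

end PowerSeriesPath

/-! ### From infinitesimal invariance to f(Xz, Y) = f(X, zY). -/

section Balanced

open Polynomial

variable {B : Type*} [Ring B] [Algebra ℂ B]

theorem matrix_map_deriv_mul {I J K : Type*} [Fintype J] (d : B →ₗ[ℂ] B)
    (hd : ∀ a b, d (a * b) = d a * b + a * d b) (M : Matrix I J B) (N : Matrix J K B) :
    (M * N).map d = M.map d * N + M * N.map d := by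
  ext i k
  simp [Matrix.mul_apply, hd, Finset.sum_add_distrib]

/-- The constants in power series with polynomial coefficients. -/
def constHom : B →ₐ[ℂ] PowerSeries B[X] where
  toRingHom := (PowerSeries.C (R := B[X])).comp (Polynomial.C (R := B))
  commutes' r := (PowerSeries.algebraMap_apply (R := ℂ) (A := B[X]) (r := r)).symm

/-- The constants in power series. -/
def seriesConst : B →ₐ[ℂ] PowerSeries B where
  toRingHom := PowerSeries.C (R := B)
  commutes' r := (PowerSeries.algebraMap_apply (R := ℂ) (A := B) (r := r)).symm

theorem constHom_apply (b : B) : constHom b = PowerSeries.C (C b) := rfl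

/-- The inclusion of polynomials into power series. -/
def polyToSeries : B[X] →ₐ[ℂ] PowerSeries B where
  toRingHom := coeToPowerSeries.ringHom
  commutes' r := by
    change ((Polynomial.C (algebraMap ℂ B r) : B[X]) : PowerSeries B) = _
    rw [coe_C, PowerSeries.algebraMap_apply]

theorem evalCoeffs_apply (c : ℂ) (f : PowerSeries B[X]) :
    evalCoeffs c f = PowerSeries.map (evalAt c : B[X] →ₐ[ℂ] B).toRingHom f := rfl

theorem polyToSeries_injective : Function.Injective (polyToSeries (B := B)) :=
  Polynomial.coe_injective B

@[simp] theorem coeffDeriv_constHom_mul_X_pow (b : B) (k : ℕ) :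
    coeffDeriv (constHom b * PowerSeries.X ^ k) = 0 := by
  ext1 n
  rw [coeff_coeffDeriv, map_zero]
  rw [constHom_apply, PowerSeries.coeff_C_mul, PowerSeries.coeff_X_pow]
  split_ifs <;> simp

variable {I : Type*} [Fintype I] [DecidableEq I]

/-- The matrix `ε t z`. -/
def pathN (z : Matrix I I B) : Matrix I I (PowerSeries B[X]) :=
  Matrix.of fun i j => PowerSeries.C (C (z i j) * X) * PowerSeries.X

theorem pathN_apply (z : Matrix I I B) (i j : I) :
    pathN z i j = PowerSeries.C (C (z i j) * X) * PowerSeries.X := rfl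

/-- The matrix `ε z`. -/
def pathZ (z : Matrix I I B) : Matrix I I (PowerSeries B[X]) :=
  Matrix.of fun i j => constHom (z i j) * PowerSeries.X ^ 1

theorem pathZ_apply (z : Matrix I I B) (i j : I) :
    pathZ z i j = constHom (z i j) * PowerSeries.X ^ 1 := rfl

/-- The inverse of `1 + ε t z`. -/
def pathQ (z : Matrix I I B) : Matrix I I (PowerSeries B[X]) :=
  Matrix.of fun i j => PowerSeries.mk fun k => C (((-z) ^ k) i j) * X ^ k

theorem pathQ_apply (z : Matrix I I B) (i j : I) :
    pathQ z i j = PowerSeries.mk fun k => C (((-z) ^ k) i j) * X ^ k := rfl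

theorem map_pathN (z : Matrix I I B) : (pathN z).map coeffDeriv = pathZ z := by
  refine Matrix.ext fun i j => ?_
  ext1 n
  simp only [Matrix.map_apply, pathN_apply, pathZ_apply, coeff_coeffDeriv]
  rw [constHom_apply, pow_one, PowerSeries.coeff_C_mul, PowerSeries.coeff_C_mul,
    PowerSeries.coeff_X]
  split_ifs <;> simp

/-- The geometric series telescopes: in degree n + 1 the coefficients are (-z)^(n+1) and (-z)^n z,
times t^(n+1). The series variable ε makes the inverse exist for every z. -/
theorem pathQ_mul (z : Matrix I I B) : pathQ z * (1 + pathN z) = 1 := by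
  rw [mul_add, mul_one]
  refine Matrix.ext fun i j => ?_
  ext1 n
  rw [Matrix.add_apply, map_add, Matrix.mul_apply, map_sum, Matrix.one_apply]
  rcases n with _ | n
  · have h : ∀ k, PowerSeries.coeff 0 (pathQ z i k * pathN z k j) = 0 := by
      intro k
      rw [pathN_apply, ← mul_assoc]
      simp
    rw [Finset.sum_eq_zero fun k _ => h k]
    simp only [pathQ_apply, PowerSeries.coeff_mk, pow_zero, mul_one, add_zero, Matrix.one_apply]
    split_ifs <;> simp
  · have h : ∀ k, PowerSeries.coeff (n + 1) (pathQ z i k * pathN z k j) =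
        C (((-z) ^ n) i k * z k j) * X ^ (n + 1) := by
      intro k
      rw [pathN_apply, ← mul_assoc, PowerSeries.coeff_succ_mul_X, PowerSeries.coeff_mul_C,
        pathQ_apply,
        PowerSeries.coeff_mk, mul_assoc, ← mul_assoc (X ^ n), X_pow_mul_C, C_mul, pow_succ,
        mul_assoc, mul_assoc]
    have h2 : PowerSeries.coeff (n + 1) (if i = j then (1 : PowerSeries B[X]) else 0) = 0 := by
      split_ifs <;> simp [PowerSeries.coeff_one]
    simp only [h]
    rw [h2, pathQ_apply, PowerSeries.coeff_mk, pow_succ, Matrix.mul_apply, ← Finset.sum_mul,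
      ← add_mul,
      ← map_sum, ← C_add]
    simp

theorem mul_pathQ (z : Matrix I I B) : (1 + pathN z) * pathQ z = 1 := by
  rw [add_mul, one_mul]
  refine Matrix.ext fun i j => ?_
  ext1 n
  rw [Matrix.add_apply, map_add, Matrix.mul_apply, map_sum, Matrix.one_apply]
  rcases n with _ | n
  · have h : ∀ k, PowerSeries.coeff 0 (pathN z i k * pathQ z k j) = 0 := by
      intro k
      rw [pathN_apply, mul_assoc]
      simp
    rw [Finset.sum_eq_zero fun k _ => h k]
    simp only [pathQ_apply, PowerSeries.coeff_mk, pow_zero, mul_one, add_zero, Matrix.one_apply]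
    split_ifs <;> simp
  · have h : ∀ k, PowerSeries.coeff (n + 1) (pathN z i k * pathQ z k j) =
        C (z i k * ((-z) ^ n) k j) * X ^ (n + 1) := by
      intro k
      rw [pathN_apply, mul_assoc, PowerSeries.coeff_C_mul, PowerSeries.coeff_succ_X_mul,
        pathQ_apply,
        PowerSeries.coeff_mk, mul_assoc, ← mul_assoc X, X_mul_C, C_mul, pow_succ',
        mul_assoc, mul_assoc]
    have h2 : PowerSeries.coeff (n + 1) (if i = j then (1 : PowerSeries B[X]) else 0) = 0 := by
      split_ifs <;> simp [PowerSeries.coeff_one]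
    simp only [h]
    rw [h2, pathQ_apply, PowerSeries.coeff_mk, pow_succ', Matrix.mul_apply, ← Finset.sum_mul,
      ← add_mul,
      ← map_sum, ← C_add]
    simp

theorem map_constHom_deriv {J K : Type*} (M : Matrix J K B) :
    (M.map constHom).map coeffDeriv = 0 := by
  refine Matrix.ext fun i j => ?_
  have h := coeffDeriv_constHom_mul_X_pow (M i j) 0
  rw [pow_zero, mul_one] at h
  exact h

theorem map_pathZ_deriv (z : Matrix I I B) : (pathZ z).map coeffDeriv = 0 := by
  refine Matrix.ext fun i j => ?_
  exact coeffDeriv_constHom_mul_X_pow (z i j) 1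

theorem map_one_deriv : (1 : Matrix I I (PowerSeries B[X])).map coeffDeriv = 0 := by
  have h := map_constHom_deriv (1 : Matrix I I B)
  rwa [Matrix.map_one constHom (map_zero _) (map_one _)] at h

/-- Differentiate Q(1 + εtz) = 1 and multiply by Q on the right. -/
theorem map_pathQ_deriv (z : Matrix I I B) :
    (pathQ z).map coeffDeriv = -(pathQ z * pathZ z * pathQ z) := by
  have h := matrix_map_deriv_mul coeffDeriv coeffDeriv_mul (pathQ z) (1 + pathN z)
  rw [pathQ_mul, map_one_deriv, Matrix.map_add _ (map_add _), map_one_deriv, map_pathN,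
    zero_add] at h
  calc (pathQ z).map coeffDeriv
      = (pathQ z).map coeffDeriv * ((1 + pathN z) * pathQ z) := by rw [mul_pathQ, mul_one]
    _ = (pathQ z).map coeffDeriv * (1 + pathN z) * pathQ z := by rw [mul_assoc]
    _ = -(pathQ z * pathZ z) * pathQ z := by rw [eq_neg_of_add_eq_zero_left h.symm]
    _ = _ := by rw [neg_mul]

variable [SCAlg B]

theorem constHom_mem {c : ZMod 2} {b : B} (hb : b ∈ pt (B := B) c) :
    constHom b ∈ pt (B := PowerSeries B[X]) c := by
  refine powerSeries_mem_pt_iff.2 fun n => polynomial_mem_pt_iff.2 fun k => ?_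
  rw [constHom_apply, PowerSeries.coeff_C]
  split_ifs
  · rw [coeff_C]
    split_ifs
    · exact hb
    · exact Submodule.zero_mem _
  · exact Submodule.zero_mem _

theorem C_mul_X_pow_mem {c : ZMod 2} {b : B} (hb : b ∈ pt (B := B) c) (k : ℕ) :
    C b * X ^ k ∈ pt (B := B[X]) c := by
  intro n
  rw [coeff_C_mul, coeff_X_pow, mul_ite, mul_one, mul_zero]
  split_ifs
  · exact hb
  · exact Submodule.zero_mem _

theorem series_C_mul_X_pow_mem {c : ZMod 2} {b : B} (hb : b ∈ pt (B := B) c) (k : ℕ) :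
    PowerSeries.C b * PowerSeries.X ^ k ∈ pt (B := PowerSeries B) c := by
  intro n
  rw [PowerSeries.coeff_C_mul, PowerSeries.coeff_X_pow, mul_ite, mul_one, mul_zero]
  split_ifs
  · exact hb
  · exact Submodule.zero_mem _

variable {pI : I → ZMod 2}

theorem pathN_even {z : Matrix I I B} (hz : IsEvenMatrix pI pI z) :
    IsEvenMatrix pI pI (pathN z) := fun i j => by
  have h := series_C_mul_X_pow_mem (C_mul_X_pow_mem (hz i j) 1) 1
  rwa [pow_one, pow_one] at h

theorem pathZ_even {z : Matrix I I B} (hz : IsEvenMatrix pI pI z) :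
    IsEvenMatrix pI pI (pathZ z) := fun i j => by
  have h := C_mul_X_pow_mem (hz i j) 0
  rw [pow_zero, mul_one] at h
  exact series_C_mul_X_pow_mem (B := B[X]) h 1

theorem pathQ_even {z : Matrix I I B} (hz : IsEvenMatrix pI pI z) :
    IsEvenMatrix pI pI (pathQ z) := fun i j n => by
  rw [pathQ_apply, PowerSeries.coeff_mk]
  exact C_mul_X_pow_mem (hz.neg.pow n i j) n

/-- Evaluation is natural in the coefficient algebra, since both sides agree on generators. The
images of the matrices are separate variables so that they can be supplied in simplified form. -/
theorem ev_map {ρ S : Type*} {pρ : ρ → ZMod 2} {pS : S → ZMod 2} {B' : Type*} [Ring B']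
    [Algebra ℂ B'] [SCAlg B'] (φ : B →ₐ[ℂ] B') {X : Matrix ρ I B} {Y : Matrix I S B}
    (hX : IsEvenMatrix pρ pI X) (hY : IsEvenMatrix pI pS Y) {X' : Matrix ρ I B'}
    {Y' : Matrix I S B'} (hX' : IsEvenMatrix pρ pI X') (hY' : IsEvenMatrix pI pS Y')
    (h1 : X.map φ = X') (h2 : Y.map φ = Y') (f : MatAlg pρ pI pS) :
    φ (ev X Y hX hY f) = ev X' Y' hX' hY' f := by
  subst h1 h2
  have h : φ.comp (ev X Y hX hY) = ev _ _ hX' hY' :=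
    matAlg_hom_ext (fun r i => by simp) (fun i s => by simp)
  exact DFunLike.congr_fun h f

variable {U V W : Type*} [AddCommGroup U] [Module ℂ U] [Superspace U]
  [AddCommGroup V] [Module ℂ V] [Superspace V] [AddCommGroup W] [Module ℂ W] [Superspace W]
  {ρ S : Type*} [Fintype ρ] [Fintype S] {pρ : ρ → ZMod 2} {pS : S → ZMod 2}
  {u : Module.Basis ρ ℂ U} {e : Module.Basis I ℂ V} {w : Module.Basis S ℂ W}

/-- The path is P = X(1 + εtz), R = Q(1 + εz)Y with Q = (1 + εtz)⁻¹. Its endpoints are (X(1 + εz),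
Y) at t = 1 and (X, (1 + εz)Y) at t = 0. -/
theorem ev_invariant_series (hu : IsHomogeneous u pρ) (he : IsHomogeneous e pI)
    (hw : IsHomogeneous w pS) {f : SuperSym (Gens U V W)} (hf : f ∈ invariants U V W)
    {X : Matrix ρ I B} {Y : Matrix I S B} {z : Matrix I I B} (hX : IsEvenMatrix pρ pI X)
    (hY : IsEvenMatrix pI pS Y) (hz : IsEvenMatrix pI pI z)
    {X' : Matrix ρ I (PowerSeries B)} {Y' : Matrix I S (PowerSeries B)}
    {z' : Matrix I I (PowerSeries B)} (hX' : IsEvenMatrix pρ pI X')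
    (hY' : IsEvenMatrix pI pS Y') (hz' : IsEvenMatrix pI pI z') (eX : X.map seriesConst = X')
    (eY : Y.map seriesConst = Y')
    (ez : (fun i j => PowerSeries.C (z i j) * PowerSeries.X : Matrix I I (PowerSeries B)) = z') :
    ev (X' * (1 + z')) Y' (hX'.mul ((IsEvenMatrix.one pI).add hz')) hY' (toModel hu he hw f) =
      ev X' ((1 + z') * Y') hX' (((IsEvenMatrix.one pI).add hz').mul hY')
        (toModel hu he hw f) := by
  have hXc : IsEvenMatrix pρ pI (X.map constHom) := fun r i => constHom_mem (hX r i)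
  have hYc : IsEvenMatrix pI pS (Y.map constHom) := fun r i => constHom_mem (hY r i)
  have h1 := IsEvenMatrix.one (B := PowerSeries B[X]) pI
  have hP : IsEvenMatrix pρ pI (X.map constHom * (1 + pathN z)) :=
    hXc.mul (h1.add (pathN_even hz))
  have hR : IsEvenMatrix pI pS (pathQ z * ((1 + pathZ z) * Y.map constHom)) :=
    (pathQ_even hz).mul ((h1.add (pathZ_even hz)).mul hYc)
  -- With w = Qεz one has P' = Xεz = Pw, because (1 + εtz)Q = 1, and R' = -QεzQ(1 + εz)Y = -wR.
  have hd := deriv_eval_eq_zero hu he hw coeffDeriv coeffDeriv_mul hP hR (pathQ z * pathZ z)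
    ((pathQ_even hz).mul (pathZ_even hz)) (fun r i => by
      have h := congrFun (congrFun
        (matrix_map_deriv_mul coeffDeriv coeffDeriv_mul (X.map constHom) (1 + pathN z)) r) i
      rw [map_constHom_deriv, Matrix.map_add _ (map_add _), map_one_deriv, map_pathN,
        Matrix.zero_mul,
        zero_add, zero_add] at h
      rw [Matrix.mul_assoc, ← Matrix.mul_assoc (1 + pathN z), mul_pathQ, Matrix.one_mul]
      exact h)
    (fun i s => by
      have h0 := matrix_map_deriv_mul coeffDeriv coeffDeriv_mul (1 + pathZ z) (Y.map constHom)
      rw [map_constHom_deriv, Matrix.map_add _ (map_add _), map_one_deriv, map_pathZ_deriv,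
        zero_add, Matrix.zero_mul, Matrix.mul_zero, zero_add] at h0
      have h := matrix_map_deriv_mul coeffDeriv coeffDeriv_mul (pathQ z)
          ((1 + pathZ z) * Y.map constHom)
      rw [h0, Matrix.mul_zero, add_zero, map_pathQ_deriv, Matrix.neg_mul, Matrix.mul_assoc] at h
      exact congrFun (congrFun h i) s) hf
  have hev := evalCoeffs_eq 1 0 hd
  have eC : ∀ (c : ℂ) (b : B), evalCoeffs c (constHom b) = PowerSeries.C b := fun c b => by
    rw [constHom_apply, evalCoeffs_apply, PowerSeries.map_C]
    congr 1
    exact evalAt_C c b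
  have eZ : ∀ c : ℂ, (pathZ z).map (evalCoeffs c) = z' := fun c => by
    subst ez
    refine Matrix.ext fun i j => ?_
    rw [Matrix.map_apply, pathZ_apply, map_mul, eC, pow_one]
    congr 1
    exact PowerSeries.map_X _
  have eN : ∀ c : ℂ, (pathN z).map (evalCoeffs c) = c • z' := fun c => by
    subst ez
    refine Matrix.ext fun i j => ?_
    rw [Matrix.map_apply, pathN_apply, map_mul]
    change _ = c • (PowerSeries.C (z i j) * PowerSeries.X)
    rw [← smul_mul_assoc]
    congr 1
    · rw [evalCoeffs_apply, PowerSeries.map_C]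
      change PowerSeries.C (evalAt c (C (z i j) * Polynomial.X)) = _
      rw [map_mul, evalAt_C, evalAt_X, ← Algebra.commutes, ← Algebra.smul_def]
      exact map_smul (seriesConst (B := B)) c (z i j)
    · exact PowerSeries.map_X _
  have eQ : ∀ c : ℂ, (pathQ z).map (evalCoeffs c) * (1 + c • z') = 1 := fun c => by
    have h := congrArg (fun M => Matrix.map M (evalCoeffs c)) (pathQ_mul z)
    simp only [Matrix.map_mul, Matrix.map_add _ (map_add (evalCoeffs (B := B) c)), eN,
      Matrix.map_one _ (map_zero (evalCoeffs (B := B) c)) (map_one (evalCoeffs (B := B) c))] at h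
    exact h
  have eXc : ∀ c : ℂ, (X.map constHom).map (evalCoeffs c) = X' := fun c => by
    rw [← eX]; exact Matrix.ext fun i j => eC c _
  have eYc : ∀ c : ℂ, (Y.map constHom).map (evalCoeffs c) = Y' := fun c => by
    rw [← eY]; exact Matrix.ext fun i j => eC c _
  rw [ev_map (evalCoeffs 1) hP hR (hX'.mul ((IsEvenMatrix.one pI).add hz')) hY',
    ev_map (evalCoeffs 0) hP hR hX' (((IsEvenMatrix.one pI).add hz').mul hY')] at hev
  · exact hev
  · rw [Matrix.map_mul, Matrix.map_add _ (map_add _), eXc, eN, zero_smul, add_zero,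
      Matrix.map_one _ (map_zero _) (map_one _), Matrix.mul_one]
  · have h := eQ 0
    rw [zero_smul, add_zero, mul_one] at h
    rw [Matrix.map_mul, Matrix.map_mul, Matrix.map_add _ (map_add _), eYc, eZ, h,
      Matrix.map_one _ (map_zero _) (map_one _), Matrix.one_mul]
  · rw [Matrix.map_mul, Matrix.map_add _ (map_add _), eXc, eN, one_smul,
      Matrix.map_one _ (map_zero _) (map_one _)]
  · have h := eQ 1
    rw [one_smul] at h
    rw [Matrix.map_mul, Matrix.map_mul, Matrix.map_add _ (map_add _), eYc, eZ,
      Matrix.map_one _ (map_zero _) (map_one _), ← Matrix.mul_assoc, h, Matrix.one_mul]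

/-- The integrated form of invariance. -/
theorem isBalanced_of_mem_invariants (hu : IsHomogeneous u pρ) (he : IsHomogeneous e pI)
    (hw : IsHomogeneous w pS) {f : SuperSym (Gens U V W)} (hf : f ∈ invariants U V W) :
    IsBalanced (toModel hu he hw f) := by
  intro β pβ X Y z₀ hX hY hz₀
  obtain ⟨z, rfl⟩ : ∃ z, z₀ = 1 + z := ⟨z₀ - 1, by abel⟩
  have hz : IsEvenMatrix pI pI z := by
    have h := hz₀.add (IsEvenMatrix.one pI).neg
    rwa [add_comm 1 z, add_neg_cancel_right] at h
  have h1 := IsEvenMatrix.one (B := (FS pβ)[X]) pI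
  have hXc : IsEvenMatrix pρ pI (X.map (C : FS pβ →+* _)) := fun r i => by
    have h := C_mul_X_pow_mem (hX r i) 0
    rwa [pow_zero, mul_one] at h
  have hYc : IsEvenMatrix pI pS (Y.map (C : FS pβ →+* _)) := fun r i => by
    have h := C_mul_X_pow_mem (hY r i) 0
    rwa [pow_zero, mul_one] at h
  set zc : Matrix I I (FS pβ)[X] := fun i j => C (z i j) * Polynomial.X ^ 1 with hzc
  have hzc' : IsEvenMatrix pI pI zc := fun i j => C_mul_X_pow_mem (hz i j) 1
  have hXs : IsEvenMatrix pρ pI (X.map seriesConst) := fun r i => by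
    have h := series_C_mul_X_pow_mem (hX r i) 0
    rw [pow_zero, mul_one] at h
    exact h
  have hYs : IsEvenMatrix pI pS (Y.map seriesConst) := fun r i => by
    have h := series_C_mul_X_pow_mem (hY r i) 0
    rw [pow_zero, mul_one] at h
    exact h
  have hzs : IsEvenMatrix pI pI
      (fun i j => PowerSeries.C (z i j) * PowerSeries.X : Matrix I I (PowerSeries (FS pβ))) :=
    fun i j => by
      have h := series_C_mul_X_pow_mem (hz i j) 1
      rwa [pow_one] at h
  have hs := ev_invariant_series hu he hw hf hX hY hz hXs hYs hzs rfl rfl rfl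
  have eX : (X.map (C : FS pβ →+* _)).map polyToSeries = X.map seriesConst := by
    exact Matrix.ext fun i j => coe_C _
  have eY : (Y.map (C : FS pβ →+* _)).map polyToSeries = Y.map seriesConst := by
    exact Matrix.ext fun i j => coe_C _
  have ez : zc.map polyToSeries = fun i j => PowerSeries.C (z i j) * PowerSeries.X := by
    refine Matrix.ext fun i j => ?_
    rw [Matrix.map_apply, hzc, pow_one, map_mul]
    congr 1
    · exact coe_C _
    · exact coe_X
  have hp : ev (X.map (C : FS pβ →+* _) * (1 + zc)) (Y.map (C : FS pβ →+* _))
      (hXc.mul (h1.add hzc')) hYc (toModel hu he hw f) =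
      ev (X.map (C : FS pβ →+* _)) ((1 + zc) * Y.map (C : FS pβ →+* _)) hXc
        ((h1.add hzc').mul hYc) (toModel hu he hw f) := by
    -- Both sides have polynomial entries in ε, so the identity of power series descends to
    -- polynomials, where ε = 1 can be substituted.
    apply polyToSeries_injective
    rw [ev_map polyToSeries (hXc.mul (h1.add hzc')) hYc
        (hXs.mul ((IsEvenMatrix.one pI).add hzs)) hYs,
      ev_map polyToSeries hXc ((h1.add hzc').mul hYc) hXs
        (((IsEvenMatrix.one pI).add hzs).mul hYs), hs]
    · exact eX
    · rw [Matrix.map_mul, Matrix.map_add _ (map_add _), Matrix.map_one _ (map_zero _) (map_one _),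
        eY, ez]
    · rw [Matrix.map_mul, Matrix.map_add _ (map_add _), Matrix.map_one _ (map_zero _) (map_one _),
        eX, ez]
    · exact eY
  have h := congrArg (evalAt 1) hp
  have eX' : (X.map (C : FS pβ →+* _)).map (evalAt 1) = X := by
    exact Matrix.ext fun i j => evalAt_C _ _
  have eY' : (Y.map (C : FS pβ →+* _)).map (evalAt 1) = Y := by
    exact Matrix.ext fun i j => evalAt_C _ _
  have ez' : zc.map (evalAt 1) = z := by
    refine Matrix.ext fun i j => ?_
    rw [Matrix.map_apply]
    simp [hzc]
  rw [ev_map (evalAt 1) (hXc.mul (h1.add hzc')) hYc (hX.mul hz₀) hY,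
    ev_map (evalAt 1) hXc ((h1.add hzc').mul hYc) hX (hz₀.mul hY)] at h
  · exact h
  · exact eX'
  · rw [Matrix.map_mul, Matrix.map_add _ (map_add _), Matrix.map_one _ (map_zero _) (map_one _),
      eY', ez']
  · rw [Matrix.map_mul, Matrix.map_add _ (map_add _), Matrix.map_one _ (map_zero _) (map_one _),
      eX', ez']
  · exact eY'

end Balanced

/-! ### Tensor decomposition and contraction with functionals. -/

section Slices

namespace FS

variable {κ α β : Type*} {pκ : κ → ZMod 2} {pα : α → ZMod 2} {pβ : β → ZMod 2}

variable (pκ pα) in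
/-- The subalgebra of the generators of the first kind. -/
def inclL : FS pκ →ₐ[ℂ] FS (Sum.elim pκ pα) :=
  subst (fun k => X _ (Sum.inl k)) fun k => X_mem (Sum.inl k)

variable (pκ pα) in
/-- The subalgebra of the generators of the second kind. -/
def inclR : FS pα →ₐ[ℂ] FS (Sum.elim pκ pα) :=
  subst (fun k => X _ (Sum.inr k)) fun k => X_mem (Sum.inr k)

@[simp] theorem inclL_X (k : κ) : inclL pκ pα (X pκ k) = X _ (Sum.inl k) := subst_X _ _ _

@[simp] theorem inclR_X (k : α) : inclR pκ pα (X pα k) = X _ (Sum.inr k) := subst_X _ _ _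

theorem inclL_mem {c : ZMod 2} {f : FS pκ} (hf : f ∈ pt (B := FS pκ) c) :
    inclL pκ pα f ∈ pt (B := FS (Sum.elim pκ pα)) c := subst_mem _ _ hf

theorem inclR_mem {c : ZMod 2} {f : FS pα} (hf : f ∈ pt (B := FS pα) c) :
    inclR pκ pα f ∈ pt (B := FS (Sum.elim pκ pα)) c := subst_mem _ _ hf

theorem word_mem (l : List κ) : (l.map (X pκ)).prod ∈ pt (B := FS pκ) (l.map pκ).sum :=
  list_prod_mem pκ (X pκ) X_mem l

/-- Every element is a combination of words in which the generators of the first kind precede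
those of the second kind. -/
theorem mem_span_sorted (F : FS (Sum.elim pκ pα)) :
    F ∈ Submodule.span ℂ (Set.range fun l : List κ × List α =>
      inclL pκ pα (l.1.map (X pκ)).prod * inclR pκ pα (l.2.map (X pα)).prod) := by
  refine Submodule.span_le.2 ?_ (mem_span_words F)
  rintro _ ⟨l, rfl⟩
  dsimp only
  suffices h : ∃ (c : ℂ) (a : List κ) (b : List α), (l.map (X (Sum.elim pκ pα))).prod =
      c • (inclL pκ pα (a.map (X pκ)).prod * inclR pκ pα (b.map (X pα)).prod) by
    obtain ⟨c, a, b, h⟩ := h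
    rw [h]
    exact Submodule.smul_mem _ _ (Submodule.subset_span ⟨(a, b), rfl⟩)
  induction l with
  | nil => exact ⟨1, [], [], by simp⟩
  | cons k l ih =>
    obtain ⟨c, a, b, h⟩ := ih
    rcases k with k | k
    · exact ⟨c, k :: a, b, by simp [h, mul_assoc]⟩
    -- The new generator of the second kind is moved past the word `a` of the first kind.
    · refine ⟨c * sgn (pα k) (a.map pκ).sum, a, k :: b, ?_⟩
      have h1 := comm (X_mem (par := Sum.elim pκ pα) (Sum.inr k))
        (inclL_mem (pα := pα) (word_mem (pκ := pκ) a))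
      rw [List.map_cons, List.prod_cons, h, mul_smul_comm, ← mul_assoc, h1, smul_mul_assoc,
        smul_smul, List.map_cons, List.prod_cons, map_mul, inclR_X, mul_assoc]
      rfl

/-- Scalars and zero need no cases of their own: they are absorbed in the factor `f`. -/
theorem induction_sorted {P : FS (Sum.elim pκ pα) → Prop}
    (hm : ∀ f g, P (inclL pκ pα f * inclR pκ pα g)) (ha : ∀ a b, P a → P b → P (a + b))
    (F : FS (Sum.elim pκ pα)) : P F := by
  obtain ⟨c, hc⟩ := (Finsupp.mem_span_range_iff_exists_finsupp).1 (mem_span_sorted F)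
  rw [← hc]
  refine Finset.sum_induction _ P ha (by simpa using hm 0 0) fun l _ => ?_
  beta_reduce
  rw [← smul_mul_assoc, ← map_smul]
  exact hm _ _

theorem twistHom_mulLeft (c : ZMod 2) (k : κ) (f : FS pκ) :
    twistHom pκ c (X pκ k * f) = sgn c (pκ k) • (X pκ k * twistHom pκ c f) := by
  rw [map_mul, twistHom_X, smul_mul_assoc]

theorem twistHom_comm (c d : ZMod 2) (f : FS pκ) :
    twistHom pκ c (twistHom pκ d f) = twistHom pκ d (twistHom pκ c f) := by
  have h : (twistHom pκ c).comp (twistHom pκ d) = (twistHom pκ d).comp (twistHom pκ c) := by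
    refine hom_ext fun k => ?_
    simp only [AlgHom.comp_apply, twistHom_X, map_smul]
    rw [smul_comm]
  exact DFunLike.congr_fun h f

variable (pκ pα) in
/-- The action on the tensor product by signed left multiplications. -/
def tensorAction : FS (Sum.elim pκ pα) →ₐ[ℂ] Module.End ℂ (FS pκ ⊗[ℂ] FS pα) :=
  lift (Sum.elim
    (fun k => TensorProduct.map (LinearMap.mulLeft ℂ (X pκ k)) LinearMap.id)
    (fun a => TensorProduct.map (twistHom pκ (pα a)).toLinearMap (LinearMap.mulLeft ℂ (X pα a))))
    (by
      rintro (a | a) (b | b) <;> refine TensorProduct.ext' fun x y => ?_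
      · simp only [Sum.elim_inl, Module.End.mul_apply, LinearMap.smul_apply,
          TensorProduct.map_tmul, LinearMap.mulLeft_apply, LinearMap.id_apply]
        rw [← mul_assoc, X_mul_X, smul_mul_assoc, TensorProduct.smul_tmul', mul_assoc]
      · simp only [Sum.elim_inl, Sum.elim_inr, Module.End.mul_apply, LinearMap.smul_apply,
          TensorProduct.map_tmul, LinearMap.mulLeft_apply, LinearMap.id_apply,
          AlgHom.toLinearMap_apply]
        rw [twistHom_mulLeft, TensorProduct.smul_tmul', smul_smul, sgn_comm (pα b), sgn_mul_self,
          one_smul]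
      · simp only [Sum.elim_inl, Sum.elim_inr, Module.End.mul_apply, LinearMap.smul_apply,
          TensorProduct.map_tmul, LinearMap.mulLeft_apply, LinearMap.id_apply,
          AlgHom.toLinearMap_apply]
        rw [twistHom_mulLeft, TensorProduct.smul_tmul']
      · simp only [Sum.elim_inr, Module.End.mul_apply, LinearMap.smul_apply,
          TensorProduct.map_tmul, LinearMap.mulLeft_apply,
          AlgHom.toLinearMap_apply]
        rw [← mul_assoc, X_mul_X, smul_mul_assoc, TensorProduct.tmul_smul, mul_assoc,
          twistHom_comm])

theorem tensorAction_inclL (k x : FS pκ) (y : FS pα) :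
    tensorAction pκ pα (inclL pκ pα k) (x ⊗ₜ y) = (k * x) ⊗ₜ y := by
  induction k using FS.induction generalizing x with
  | h0 r =>
    rw [AlgHom.commutes, AlgHom.commutes, Module.algebraMap_end_apply,
      Algebra.algebraMap_eq_smul_one,
      smul_mul_assoc, one_mul, TensorProduct.smul_tmul']
  | h1 k => simp [tensorAction]
  | hm a b ha hb => rw [map_mul, map_mul, Module.End.mul_apply, hb, ha, mul_assoc]
  | ha a b ha hb => rw [map_add, map_add, LinearMap.add_apply, hb, ha, add_mul,
      TensorProduct.add_tmul]

/-- Generators of the second kind twist the left factor, but the twist fixes 1, so no sign appears.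
-/
theorem tensorAction_inclR (a y : FS pα) :
    tensorAction pκ pα (inclR pκ pα a) (1 ⊗ₜ y) = 1 ⊗ₜ (a * y) := by
  induction a using FS.induction generalizing y with
  | h0 r =>
    rw [AlgHom.commutes, AlgHom.commutes, Module.algebraMap_end_apply,
      Algebra.algebraMap_eq_smul_one,
      smul_mul_assoc, one_mul, TensorProduct.tmul_smul]
  | h1 k => simp [tensorAction]
  | hm a b ha hb => rw [map_mul, map_mul, Module.End.mul_apply, hb, ha, mul_assoc]
  | ha a b ha hb => rw [map_add, map_add, LinearMap.add_apply, hb, ha, add_mul,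
      TensorProduct.tmul_add]

variable (pκ pα) in
/-- The decomposition of a free supercommutative algebra as a tensor product. -/
def toTensor : FS (Sum.elim pκ pα) →ₗ[ℂ] FS pκ ⊗[ℂ] FS pα :=
  LinearMap.applyₗ (1 ⊗ₜ 1) ∘ₗ (tensorAction pκ pα).toLinearMap

/-- Acting on 1 ⊗ 1 separates the two groups of variables. This makes the contractions well defined
on sorted products. -/
theorem toTensor_mul (k : FS pκ) (a : FS pα) :
    toTensor pκ pα (inclL pκ pα k * inclR pκ pα a) = k ⊗ₜ a := by
  change tensorAction pκ pα (inclL pκ pα k * inclR pκ pα a) (1 ⊗ₜ 1) = k ⊗ₜ a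
  rw [map_mul, Module.End.mul_apply, tensorAction_inclR, tensorAction_inclL, mul_one, mul_one]

/-- The contraction of the first tensor factor with a functional. -/
def sliceL (φ : FS pκ →ₗ[ℂ] ℂ) : FS (Sum.elim pκ pα) →ₗ[ℂ] FS pα :=
  (TensorProduct.lid ℂ (FS pα)).toLinearMap ∘ₗ TensorProduct.map φ LinearMap.id ∘ₗ toTensor pκ pα

/-- The contraction of the second tensor factor with a functional. -/
def sliceR (η : FS pα →ₗ[ℂ] ℂ) : FS (Sum.elim pκ pα) →ₗ[ℂ] FS pκ :=
  (TensorProduct.rid ℂ (FS pκ)).toLinearMap ∘ₗ TensorProduct.map LinearMap.id η ∘ₗ toTensor pκ pα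

theorem sliceL_mul (φ : FS pκ →ₗ[ℂ] ℂ) (k : FS pκ) (a : FS pα) :
    sliceL φ (inclL pκ pα k * inclR pκ pα a) = φ k • a := by
  simp [sliceL, toTensor_mul]

theorem sliceR_mul (η : FS pα →ₗ[ℂ] ℂ) (k : FS pκ) (a : FS pα) :
    sliceR η (inclL pκ pα k * inclR pκ pα a) = η a • k := by
  simp [sliceR, toTensor_mul]

/-- The substitution for the generators of the second kind. -/
def mapR (pκ : κ → ZMod 2) (g : α → FS pβ) (hg : ∀ a, g a ∈ pt (B := FS pβ) (pα a)) :
    FS (Sum.elim pκ pα) →ₐ[ℂ] FS (Sum.elim pκ pβ) :=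
  subst (Sum.elim (fun k => X _ (Sum.inl k)) fun a => inclR pκ pβ (g a)) (by
    rintro (k | a)
    · exact X_mem (Sum.inl k)
    · exact inclR_mem (hg a))

theorem mapR_inl (g : α → FS pβ) (hg : ∀ a, g a ∈ pt (B := FS pβ) (pα a)) (k : κ) :
    mapR pκ g hg (X _ (Sum.inl k)) = X _ (Sum.inl k) := subst_X _ _ _

theorem mapR_inr (g : α → FS pβ) (hg : ∀ a, g a ∈ pt (B := FS pβ) (pα a)) (a : α) :
    mapR pκ g hg (X _ (Sum.inr a)) = inclR pκ pβ (g a) := subst_X _ _ _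

theorem mapR_inclL (g : α → FS pβ) (hg : ∀ a, g a ∈ pt (B := FS pβ) (pα a)) (f : FS pκ) :
    mapR pκ g hg (inclL pκ pα f) = inclL pκ pβ f := by
  have h : (mapR pκ g hg).comp (inclL pκ pα) = inclL pκ pβ :=
    hom_ext fun k => by rw [AlgHom.comp_apply, inclL_X, inclL_X, mapR_inl]
  exact DFunLike.congr_fun h f

theorem mapR_inclR (g : α → FS pβ) (hg : ∀ a, g a ∈ pt (B := FS pβ) (pα a)) (f : FS pα) :
    mapR pκ g hg (inclR pκ pα f) = inclR pκ pβ (subst g hg f) := by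
  have h : (mapR pκ g hg).comp (inclR pκ pα) = (inclR pκ pβ).comp (subst g hg) :=
    hom_ext fun k => by rw [AlgHom.comp_apply, AlgHom.comp_apply, inclR_X, subst_X, mapR_inr]
  exact DFunLike.congr_fun h f

/-- Extracting a coefficient in the auxiliary parameters commutes with substitution in the other
variables. -/
theorem sliceL_mapR (φ : FS pκ →ₗ[ℂ] ℂ) (g : α → FS pβ)
    (hg : ∀ a, g a ∈ pt (B := FS pβ) (pα a)) (F : FS (Sum.elim pκ pα)) :
    sliceL φ (mapR pκ g hg F) = subst g hg (sliceL φ F) := by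
  induction F using induction_sorted with
  | hm f g => rw [map_mul, mapR_inclL, mapR_inclR, sliceL_mul, sliceL_mul, map_smul]
  | ha a b ha hb => simp only [map_add, ha, hb]

theorem sliceR_mapR (η : FS pβ →ₗ[ℂ] ℂ) (g : α → FS pβ)
    (hg : ∀ a, g a ∈ pt (B := FS pβ) (pα a)) (F : FS (Sum.elim pκ pα)) :
    sliceR η (mapR pκ g hg F) = sliceR (η ∘ₗ (subst g hg).toLinearMap) F := by
  induction F using induction_sorted with
  | hm f g => rw [map_mul, mapR_inclL, mapR_inclR, sliceR_mul, sliceR_mul]; rfl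
  | ha a b ha hb => simp only [map_add, ha, hb]

end FS

end Slices

/-! ### The coefficient of the product of all parameters. -/

section Fock

variable {N : ℕ} (p : Fin N → ZMod 2)

/-- The sign of the creation of `a` in the state `s`. -/
def fockSign (a : Fin N) (s : Finset (Fin N)) : ℂ := ∏ b ∈ s with b < a, sgn (p a) (p b)

/-- The creation operators on the Fock space. -/
def fockCreate (a : Fin N) : Module.End ℂ (Finset (Fin N) → ℂ) where
  toFun v s := if a ∈ s then fockSign p a s * v (s.erase a) else 0
  map_add' v w := by
    ext s
    simp only [Pi.add_apply]
    split_ifs <;> ring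
  map_smul' c v := by
    ext s
    simp only [Pi.smul_apply, smul_eq_mul, RingHom.id_apply]
    split_ifs <;> ring

theorem fockCreate_apply (a : Fin N) (v : Finset (Fin N) → ℂ) (s : Finset (Fin N)) :
    fockCreate p a v s = if a ∈ s then fockSign p a s * v (s.erase a) else 0 := rfl

theorem fockSign_erase_of_lt {a b : Fin N} (h : a < b) (s : Finset (Fin N)) :
    fockSign p a (s.erase b) = fockSign p a s := by
  refine Finset.prod_congr (Finset.ext fun c => ?_) fun _ _ => rfl
  simp only [Finset.mem_filter, Finset.mem_erase]
  constructor
  · rintro ⟨⟨_, h1⟩, h2⟩; exact ⟨h1, h2⟩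
  · rintro ⟨h1, h2⟩; exact ⟨⟨(h2.trans h).ne, h1⟩, h2⟩

theorem fockSign_eq_of_lt {a b : Fin N} (h : a < b) {s : Finset (Fin N)} (ha : a ∈ s) :
    fockSign p b s = sgn (p b) (p a) * fockSign p b (s.erase a) := by
  unfold fockSign
  rw [Finset.filter_erase, Finset.mul_prod_erase _ (fun c => sgn (p b) (p c))
    (Finset.mem_filter.2 ⟨ha, h⟩)]

/-- The sign of creating `b` sees the smaller `a`, while that of creating `a` does not see `b`. Even
generators also square to zero here, so parameters of both parities are treated alike. -/
theorem fockCreate_comm_of_lt {a b : Fin N} (h : a < b) :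
    fockCreate p b * fockCreate p a = sgn (p b) (p a) • (fockCreate p a * fockCreate p b) := by
  refine LinearMap.ext fun v => funext fun s => ?_
  simp only [Module.End.mul_apply, LinearMap.smul_apply, Pi.smul_apply, fockCreate_apply,
    Finset.mem_erase, smul_eq_mul]
  by_cases ha : a ∈ s
  · by_cases hb : b ∈ s
    · simp only [ha, hb, h.ne, h.ne', ne_eq, not_false_eq_true, and_self, if_true]
      rw [fockSign_erase_of_lt p h, fockSign_eq_of_lt p h ha, Finset.erase_right_comm]
      ring
    · simp [hb]
  · simp [ha]

/-- The action of a free supercommutative algebra on the Fock space. -/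
def fock : FS p →ₐ[ℂ] Module.End ℂ (Finset (Fin N) → ℂ) :=
  FS.lift (fockCreate p) (by
    intro a b
    rcases lt_trichotomy a b with h | rfl | h
    · rw [fockCreate_comm_of_lt p h, smul_smul, sgn_comm, sgn_mul_self, one_smul]
    · have h0 : fockCreate p a * fockCreate p a = 0 := by
        refine LinearMap.ext fun v => funext fun s => ?_
        simp [fockCreate_apply]
      rw [h0, smul_zero]
    · exact fockCreate_comm_of_lt p h)

/-- The coefficient of the product of all the generators, each taken once. -/
def topCoeff : FS p →ₗ[ℂ] ℂ :=
  LinearMap.proj Finset.univ ∘ₗ LinearMap.applyₗ (Pi.single ∅ 1) ∘ₗ (fock p).toLinearMap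

/-- Starting from the empty state, a word reaches only the set of its letters, and a repeated letter
kills it. -/
theorem fock_word_ne_zero {l : List (Fin N)} {s : Finset (Fin N)}
    (h : fock p (l.map (FS.X p)).prod (Pi.single ∅ 1) s ≠ 0) : l.Nodup ∧ l.toFinset = s := by
  induction l generalizing s with
  | nil =>
    simp only [List.map_nil, List.prod_nil, map_one, Module.End.one_apply] at h
    refine ⟨List.nodup_nil, ?_⟩
    by_contra h1
    exact h (Pi.single_eq_of_ne (Ne.symm h1) _)
  | cons a l ih =>
    rw [List.map_cons, List.prod_cons, map_mul, Module.End.mul_apply, fock, FS.lift_X,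
      fockCreate_apply] at h
    split_ifs at h with ha
    · obtain ⟨h1, h2⟩ := ih (right_ne_zero_of_mul h)
      refine ⟨List.nodup_cons.2 ⟨fun h3 => ?_, h1⟩, ?_⟩
      · rw [← List.mem_toFinset, h2] at h3
        exact Finset.notMem_erase _ _ h3
      · rw [List.toFinset_cons, h2, Finset.insert_erase ha]
    · exact absurd rfl h

theorem perm_finRange_of_topCoeff_ne_zero {l : List (Fin N)}
    (h : topCoeff p (l.map (FS.X p)).prod ≠ 0) : l.Perm (List.finRange N) := by
  obtain ⟨h1, h2⟩ := fock_word_ne_zero p h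
  refine (List.perm_ext_iff_of_nodup h1 (List.nodup_finRange N)).2 fun a => ?_
  rw [← List.mem_toFinset, h2]
  simp

/-- Each letter is created below all those present, so every sign is an empty product. -/
theorem fock_word_of_sorted {l : List (Fin N)} (h : l.Pairwise (· < ·)) :
    fock p (l.map (FS.X p)).prod (Pi.single ∅ 1) l.toFinset = 1 := by
  induction l with
  | nil => simp
  | cons a l ih =>
    obtain ⟨h1, h2⟩ := List.pairwise_cons.1 h
    have ha : a ∉ l.toFinset := fun h3 => lt_irrefl _ (h1 a (List.mem_toFinset.1 h3))
    rw [List.map_cons, List.prod_cons, map_mul, Module.End.mul_apply, fock, FS.lift_X,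
      fockCreate_apply, List.toFinset_cons, if_pos (Finset.mem_insert_self _ _),
      Finset.erase_insert ha]
    have h3 : fockSign p a (insert a l.toFinset) = 1 := by
      unfold fockSign
      rw [Finset.filter_eq_empty_iff.2, Finset.prod_empty]
      intro b hb
      rcases Finset.mem_insert.1 hb with rfl | hb
      · exact lt_irrefl _
      · exact (h1 b (List.mem_toFinset.1 hb)).not_gt
    rw [h3, one_mul]
    exact ih h2

theorem topCoeff_finRange : topCoeff p ((List.finRange N).map (FS.X p)).prod = 1 := by
  have h := fock_word_of_sorted p (List.pairwise_lt_finRange N)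
  rwa [List.toFinset_finRange] at h

end Fock

/-! ### Semiprimeness of the complex group algebra. -/

section GroupAction

variable {G : Type*} [Group G] [Fintype G]

open scoped ComplexOrder in
-- For a = ∑ ξ(π)π the hypothesis says a ℂ[G] a = 0. The function `A` consists of the coefficients
-- of a*a. As a a* a = 0, the coefficient of (a*a)*(a*a) at 1, which is ∑ |A|², vanishes; so A = 0,
-- and A(1) = ∑ |ξ|² gives ξ = 0.
theorem eq_zero_of_sum_mul_eq_zero (ξ : G → ℂ)
    (h : ∀ σ τ, ∑ π, ξ π * ξ (σ * π⁻¹ * τ) = 0) : ξ = 0 := by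
  set A : G → ℂ := fun ω => ∑ σ, star (ξ σ) * ξ (σ * ω) with hA
  have h1 : ∑ ω, star (A ω) * A ω = 0 := by
    calc ∑ ω, star (A ω) * A ω
        = ∑ ω, ∑ π, ∑ σ, ξ π * star (ξ (π * ω)) * (star (ξ σ) * ξ (σ * ω)) := by
          refine Finset.sum_congr rfl fun ω _ => ?_
          rw [hA, star_sum, Finset.sum_mul_sum]
          refine Finset.sum_congr rfl fun π _ => Finset.sum_congr rfl fun σ _ => ?_
          rw [star_mul', star_star]
      _ = ∑ π, ∑ ω, ∑ σ, ξ π * star (ξ (π * ω)) * (star (ξ σ) * ξ (σ * ω)) := Finset.sum_comm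
      _ = ∑ π, ∑ τ, ∑ σ, ξ π * star (ξ τ) * (star (ξ σ) * ξ (σ * π⁻¹ * τ)) := by
          refine Finset.sum_congr rfl fun π _ => ?_
          refine Fintype.sum_equiv (Equiv.mulLeft π) _ _ fun ω => ?_
          simp [mul_assoc]
      _ = ∑ τ, ∑ π, ∑ σ, ξ π * star (ξ τ) * (star (ξ σ) * ξ (σ * π⁻¹ * τ)) := Finset.sum_comm
      _ = ∑ τ, ∑ σ, ∑ π, ξ π * star (ξ τ) * (star (ξ σ) * ξ (σ * π⁻¹ * τ)) :=
          Finset.sum_congr rfl fun _ _ => Finset.sum_comm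
      _ = ∑ τ, ∑ σ, star (ξ τ) * star (ξ σ) * ∑ π, ξ π * ξ (σ * π⁻¹ * τ) := by
          refine Finset.sum_congr rfl fun τ _ => Finset.sum_congr rfl fun σ _ => ?_
          rw [Finset.mul_sum]
          exact Finset.sum_congr rfl fun π _ => by ring
      _ = 0 := by simp [h]
  have key : ∀ v : G → ℂ, ∑ ω, star (v ω) * v ω = 0 → v = 0 := fun v hv =>
    dotProduct_star_self_eq_zero.1 (by simpa [dotProduct, mul_comm] using hv)
  have h2 := congrFun (key A h1) 1
  refine key ξ ?_
  simpa [hA] using h2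

/-- A functional vanishes on a vector if the associated twisted average annihilates its orbit. -/
theorem functional_eq_zero {M : Type*} [AddCommGroup M] [Module ℂ M]
    (A : G →* Module.End ℂ M) (η : M →ₗ[ℂ] ℂ) (f : M)
    (h : ∀ τ, ∑ π, η (A π f) • A π⁻¹ (A τ f) = 0) : η f = 0 := by
  -- Applying η ∘ A σ to the hypothesis produces the relation a σ⁻¹ a = 0 for a = ∑ η(A π f)π.
  have h1 := eq_zero_of_sum_mul_eq_zero (fun π => η (A π f)) fun σ τ => by
    have h2 := congrArg (fun m => η (A σ m)) (h τ)
    simp only [map_sum, map_smul, map_zero, smul_eq_mul] at h2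
    rw [← h2]
    refine Finset.sum_congr rfl fun π _ => ?_
    rw [map_mul, map_mul, Module.End.mul_apply, Module.End.mul_apply]
  have h3 := congrFun h1 1
  simpa using h3

end GroupAction

/-! ### Words in x with coefficients in y. -/

section Words

theorem list_prod_sum {B : Type*} [Ring B] [Algebra ℂ B] {M : ℕ} {T : Type*} [Fintype T]
    (g : Fin M → T → B) : ((List.finRange M).map fun b => ∑ t, g b t).prod =
      ∑ a : Fin M → T, ((List.finRange M).map fun b => g b (a b)).prod := by
  classical
  have h := (MultilinearMap.mkPiAlgebraFin ℂ M B).map_sum g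
  simpa only [MultilinearMap.mkPiAlgebraFin_apply, List.ofFn_eq_map] using h

theorem unzipSign_zero {κ : Type*} (q : κ → ZMod 2) (l : List κ) :
    unzipSign (l.map fun k => ((0 : ZMod 2), q k)) = 1 := by
  induction l with
  | nil => rfl
  | cons k l ih =>
    simp only [List.map_cons, unzipSign, ih, List.map_map, Function.comp_def]
    simp

theorem map_finRange_perm {N : ℕ} (σ : Equiv.Perm (Fin N)) :
    ((List.finRange N).map σ).Perm (List.finRange N) :=
  (List.perm_ext_iff_of_nodup ((List.nodup_finRange N).map σ.injective)
    (List.nodup_finRange N)).2 fun a => by simpa using ⟨σ.symm a, by simp⟩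

theorem sum_eq_sum_perm {N : ℕ} {M : Type*} [AddCommMonoid M] (F : (Fin N → Fin N) → M)
    (h : ∀ a, ¬Function.Bijective a → F a = 0) : ∑ a, F a = ∑ σ : Equiv.Perm (Fin N), F σ := by
  refine (Fintype.sum_of_injective (fun σ : Equiv.Perm (Fin N) => (σ : Fin N → Fin N))
    DFunLike.coe_injective _ _ (fun a ha => h a fun hb => ha ?_) fun _ => rfl).symm
  exact ⟨Equiv.ofBijective a hb, rfl⟩

theorem bijective_of_perm {N : ℕ} {a : Fin N → Fin N}
    (h : ((List.finRange N).map a).Perm (List.finRange N)) : Function.Bijective a := by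
  rw [← Finite.injective_iff_bijective]
  have h1 := h.nodup_iff.2 (List.nodup_finRange N)
  intro b c hbc
  exact List.inj_on_of_nodup_map h1 (List.mem_finRange b) (List.mem_finRange c) hbc

variable {ρ I S : Type*} {pρ : ρ → ZMod 2} {pI : I → ZMod 2} {pS : S → ZMod 2}

variable (pρ pI pS) in
/-- The product of the generators `x_{a b, j b}`. -/
def xWord {M : ℕ} (a : Fin M → ρ) (j : Fin M → I) : MatAlg pρ pI pS :=
  ((List.finRange M).map fun b => genU pρ pI pS (a b) (j b)).prod

theorem map_xWord {B : Type*} [Ring B] [Algebra ℂ B] (φ : MatAlg pρ pI pS →ₐ[ℂ] B) {M : ℕ}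
    (a : Fin M → ρ) (j : Fin M → I) : φ (xWord pρ pI pS a j) =
      ((List.finRange M).map fun b => φ (genU pρ pI pS (a b) (j b))).prod := by
  rw [xWord, map_list_prod, List.map_map]
  rfl

variable (pI pS) in
/-- The polynomials in the generators `y_{is}`. -/
def yIncl (pρ : ρ → ZMod 2) : FS (fun a : I × S => pI a.1 + pS a.2) →ₐ[ℂ] MatAlg pρ pI pS :=
  FS.inclR _ _

/-- The substitution of the entries of a matrix for the generators. -/
def substMatrix {B : Type*} [Ring B] [Algebra ℂ B] [SCAlg B] (Y : Matrix I S B)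
    (hY : IsEvenMatrix pI pS Y) : FS (fun a : I × S => pI a.1 + pS a.2) →ₐ[ℂ] B :=
  FS.subst (fun a => Y a.1 a.2) (fun a => hY a.1 a.2)

@[simp] theorem substMatrix_X {B : Type*} [Ring B] [Algebra ℂ B] [SCAlg B] {Y : Matrix I S B}
    (hY : IsEvenMatrix pI pS Y) (a : I × S) : substMatrix Y hY (FS.X _ a) = Y a.1 a.2 :=
  FS.subst_X _ _ _

theorem yIncl_X {pρ : ρ → ZMod 2} (a : I × S) :
    yIncl pI pS pρ (FS.X _ a) = genW pρ pI pS a.1 a.2 := FS.inclR_X _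

theorem map_yIncl {pρ : ρ → ZMod 2} {B : Type*} [Ring B] [Algebra ℂ B] [SCAlg B]
    {X : Matrix ρ I B} {Y : Matrix I S B} (hX : IsEvenMatrix pρ pI X)
    (hY : IsEvenMatrix pI pS Y) (h : FS (fun a : I × S => pI a.1 + pS a.2)) :
    ev X Y hX hY (yIncl pI pS pρ h) = substMatrix Y hY h := by
  have e : (ev X Y hX hY).comp (yIncl pI pS pρ) = substMatrix Y hY :=
    FS.hom_ext fun k => by rw [AlgHom.comp_apply, substMatrix_X, yIncl_X, ev_genW]
  exact DFunLike.congr_fun e h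

theorem substMatrix_genW {pρ : ρ → ZMod 2} :
    substMatrix (genW pρ pI pS) (genW_even pρ pI pS) = yIncl pI pS pρ := rfl

theorem IsEvenMatrix.map_inclR {κ α : Type*} {pκ : κ → ZMod 2} {pα : α → ZMod 2}
    {M : Matrix I S (FS pα)} (hM : IsEvenMatrix pI pS M) :
    IsEvenMatrix pI pS (M.map (FS.inclR pκ pα)) := fun i s => FS.inclR_mem (hM i s)

theorem substMatrix_map_inclR {κ α : Type*} {pκ : κ → ZMod 2} {pα : α → ZMod 2}
    {M : Matrix I S (FS pα)} (hM : IsEvenMatrix pI pS M)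
    (h : FS (fun a : I × S => pI a.1 + pS a.2)) :
    substMatrix (M.map (FS.inclR pκ pα)) hM.map_inclR h = FS.inclR pκ pα (substMatrix M hM h) := by
  have e : substMatrix (M.map (FS.inclR pκ pα)) hM.map_inclR =
      (FS.inclR pκ pα).comp (substMatrix M hM) :=
    FS.hom_ext fun k => by rw [AlgHom.comp_apply, substMatrix_X, substMatrix_X, Matrix.map_apply]
  exact DFunLike.congr_fun e h

theorem mem_span_xWord_mul (f : MatAlg pρ pI pS) :
    f ∈ Submodule.span ℂ {m | ∃ (M : ℕ) (a : Fin M → ρ) (j : Fin M → I)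
      (h : FS (fun a : I × S => pI a.1 + pS a.2)),
        xWord pρ pI pS a j * yIncl pI pS pρ h = m} := by
  refine Submodule.span_mono ?_ (FS.mem_span_sorted f)
  rintro _ ⟨⟨l, l'⟩, rfl⟩
  refine ⟨l.length, fun b => (l.get b).1, fun b => (l.get b).2, _, congrArg (· * _) ?_⟩
  rw [xWord, map_list_prod, List.map_map]
  have h : l = (List.finRange l.length).map l.get := (List.map_get_finRange l).symm
  conv_rhs => rw [h]
  rw [List.map_map]
  congr 2
  funext b
  simp [genU]

variable (pρ pI pS) in
/-- The homomorphism that sends the generators to the scalar products `∑ i, x_{ri} y_{is}`. -/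
def pairHom [Fintype I] : FS (fun a : ρ × S => pρ a.1 + pS a.2) →ₐ[ℂ] MatAlg pρ pI pS :=
  substMatrix (genU pρ pI pS * genW pρ pI pS) ((genU_even pρ pI pS).mul (genW_even pρ pI pS))

end Words

/-! ### The symmetric group acting on the rows, and multilinear elements. -/

section Permutations

variable {I S : Type*} (pI : I → ZMod 2) (pS : S → ZMod 2)

/-- The parities of an even space. -/
abbrev evenParity (N : ℕ) : Fin N → ZMod 2 := fun _ => 0

theorem submatrix_genU_even {N : ℕ} (σ : Equiv.Perm (Fin N)) :
    IsEvenMatrix (evenParity N) pI ((genU (evenParity N) pI pS).submatrix σ id) :=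
  fun t i => genU_even _ _ _ (σ t) i

/-- The permutation of the rows of the matrix `x`. -/
def permAct {N : ℕ} (σ : Equiv.Perm (Fin N)) :
    MatAlg (evenParity N) pI pS →ₐ[ℂ] MatAlg (evenParity N) pI pS :=
  ev ((genU (evenParity N) pI pS).submatrix σ id) (genW _ _ _) (submatrix_genU_even pI pS σ)
    (genW_even _ _ _)

variable {pI pS} {N : ℕ}

theorem permAct_xWord (σ : Equiv.Perm (Fin N)) {M : ℕ} (a : Fin M → Fin N) (j : Fin M → I) :
    permAct pI pS σ (xWord _ _ _ a j) = xWord _ _ _ (σ ∘ a) j := by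
  rw [map_xWord, xWord]
  congr 2
  funext b
  exact ev_genU _ _ _ _

theorem permAct_yIncl (σ : Equiv.Perm (Fin N)) (h : FS (fun a : I × S => pI a.1 + pS a.2)) :
    permAct pI pS σ (yIncl pI pS (evenParity N) h) = yIncl pI pS (evenParity N) h := by
  rw [permAct, map_yIncl, substMatrix_genW]

theorem permAct_mul (σ τ : Equiv.Perm (Fin N)) (f : MatAlg (evenParity N) pI pS) :
    permAct pI pS (σ * τ) f = permAct pI pS σ (permAct pI pS τ f) := by
  have h : permAct pI pS (σ * τ) = (permAct pI pS σ).comp (permAct pI pS τ) :=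
    matAlg_hom_ext (fun t i => by simp [permAct]) (fun i s => by simp [permAct])
  exact DFunLike.congr_fun h f

theorem permAct_one (f : MatAlg (evenParity N) pI pS) : permAct pI pS 1 f = f := by
  have h : permAct pI pS 1 = AlgHom.id ℂ (MatAlg (evenParity N) pI pS) :=
    matAlg_hom_ext (fun t i => by simp [permAct]) (fun i s => by simp [permAct])
  exact DFunLike.congr_fun h f

variable (pI pS N) in
/-- The representation of the symmetric group by permutations of the rows. -/
def permRep : Equiv.Perm (Fin N) →* Module.End ℂ (MatAlg (evenParity N) pI pS) where
  toFun σ := (permAct pI pS σ).toLinearMap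
  map_one' := LinearMap.ext permAct_one
  map_mul' σ τ := LinearMap.ext (permAct_mul σ τ)

variable (pI pS N) in
/-- The elements that are multilinear in the rows of `x`. -/
def multSpan : Submodule ℂ (MatAlg (evenParity N) pI pS) :=
  Submodule.span ℂ {m | ∃ (j : Fin N → I) (h : FS (fun a : I × S => pI a.1 + pS a.2)),
    xWord _ _ _ id j * yIncl pI pS (evenParity N) h = m}

/-- Sorting the factors by row index changes the word by a sign only. -/
theorem xWord_perm_mem (σ : Equiv.Perm (Fin N)) (j : Fin N → I)
    (h : FS (fun a : I × S => pI a.1 + pS a.2)) :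
    xWord _ _ _ σ j * yIncl pI pS (evenParity N) h ∈ multSpan pI pS N := by
  have h1 := (map_finRange_perm σ).map fun c => (c, j (σ⁻¹ c))
  obtain ⟨c, -, hc⟩ := exists_prod_perm (fun a : Fin N × I => (0 : ZMod 2) + pI a.2)
    (fun a => genU (evenParity N) pI pS a.1 a.2) (fun a => genU_even _ _ _ a.1 a.2) h1
  have h2 : xWord (evenParity N) pI pS σ j = c • xWord _ _ _ id (j ∘ ⇑σ⁻¹) := by
    rw [List.map_map, List.map_map, List.map_map] at hc
    refine Eq.trans ?_ hc
    rw [xWord]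
    congr 2
    funext b
    simp
  rw [h2, smul_mul_assoc]
  exact Submodule.smul_mem _ _ (Submodule.subset_span ⟨_, h, rfl⟩)

theorem permRep_mem (σ : Equiv.Perm (Fin N)) {f : MatAlg (evenParity N) pI pS}
    (hf : f ∈ multSpan pI pS N) : permRep pI pS N σ f ∈ multSpan pI pS N := by
  induction hf using Submodule.span_induction with
  | mem x hx =>
    obtain ⟨j, h, rfl⟩ := hx
    change permAct pI pS σ _ ∈ _
    rw [map_mul, permAct_xWord, permAct_yIncl]
    exact xWord_perm_mem σ j h
  | zero => simp
  | add x y _ _ h1 h2 => rw [map_add]; exact Submodule.add_mem _ h1 h2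
  | smul r x _ h => rw [map_smul]; exact Submodule.smul_mem _ _ h

end Permutations

/-! ### Balanced multilinear elements. -/

section Contraction

open FS

variable {I S : Type} [Fintype I] [DecidableEq I] (pI : I → ZMod 2) (pS : S → ZMod 2) {N : ℕ}
  (d : Fin N → I)

/-- The parities of the generators `x_{ti}` of multilinear elements. -/
abbrev rowParity (N : ℕ) : Fin N × I → ZMod 2 := fun a => evenParity N a.1 + pI a.2

/-- The parities of the auxiliary generators. -/
abbrev auxParity : Fin N ⊕ (Fin N × I) → ZMod 2 :=
  Sum.elim (fun t => pI (d t)) (rowParity pI N)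

/-- The matrix of auxiliary generators. -/
def auxX {α : Type} (pα : α → ZMod 2) : Matrix (Fin N) I (FS (Sum.elim (auxParity pI d) pα)) :=
  fun a i => X _ (Sum.inl (Sum.inr (a, i)))

theorem auxX_even {α : Type} (pα : α → ZMod 2) :
    IsEvenMatrix (evenParity N) pI (auxX pI d pα) := fun a i => X_mem (Sum.inl (Sum.inr (a, i)))

/-- The matrix with the rows `∑ θ_t g_t`, where the sum is over the `t` with `d t = i`. -/
def auxZ {J : Type} {α : Type} (pα : α → ZMod 2) (g : Matrix (Fin N) J (FS pα)) :
    Matrix I J (FS (Sum.elim (auxParity pI d) pα)) :=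
  fun i j => ∑ t, if i = d t then
    sgn (pI (d t)) (pI (d t)) • (X _ (Sum.inl (Sum.inl t)) * inclR _ _ (g t j)) else 0

theorem auxZ_even {J : Type} {pJ : J → ZMod 2} {α : Type} {pα : α → ZMod 2}
    {g : Matrix (Fin N) J (FS pα)} (hg : IsEvenMatrix (evenParity N) pJ g) :
    IsEvenMatrix pI pJ (auxZ pI d pα g) := by
  intro i j
  refine Submodule.sum_mem _ fun t _ => ?_
  split_ifs with h
  · subst h
    refine Submodule.smul_mem _ _ ?_
    have h1 := mul_mem (X_mem (par := Sum.elim (auxParity pI d) pα) (Sum.inl (Sum.inl t)))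
      (inclR_mem (pκ := auxParity pI d) (hg t j))
    rwa [zero_add] at h1
  · exact Submodule.zero_mem _

/-- Right multiplication acts on each summand θ_t g_t separately. With g = x and h = y, the product
involves x only through xy. -/
theorem auxZ_mul {J K : Type} [Fintype J] {α : Type} (pα : α → ZMod 2)
    (g : Matrix (Fin N) J (FS pα)) (h : Matrix J K (FS pα)) :
    auxZ pI d pα g * (h.map (inclR (auxParity pI d) pα) : Matrix J K _) = auxZ pI d pα (g * h) := by
  ext i k
  simp only [Matrix.mul_apply, auxZ, Finset.sum_mul, Matrix.map_apply]
  rw [Finset.sum_comm]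
  refine Finset.sum_congr rfl fun t _ => ?_
  split_ifs with hi
  · rw [map_sum, Finset.mul_sum, Finset.smul_sum]
    refine Finset.sum_congr rfl fun j _ => ?_
    rw [smul_mul_assoc, map_mul, mul_assoc]
  · simp

/-- The even elements `θ_t x_{b, d t}`. -/
def auxE (b t : Fin N) : FS (auxParity pI d) :=
  X _ (Sum.inl t) * X _ (Sum.inr (b, d t))

theorem auxE_even (b t : Fin N) : auxE pI d b t ∈ pt (B := FS (auxParity pI d)) 0 := by
  have h := mul_mem (X_mem (par := auxParity pI d) (Sum.inl t)) (X_mem (Sum.inr (b, d t)))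
  have h0 : pI (d t) + (0 + pI (d t)) = 0 := by rw [zero_add, zmod_two_add_self]
  exact h0 ▸ h

/-- The sign in `auxZ` compensates for moving θ_t to the left of x_{b, d t}, whose parity is the
same. -/
theorem auxX_mul_auxZ {J : Type} {α : Type} (pα : α → ZMod 2)
    (g : Matrix (Fin N) J (FS pα)) (b : Fin N) (j : J) :
    (auxX pI d pα * auxZ pI d pα g) b j = ∑ t, inclL _ _ (auxE pI d b t) * inclR _ _ (g t j) := by
  simp only [Matrix.mul_apply, auxZ, Finset.mul_sum]
  rw [Finset.sum_comm]
  refine Finset.sum_congr rfl fun t _ => ?_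
  rw [Finset.sum_eq_single (d t) (fun i _ hi => by rw [if_neg hi, mul_zero]) (by simp), if_pos rfl,
    auxX, mul_smul_comm, ← mul_assoc, X_mul_X, smul_mul_assoc, smul_smul, auxE, map_mul, inclL_X,
    inclL_X]
  simp

/-- The contraction of `f(x z, y)` with the functional `η` and the top coefficient. -/
def contract (η : MatAlg (evenParity N) pI pS →ₗ[ℂ] ℂ) :
    MatAlg (evenParity N) pI pS →ₗ[ℂ] FS (rowParity pI N) :=
  sliceL (topCoeff fun t => pI (d t)) ∘ₗ sliceR η ∘ₗ
    (ev (auxX pI d _ * auxZ pI d _ (genU (evenParity N) pI pS))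
      ((genW (evenParity N) pI pS).map (inclR (auxParity pI d) (genParity (evenParity N) pI pS)))
      ((auxX_even pI d _).mul (auxZ_even pI d (genU_even _ _ _)))
      (genW_even _ _ _).map_inclR).toLinearMap

/-- Balance moves z onto y. The value is then obtained from free variables by substituting the
entries of xy, and η composed with this substitution is zero. -/
theorem contract_eq_zero {η : MatAlg (evenParity N) pI pS →ₗ[ℂ] ℂ}
    (hη : ∀ h, η (pairHom _ pI pS h) = 0) {f : MatAlg (evenParity N) pI pS} (hf : IsBalanced f) :
    contract pI pS d η f = 0 := by
  have hW : IsEvenMatrix (evenParity N) pS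
      (Matrix.of fun t s => X (fun a : Fin N × S => evenParity N a.1 + pS a.2) (t, s)) :=
    fun t s => X_mem (t, s)
  have h1 := hf _ _ (auxX pI d _) ((genW (evenParity N) pI pS).map (inclR (auxParity pI d)
    (genParity (evenParity N) pI pS)))
    (auxZ pI d _ (genU (evenParity N) pI pS)) (auxX_even pI d _)
    (genW_even (evenParity N) pI pS).map_inclR (auxZ_even pI d (genU_even _ _ _))
  have h2 := ev_map (mapR (auxParity pI d)
      (fun a => (genU (evenParity N) pI pS * genW (evenParity N) pI pS) a.1 a.2)
      (fun a => ((genU_even _ pI pS).mul (genW_even _ pI pS)) a.1 a.2))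
    (auxX_even pI d _) (auxZ_even pI d hW) (auxX_even pI d _)
    ((auxZ_even pI d (genU_even (evenParity N) pI pS)).mul
      (genW_even (evenParity N) pI pS).map_inclR)
    (Matrix.ext fun a i => mapR_inl _ _ _) (by
      rw [auxZ_mul]
      ext i s
      simp only [Matrix.map_apply, auxZ, map_sum]
      refine Finset.sum_congr rfl fun t _ => ?_
      split_ifs
      · rw [map_smul, map_mul, mapR_inl, mapR_inclR, Matrix.of_apply, subst_X]
      · exact map_zero _) f
  change sliceL _ (sliceR η (ev _ _ _ _ f)) = 0
  rw [h1, ← h2, sliceR_mapR]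
  have h3 : η ∘ₗ (subst (fun a : Fin N × S =>
      (genU (evenParity N) pI pS * genW (evenParity N) pI pS) a.1 a.2)
      (fun a => ((genU_even _ pI pS).mul (genW_even _ pI pS)) a.1 a.2)).toLinearMap = 0 :=
    LinearMap.ext hη
  rw [h3]
  simp [sliceR]

theorem prod_auxE_mul {M : ℕ} (a b : Fin M → Fin N) (j : Fin M → I) :
    ((List.finRange M).map fun c => inclL (auxParity pI d) _ (auxE pI d (b c) (a c)) *
      inclR _ _ (genU (evenParity N) pI pS (a c) (j c))).prod =
    inclL _ _ ((List.finRange M).map fun c => auxE pI d (b c) (a c)).prod *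
      inclR _ _ (xWord (evenParity N) pI pS a j) := by
  have h := prod_mul_eq (B := FS (Sum.elim (auxParity pI d) (genParity (evenParity N) pI pS)))
    (fun _ => 0) (fun c => 0 + pI (j c))
    (fun c => inclL (auxParity pI d) (genParity (evenParity N) pI pS) (auxE pI d (b c) (a c)))
    (fun c => inclR (auxParity pI d) _ (genU (evenParity N) pI pS (a c) (j c)))
    (fun c => inclL_mem (auxE_even pI d (b c) (a c)))
    (fun c => inclR_mem (genU_even (evenParity N) pI pS (a c) (j c))) (List.finRange M)
  rw [h, unzipSign_zero, one_smul, xWord, map_list_prod, map_list_prod, List.map_map, List.map_map]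
  rfl

theorem prod_auxE {M : ℕ} (a b : Fin M → Fin N) :
    ((List.finRange M).map fun c => auxE pI d (b c) (a c)).prod =
      unzipSign ((List.finRange M).map fun c => (pI (d (a c)), 0 + pI (d (a c)))) •
        (inclL _ _ (((List.finRange M).map a).map (X _)).prod *
          inclR _ _ ((List.finRange M).map fun c => X (rowParity pI N) (b c, d (a c))).prod) := by
  have h := prod_mul_eq (B := FS (auxParity pI d)) (fun c => pI (d (a c)))
    (fun c => 0 + pI (d (a c)))
    (fun c => X (auxParity pI d) (Sum.inl (a c))) (fun c => X (auxParity pI d) (Sum.inr (b c,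
      d (a c))))
    (fun c => X_mem (par := auxParity pI d) (Sum.inl (a c)))
    (fun c => X_mem (par := auxParity pI d) (Sum.inr (b c, d (a c)))) (List.finRange M)
  rw [map_list_prod, map_list_prod, List.map_map, List.map_map, List.map_map]
  simp only [Function.comp_def, inclL_X, inclR_X]
  exact h

/-- The factors are even, so they may be listed in the order of the θ_t. The sign of separating θ
from x and the top coefficient then do not depend on σ. -/
theorem prod_auxE_perm (σ : Equiv.Perm (Fin N)) :
    ((List.finRange N).map fun c => auxE pI d c (σ c)).prod =
      ((List.finRange N).map fun c => auxE pI d (σ⁻¹ c) c).prod := by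
  have h : ((List.finRange N).map fun c => auxE pI d c (σ c)).Perm
      ((List.finRange N).map fun c => auxE pI d (σ⁻¹ c) c) := by
    have h1 := (map_finRange_perm σ).map fun c => auxE pI d (σ⁻¹ c) c
    rw [List.map_map] at h1
    simpa [Function.comp_def] using h1
  refine h.prod_eq' (List.Pairwise.map _ (fun b c _ => ?_) (List.pairwise_lt_finRange N))
  exact even_comm (auxE_even pI d _ _) (auxE_even pI d _ _)

/-- In the expansion each row c chooses an index a(c). The coefficient of θ_1⋯θ_N keeps only the
bijective choices, and η is then applied to the word with rows permuted accordingly. -/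
theorem contract_xWord_mul (η : MatAlg (evenParity N) pI pS →ₗ[ℂ] ℂ) (j : Fin N → I)
    (h : FS (fun a : I × S => pI a.1 + pS a.2)) :
    contract pI pS d η (xWord _ _ _ id j * yIncl pI pS _ h) =
      unzipSign ((List.finRange N).map fun c => (pI (d c), 0 + pI (d c))) •
        ∑ σ : Equiv.Perm (Fin N), η (permAct pI pS σ (xWord _ _ _ id j * yIncl pI pS _ h)) •
          ((List.finRange N).map fun c => X (rowParity pI N) (σ⁻¹ c, d c)).prod := by
  change sliceL _ (sliceR η (ev _ _ _ _ _)) = _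
  rw [map_mul, map_yIncl, substMatrix_map_inclR (genW_even (evenParity N) pI pS), substMatrix_genW,
    map_xWord]
  simp only [ev_genU, auxX_mul_auxZ, id]
  rw [list_prod_sum, Finset.sum_mul, map_sum, map_sum]
  have key : ∀ a : Fin N → Fin N, sliceL (topCoeff fun t => pI (d t)) (sliceR η
      (((List.finRange N).map fun c => inclL (auxParity pI d) _ (auxE pI d c (a c)) *
        inclR _ _ (genU (evenParity N) pI pS (a c) (j c))).prod *
          inclR _ _ (yIncl pI pS (evenParity N) h))) =
      η (xWord _ _ _ a j * yIncl pI pS _ h) • sliceL (topCoeff fun t => pI (d t))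
        ((List.finRange N).map fun c => auxE pI d c (a c)).prod := fun a => by
    rw [prod_auxE_mul pI pS d a (fun c => c) j, mul_assoc, ← map_mul, sliceR_mul, map_smul]
  rw [sum_eq_sum_perm, Finset.smul_sum]
  · refine Finset.sum_congr rfl fun σ _ => ?_
    rw [key, map_mul (permAct pI pS σ), permAct_xWord, permAct_yIncl, prod_auxE_perm, smul_comm]
    congr 1
    have h2 := prod_auxE pI d id fun c => σ⁻¹ c
    simp only [id] at h2
    rw [h2, map_smul, sliceL_mul]
    have h3 := topCoeff_finRange fun t => pI (d t)
    rw [List.map_id, h3, one_smul]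
  · intro a ha
    rw [key, prod_auxE pI d a (fun c => c), map_smul, sliceL_mul]
    have h4 : topCoeff (fun t => pI (d t)) (((List.finRange N).map a).map (X _)).prod = 0 := by
      by_contra h5
      exact ha (bijective_of_perm (perm_finRange_of_topCoeff_ne_zero _ h5))
    rw [h4, zero_smul, smul_zero, smul_zero]

theorem contract_apply (η : MatAlg (evenParity N) pI pS →ₗ[ℂ] ℂ) {f : MatAlg (evenParity N) pI pS}
    (hf : f ∈ multSpan pI pS N) :
    contract pI pS d η f =
      unzipSign ((List.finRange N).map fun c => (pI (d c), 0 + pI (d c))) •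
        ∑ σ : Equiv.Perm (Fin N), η (permAct pI pS σ f) •
          ((List.finRange N).map fun c => X (rowParity pI N) (σ⁻¹ c, d c)).prod := by
  induction hf using Submodule.span_induction with
  | mem x hx =>
    obtain ⟨j, h, rfl⟩ := hx
    exact contract_xWord_mul pI pS d η j h
  | zero => simp
  | add x y _ _ h1 h2 =>
    simp only [map_add, h1, h2, add_smul, Finset.sum_add_distrib, smul_add]
  | smul r x _ h =>
    simp only [map_smul, h, smul_assoc, ← Finset.smul_sum]
    rw [smul_comm]

/-- Balanced multilinear elements are polynomials in the scalar products. -/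
theorem mem_range_of_mem_multSpan {f : MatAlg (evenParity N) pI pS} (hf : f ∈ multSpan pI pS N)
    (hb : IsBalanced f) : f ∈ (pairHom (evenParity N) pI pS).range := by
  by_contra hn
  -- The functional kills every polynomial in the scalar products but not `f`.
  obtain ⟨η, h1, h2⟩ := Submodule.exists_le_ker_of_notMem
    (p := (pairHom (evenParity N) pI pS).range.toSubmodule) hn
  refine h1 (functional_eq_zero (permRep pI pS N) η f fun τ => ?_)
  have hs : ∀ d : Fin N → I, ∑ σ : Equiv.Perm (Fin N), η (permAct pI pS σ f) •
      xWord (evenParity N) pI pS (fun c => σ⁻¹ c) d = 0 := fun d => by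
    have h3 := contract_eq_zero pI pS d (fun h => h2 ⟨h, rfl⟩) hb
    rw [contract_apply pI pS d η hf] at h3
    have h4 := (smul_eq_zero.1 h3).resolve_left (unzipSign_ne_zero _)
    have h5 := congrArg (inclL (rowParity pI N) (fun a : I × S => pI a.1 + pS a.2)) h4
    rw [map_sum, map_zero] at h5
    rw [← h5]
    refine Finset.sum_congr rfl fun σ _ => ?_
    rw [map_smul, map_list_prod, List.map_map, xWord]
    congr 3
    funext c
    simp [genU]
  -- The relation holds for every multilinear g: the identities `hs` for all `d`, multiplied by
  -- polynomials in y, cover the spanning set.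
  generalize hg : permRep pI pS N τ f = g
  have hm : g ∈ multSpan pI pS N := hg ▸ permRep_mem τ hf
  clear hg
  induction hm using Submodule.span_induction with
  | mem x hx =>
    obtain ⟨d, h, rfl⟩ := hx
    have h6 := congrArg (· * yIncl pI pS (evenParity N) h) (hs d)
    simp only [Finset.sum_mul, zero_mul, smul_mul_assoc] at h6
    rw [← h6]
    refine Finset.sum_congr rfl fun σ _ => ?_
    congr 1
    change permAct pI pS σ⁻¹ _ = _
    rw [map_mul, permAct_xWord, permAct_yIncl]
    rfl
  | zero => simp
  | add x y _ _ h1 h2 => simp only [map_add, smul_add, Finset.sum_add_distrib, h1, h2, add_zero]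
  | smul r x _ h =>
    simp only [map_smul, smul_comm _ r, ← Finset.smul_sum, h, smul_zero]

end Contraction

open FS

theorem prod_ite_eq {B : Type*} [Ring B] {M : ℕ} (P : Fin M → Prop) [DecidablePred P]
    (g : Fin M → B) : ((List.finRange M).map fun b => if P b then g b else 0).prod =
      if ∀ b, P b then ((List.finRange M).map g).prod else 0 := by
  split_ifs with h
  · simp [h]
  · push Not at h
    obtain ⟨b, hb⟩ := h
    exact List.prod_eq_zero (List.mem_map.2 ⟨b, List.mem_finRange b, if_neg hb⟩)

/-- The top coefficient of a permuted word is a reordering sign; the square removes it. -/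
theorem topCoeff_perm_mul_self {N : ℕ} (p : Fin N → ZMod 2) (σ : Equiv.Perm (Fin N)) :
    topCoeff p (((List.finRange N).map σ).map (X p)).prod *
      topCoeff p (((List.finRange N).map σ).map (X p)).prod = 1 := by
  obtain ⟨c, hc, h⟩ := exists_prod_perm p (X p) X_mem (map_finRange_perm σ)
  rw [h, map_smul, topCoeff_finRange, smul_eq_mul, mul_one, hc]

theorem topCoeff_eq_zero {N M : ℕ} (p : Fin N → ZMod 2) {a : Fin M → Fin N} (h : M ≠ N) :
    topCoeff p (((List.finRange M).map a).map (X p)).prod = 0 := by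
  by_contra h1
  have h2 := (perm_finRange_of_topCoeff_ne_zero p h1).length_eq
  simp at h2
  exact h h2

theorem topCoeff_eq_zero_of_not_bijective {N : ℕ} (p : Fin N → ZMod 2) {a : Fin N → Fin N}
    (h : ¬Function.Bijective a) :
    topCoeff p (((List.finRange N).map a).map (X p)).prod = 0 := by
  by_contra h1
  exact h (bijective_of_perm (perm_finRange_of_topCoeff_ne_zero p h1))

theorem prod_X_mul_inclR {α : Type*} {pα : α → ZMod 2} {N M : ℕ} (p : Fin N → ZMod 2)
    (a : Fin M → Fin N) (q : Fin M → ZMod 2) (g : Fin M → FS pα)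
    (hg : ∀ b, g b ∈ pt (B := FS pα) (q b)) :
    ((List.finRange M).map fun b => X (Sum.elim p pα) (Sum.inl (a b)) * inclR p pα (g b)).prod =
      unzipSign ((List.finRange M).map fun b => (p (a b), q b)) •
        (inclL p pα (((List.finRange M).map a).map (X p)).prod *
          inclR p pα ((List.finRange M).map g).prod) := by
  have h := prod_mul_eq (B := FS (Sum.elim p pα)) (fun b => p (a b)) q
    (fun b => X (Sum.elim p pα) (Sum.inl (a b))) (fun b => inclR p pα (g b))
    (fun b => X_mem (par := Sum.elim p pα) (Sum.inl (a b))) (fun b => inclR_mem (hg b))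
    (List.finRange M)
  rw [h, map_list_prod, map_list_prod, List.map_map, List.map_map, List.map_map]
  simp only [Function.comp_def, inclL_X]

/-! ### Polarization, restitution and reduction to multilinear elements. -/

section Polarization

variable {ρ I S : Type} [DecidableEq ρ] [Fintype I] [DecidableEq I] (pρ : ρ → ZMod 2)
  (pI : I → ZMod 2) (pS : S → ZMod 2) {N : ℕ} (r : Fin N → ρ)

/-- The matrix with the rows `∑ τ_a g_a`, where the sum is over the `a` with `r a = s`. -/
def polMatrix {J : Type} {β : Type} (pβ : β → ZMod 2) (g : Matrix (Fin N) J (FS pβ)) :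
    Matrix ρ J (FS (Sum.elim (fun a => pρ (r a)) pβ)) :=
  Matrix.of fun s j => ∑ a, if r a = s then X _ (Sum.inl a) * inclR _ _ (g a j) else 0

variable {pI} in
theorem polMatrix_even {β : Type} {pβ : β → ZMod 2} {g : Matrix (Fin N) I (FS pβ)}
    (hg : IsEvenMatrix (evenParity N) pI g) : IsEvenMatrix pρ pI (polMatrix pρ r pβ g) := by
  intro s i
  rw [polMatrix, Matrix.of_apply]
  refine Submodule.sum_mem _ fun a _ => ?_
  split_ifs with h
  · subst h
    have h1 := mul_mem (X_mem (par := Sum.elim (fun a => pρ (r a)) pβ) (Sum.inl a))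
      (inclR_mem (pκ := fun a => pρ (r a)) (hg a i))
    rwa [zero_add] at h1
  · exact Submodule.zero_mem _

theorem polMatrix_mul {J K : Type} [Fintype J] {β : Type} (pβ : β → ZMod 2)
    (g : Matrix (Fin N) J (FS pβ)) (h : Matrix J K (FS pβ)) :
    polMatrix pρ r pβ g * (h.map (inclR (fun a => pρ (r a)) pβ) : Matrix J K _) =
      polMatrix pρ r pβ (g * h) := by
  ext s k
  simp only [Matrix.mul_apply, polMatrix, Finset.sum_mul, Matrix.map_apply, Matrix.of_apply]
  rw [Finset.sum_comm]
  refine Finset.sum_congr rfl fun t _ => ?_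
  split_ifs with hi
  · rw [map_sum, Finset.mul_sum]
    refine Finset.sum_congr rfl fun j _ => ?_
    rw [map_mul, mul_assoc]
  · simp

/-- The polarization of an element. -/
def polarize : MatAlg pρ pI pS →ₗ[ℂ] MatAlg (evenParity N) pI pS :=
  sliceL (topCoeff fun a => pρ (r a)) ∘ₗ
    (ev (polMatrix pρ r _ (genU (evenParity N) pI pS))
      ((genW (evenParity N) pI pS).map (inclR (fun a => pρ (r a)) _))
      (polMatrix_even pρ r (genU_even _ _ _)) (genW_even (evenParity N) pI
        pS).map_inclR).toLinearMap

variable {pI pS} in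
-- Taking the coefficient of τ_1⋯τ_N commutes with substituting for x and y. This carries
-- polarization to the points over every free supercommutative algebra, where balance is tested.
theorem ev_polarize {β : Type} {pβ : β → ZMod 2} {X : Matrix (Fin N) I (FS pβ)}
    {Y : Matrix I S (FS pβ)} (hX : IsEvenMatrix (evenParity N) pI X) (hY : IsEvenMatrix pI pS Y)
    (f : MatAlg pρ pI pS) : ev X Y hX hY (polarize pρ pI pS r f) =
      sliceL (topCoeff fun a => pρ (r a))
        (ev (polMatrix pρ r pβ X) (Y.map (inclR (fun a => pρ (r a)) pβ))
          (polMatrix_even pρ r hX) hY.map_inclR f) := by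
  have hg : ∀ k, Sum.elim (fun a : Fin N × I => X a.1 a.2) (fun a : I × S => Y a.1 a.2) k ∈
      pt (B := FS pβ) (genParity (evenParity N) pI pS k) := by
    rintro (a | a)
    · exact hX _ _
    · exact hY _ _
  have h1 := ev_map (mapR (fun a => pρ (r a)) _ hg) (polMatrix_even pρ r (genU_even _ pI pS))
    ((genW_even (evenParity N) pI pS).map_inclR (pκ := fun a => pρ (r a)))
    (polMatrix_even pρ r hX) hY.map_inclR (by
      ext s i
      simp only [Matrix.map_apply, polMatrix, Matrix.of_apply, map_sum]
      refine Finset.sum_congr rfl fun a _ => ?_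
      split_ifs
      · rw [map_mul, mapR_inl, mapR_inclR, genU, subst_X]
        rfl
      · exact map_zero _) (by
      ext i s
      simp only [Matrix.map_apply]
      rw [mapR_inclR, genW, subst_X]
      rfl) f
  rw [← h1, sliceL_mapR]
  rfl

variable {pρ pI pS} in
-- Polarization combines rows with coefficients on the left, which commutes with right
-- multiplication by z.
theorem IsBalanced.polarize {f : MatAlg pρ pI pS} (hf : IsBalanced f) :
    IsBalanced (polarize pρ pI pS r f) := by
  intro β pβ X Y z hX hY hz
  have h := hf _ _ _ _ _ (polMatrix_even pρ r hX) (hY.map_inclR (pκ := fun a => pρ (r a)))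
    (hz.map_inclR (pκ := fun a => pρ (r a)))
  rw [ev_polarize, ev_polarize]
  refine congrArg _ (Eq.trans ?_ (h.trans ?_))
  · exact ev_congr _ _ (polMatrix_mul pρ r pβ X z).symm rfl f
  · exact ev_congr _ _ rfl (Matrix.map_mul (f := inclR (fun a => pρ (r a)) pβ)).symm f

/-- The function a records which summand τ_a x_a each factor contributes; it must satisfy r ∘ a = s.
-/
theorem polarize_xWord_mul {M : ℕ} (s : Fin M → ρ) (j : Fin M → I)
    (h : FS (fun a : I × S => pI a.1 + pS a.2)) :
    polarize pρ pI pS r (xWord _ _ _ s j * yIncl pI pS _ h) =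
      ∑ a : Fin M → Fin N, if ∀ b, r (a b) = s b then
        (unzipSign ((List.finRange M).map fun b => (pρ (s b), pI (j b))) *
          topCoeff (fun a => pρ (r a)) (((List.finRange M).map a).map (X _)).prod) •
            (xWord _ _ _ a j * yIncl pI pS _ h) else 0 := by
  change sliceL _ (ev _ _ _ _ _) = _
  rw [map_mul, map_yIncl, substMatrix_map_inclR (genW_even (evenParity N) pI pS),
    substMatrix_genW, map_xWord]
  simp only [ev_genU, polMatrix, Matrix.of_apply]
  rw [list_prod_sum, Finset.sum_mul, map_sum]
  refine Finset.sum_congr rfl fun a _ => ?_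
  rw [prod_ite_eq]
  split_ifs with ha
  · have h1 := prod_X_mul_inclR (fun a => pρ (r a)) a (fun b => 0 + pI (j b))
      (fun b => genU (evenParity N) pI pS (a b) (j b))
      (fun b => genU_even (evenParity N) pI pS (a b) (j b))
    rw [h1, smul_mul_assoc, mul_assoc, ← map_mul, map_smul, sliceL_mul, smul_smul]
    simp only [ha, zero_add]
    rfl
  · rw [zero_mul, map_zero]

theorem polarize_mem (f : MatAlg pρ pI pS) : polarize pρ pI pS r f ∈ multSpan pI pS N := by
  induction mem_span_xWord_mul f using Submodule.span_induction with
  | mem x hx =>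
    obtain ⟨M, s, j, h, rfl⟩ := hx
    rw [polarize_xWord_mul]
    refine Submodule.sum_mem _ fun a _ => ?_
    split_ifs
    · by_cases hM : M = N
      · subst hM
        by_cases ha : Function.Bijective a
        · exact Submodule.smul_mem _ _ (xWord_perm_mem (Equiv.ofBijective a ha) j h)
        · rw [topCoeff_eq_zero_of_not_bijective _ ha, mul_zero, zero_smul]
          exact Submodule.zero_mem _
      · rw [topCoeff_eq_zero _ hM, mul_zero, zero_smul]
        exact Submodule.zero_mem _
    · exact Submodule.zero_mem _
  | zero => simp
  | add x y _ _ h1 h2 => rw [map_add]; exact Submodule.add_mem _ h1 h2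
  | smul r x _ h => rw [map_smul]; exact Submodule.smul_mem _ _ h

/-- The matrix with the rows `τ_a g_{r a}`. -/
def resMatrix {J : Type} {β : Type} (pβ : β → ZMod 2) (g : Matrix ρ J (FS pβ)) :
    Matrix (Fin N) J (FS (Sum.elim (fun a => pρ (r a)) pβ)) :=
  Matrix.of fun a j => X _ (Sum.inl a) * inclR _ _ (g (r a) j)

theorem resMatrix_apply {J : Type} {β : Type} (pβ : β → ZMod 2) (g : Matrix ρ J (FS pβ))
    (a : Fin N) (j : J) :
    resMatrix pρ r pβ g a j = X _ (Sum.inl a) * inclR _ _ (g (r a) j) := rfl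

variable {pρ} in
theorem resMatrix_even {J : Type} {pJ : J → ZMod 2} {β : Type} {pβ : β → ZMod 2}
    {g : Matrix ρ J (FS pβ)} (hg : IsEvenMatrix pρ pJ g) :
    IsEvenMatrix (evenParity N) pJ (resMatrix pρ r pβ g) := by
  intro a j
  have h1 := mul_mem (X_mem (par := Sum.elim (fun a => pρ (r a)) pβ) (Sum.inl a))
      (inclR_mem (pκ := fun a => pρ (r a)) (hg (r a) j))
  have h2 : pρ (r a) + (pρ (r a) + pJ j) = 0 + pJ j := by
    rw [← add_assoc, zmod_two_add_self]
  exact h2 ▸ h1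

/-- The restitution of an element. -/
def restitute : MatAlg (evenParity N) pI pS →ₗ[ℂ] MatAlg pρ pI pS :=
  sliceL (topCoeff fun a => pρ (r a)) ∘ₗ
    (ev (resMatrix pρ r _ (genU pρ pI pS))
      ((genW pρ pI pS).map (inclR (fun a => pρ (r a)) _))
      (resMatrix_even r (genU_even _ _ _)) (genW_even pρ pI pS).map_inclR).toLinearMap

theorem restitute_xWord_mul {M : ℕ} (a : Fin M → Fin N) (j : Fin M → I)
    (h : FS (fun a : I × S => pI a.1 + pS a.2)) :
    restitute pρ pI pS r (xWord _ _ _ a j * yIncl pI pS _ h) =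
      (unzipSign ((List.finRange M).map fun b => (pρ (r (a b)), pρ (r (a b)) + pI (j b))) *
        topCoeff (fun a => pρ (r a)) (((List.finRange M).map a).map (X _)).prod) •
          (xWord _ _ _ (fun b => r (a b)) j * yIncl pI pS _ h) := by
  change sliceL _ (ev _ _ _ _ _) = _
  rw [map_mul, map_yIncl, substMatrix_map_inclR (genW_even pρ pI pS),
    substMatrix_genW, map_xWord]
  simp only [ev_genU, resMatrix, Matrix.of_apply]
  have h1 := prod_X_mul_inclR (fun a => pρ (r a)) a (fun b => pρ (r (a b)) + pI (j b))
    (fun b => genU pρ pI pS (r (a b)) (j b))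
    (fun b => genU_even pρ pI pS (r (a b)) (j b))
  rw [h1, smul_mul_assoc, mul_assoc, ← map_mul, map_smul, sliceL_mul, smul_smul]
  rfl

/-- Restitution replaces the product (xy)_{as} by τ_a (xy)_{r a, s}. It can therefore be carried out
in free variables, before the entries of xy are substituted. -/
theorem restitute_mem {f : MatAlg (evenParity N) pI pS}
    (hf : f ∈ (pairHom (evenParity N) pI pS).range) :
    restitute pρ pI pS r f ∈ (pairHom pρ pI pS).range := by
  obtain ⟨h, rfl⟩ := hf
  have hV : IsEvenMatrix pρ pS
      (Matrix.of fun t s => X (fun a : ρ × S => pρ a.1 + pS a.2) (t, s)) := fun t s => X_mem (t, s)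
  have hg := fun a : ρ × S => ((genU_even pρ pI pS).mul (genW_even pρ pI pS)) a.1 a.2
  have e : (ev (resMatrix pρ r _ (genU pρ pI pS))
      ((genW pρ pI pS).map (inclR (fun a => pρ (r a)) _))
      (resMatrix_even r (genU_even _ _ _)) (genW_even pρ pI pS).map_inclR).comp
        (pairHom (evenParity N) pI pS) =
      (mapR (fun a => pρ (r a)) _ hg).comp (substMatrix _ (resMatrix_even r hV)) := by
    refine hom_ext fun k => ?_
    rw [AlgHom.comp_apply, AlgHom.comp_apply, pairHom, substMatrix_X, substMatrix_X,
      resMatrix_apply, map_mul, mapR_inl, mapR_inclR, Matrix.of_apply, subst_X, Matrix.mul_apply,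
      Matrix.mul_apply, map_sum, map_sum, Finset.mul_sum]
    refine Finset.sum_congr rfl fun i _ => ?_
    rw [map_mul, map_mul, ev_genU, ev_genW, resMatrix_apply, Matrix.map_apply, mul_assoc]
  refine ⟨sliceL (topCoeff fun a => pρ (r a)) (substMatrix _ (resMatrix_even r hV) h), ?_⟩
  have h1 := sliceL_mapR (topCoeff fun a => pρ (r a)) _ hg (substMatrix _ (resMatrix_even r hV) h)
  refine h1.symm.trans (congrArg _ ?_)
  exact (DFunLike.congr_fun e h).symm

/-- The sign that relates the polarization and the restitution. -/
def polSign {M : ℕ} (s : Fin M → ρ) : ℂ :=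
  unzipSign (((List.finRange M).map fun b => pρ (s b)).map fun a => (a, a))

theorem polSign_eq {M : ℕ} (s : Fin M → ρ) : polSign pρ s =
    unzipSign ((List.finRange M).map fun b => (pρ (s b), pρ (s b))) := by
  rw [polSign, List.map_map]
  rfl

theorem polSign_ne_zero {M : ℕ} (s : Fin M → ρ) : polSign pρ s ≠ 0 := unzipSign_ne_zero _

theorem polSign_comp (σ : Equiv.Perm (Fin N)) : polSign pρ (fun b => r (σ b)) = polSign pρ r := by
  refine unzipSign_perm ?_
  have h := (map_finRange_perm σ).map fun b => pρ (r b)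
  rwa [List.map_map] at h

/-- Every admissible choice of indices restores the original word. The reordering sign enters twice,
and `unzipSign_mul` merges the two separation signs into one that is independent of `j`. -/
theorem restitute_polarize {M : ℕ} (s : Fin M → ρ) (j : Fin M → I)
    (h : FS (fun a : I × S => pI a.1 + pS a.2)) :
    restitute pρ pI pS r (polarize pρ pI pS r (xWord _ _ _ s j * yIncl pI pS _ h)) =
      ∑ a : Fin M → Fin N, if ∀ b, r (a b) = s b then
        (polSign pρ s *
          (topCoeff (fun a => pρ (r a)) (((List.finRange M).map a).map (X _)).prod *
          topCoeff (fun a => pρ (r a)) (((List.finRange M).map a).map (X _)).prod)) •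
            (xWord _ _ _ s j * yIncl pI pS _ h) else 0 := by
  rw [polarize_xWord_mul, map_sum]
  refine Finset.sum_congr rfl fun a _ => ?_
  split_ifs with ha
  · rw [map_smul, restitute_xWord_mul, smul_smul]
    simp only [ha]
    have h1 := unzipSign_mul (fun b => pρ (s b)) (fun b => pI (j b)) (List.finRange M)
    rw [polSign_eq, ← h1]
    congr 1
    ring
  · exact map_zero _

variable [Fintype ρ]

variable (N) in
/-- The projection, up to a factor, to the part of degree `N` in `x`. -/
def degreePart : MatAlg pρ pI pS →ₗ[ℂ] MatAlg pρ pI pS :=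
  ((N.factorial : ℂ)⁻¹) • ∑ r : Fin N → ρ,
    (polSign pρ r)⁻¹ • (restitute pρ pI pS r ∘ₗ polarize pρ pI pS r)

theorem degreePart_apply (f : MatAlg pρ pI pS) : degreePart pρ pI pS N f =
    ((N.factorial : ℂ)⁻¹) • ∑ r : Fin N → ρ,
      (polSign pρ r)⁻¹ • restitute pρ pI pS r (polarize pρ pI pS r f) := by
  simp [degreePart]

theorem degreePart_of_ne {M : ℕ} (hM : M ≠ N) (s : Fin M → ρ) (j : Fin M → I)
    (h : FS (fun a : I × S => pI a.1 + pS a.2)) :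
    degreePart pρ pI pS N (xWord _ _ _ s j * yIncl pI pS _ h) = 0 := by
  rw [degreePart_apply, Finset.sum_eq_zero, smul_zero]
  intro r _
  rw [restitute_polarize, Finset.sum_eq_zero, smul_zero]
  intro a _
  rw [topCoeff_eq_zero _ hM]
  simp

/-- Each permutation σ contributes for exactly one r, namely s ∘ σ⁻¹, and by `polSign_comp` the sign
of r equals that of s. The N! equal contributions are cancelled by the factor 1/N!. -/
theorem degreePart_self (s : Fin N → ρ) (j : Fin N → I)
    (h : FS (fun a : I × S => pI a.1 + pS a.2)) :
    degreePart pρ pI pS N (xWord _ _ _ s j * yIncl pI pS _ h) =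
      xWord _ _ _ s j * yIncl pI pS _ h := by
  set m := xWord pρ pI pS s j * yIncl pI pS _ h with hm
  have h1 : ∀ r : Fin N → ρ, (polSign pρ r)⁻¹ • restitute pρ pI pS r (polarize pρ pI pS r m) =
      ∑ σ : Equiv.Perm (Fin N), if r = fun b => s (σ⁻¹ b) then m else 0 := by
    intro r
    rw [hm, restitute_polarize, sum_eq_sum_perm, Finset.smul_sum]
    · refine Finset.sum_congr rfl fun σ _ => ?_
      have h2 : (∀ b, r (σ b) = s b) ↔ r = fun b => s (σ⁻¹ b) := by
        constructor
        · intro hb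
          funext b
          simp [← hb]
        · rintro rfl b
          simp
      rw [if_congr h2 rfl rfl]
      split_ifs with h3
      · have h4 := polSign_comp pρ r σ
        rw [funext (h2.2 h3)] at h4
        rw [h4, topCoeff_perm_mul_self, mul_one, smul_smul, inv_mul_cancel₀ (polSign_ne_zero pρ r),
          one_smul]
      · rw [smul_zero]
    · intro a ha
      rw [topCoeff_eq_zero_of_not_bijective _ ha]
      simp
  rw [degreePart_apply, Finset.sum_congr rfl fun r _ => h1 r, Finset.sum_comm]
  simp only [Finset.sum_ite_eq', Finset.mem_univ, if_true, Finset.sum_const, Finset.card_univ,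
    Fintype.card_perm, Fintype.card_fin]
  rw [← Nat.cast_smul_eq_nsmul ℂ, smul_smul,
    inv_mul_cancel₀ (Nat.cast_ne_zero.2 N.factorial_ne_zero), one_smul]

/-- A given element has bounded degree in x. Asking for all larger bounds lets the bounds of two
summands be merged. -/
theorem exists_sum_degreePart (f : MatAlg pρ pI pS) :
    ∃ K, ∀ K', K ≤ K' → ∑ N ∈ Finset.range K', degreePart pρ pI pS N f = f := by
  induction mem_span_xWord_mul f using Submodule.span_induction with
  | mem x hx =>
    obtain ⟨M, s, j, h, rfl⟩ := hx
    refine ⟨M + 1, fun K hK => ?_⟩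
    rw [Finset.sum_eq_single M]
    · exact degreePart_self pρ pI pS s j h
    · exact fun N _ hN => degreePart_of_ne pρ pI pS hN.symm s j h
    · exact fun hn => absurd (Finset.mem_range.2 hK) hn
  | zero => exact ⟨0, fun K _ => by simp⟩
  | add x y _ _ h1 h2 =>
    obtain ⟨K1, h1⟩ := h1
    obtain ⟨K2, h2⟩ := h2
    refine ⟨max K1 K2, fun K hK => ?_⟩
    simp only [map_add, Finset.sum_add_distrib]
    rw [h1 K ((le_max_left _ _).trans hK), h2 K ((le_max_right _ _).trans hK)]
  | smul r x _ h =>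
    obtain ⟨K1, h1⟩ := h
    refine ⟨K1, fun K hK => ?_⟩
    simp only [map_smul, ← Finset.smul_sum]
    rw [h1 K hK]

variable {pρ pI pS} in
/-- Balanced elements are polynomials in the scalar products. -/
theorem IsBalanced.mem_range {f : MatAlg pρ pI pS} (hf : IsBalanced f) :
    f ∈ (pairHom pρ pI pS).range := by
  obtain ⟨K, hK⟩ := exists_sum_degreePart pρ pI pS f
  rw [← hK K le_rfl]
  refine Subalgebra.sum_mem _ fun N _ => ?_
  rw [degreePart_apply]
  refine Subalgebra.smul_mem _ (Subalgebra.sum_mem _ fun r _ => Subalgebra.smul_mem _ ?_ _) _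
  exact restitute_mem pρ pI pS r
    (mem_range_of_mem_multSpan pI pS (polarize_mem pρ pI pS r f) (hf.polarize r))

end Polarization

/-! ### Return to the original algebra. -/

section MainTheorem

variable {k l n m p q : ℕ} {U V W : Type*}
    [AddCommGroup U] [Module ℂ U] [Superspace U]
    [AddCommGroup V] [Module ℂ V] [Superspace V]
    [AddCommGroup W] [Module ℂ W] [Superspace W]

theorem IsStandardFormat.isHomogeneous {e : Module.Basis (Fin n ⊕ Fin m) ℂ V}
    (he : IsStandardFormat e) : IsHomogeneous e (Sum.elim (fun _ => 0) fun _ => 1) := by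
  rintro (i | i)
  · exact he.1 i
  · exact he.2 i

theorem ofModel_pairHom_mem (u : Module.Basis (Fin k ⊕ Fin l) ℂ U) (hu : IsStandardFormat u)
    (e : Module.Basis (Fin n ⊕ Fin m) ℂ V) (he : IsStandardFormat e)
    (w : Module.Basis (Fin p ⊕ Fin q) ℂ W) (hw : IsStandardFormat w)
    (h : FS fun a : (Fin k ⊕ Fin l) × (Fin p ⊕ Fin q) =>
      (Sum.elim (fun _ => 0) fun _ => 1 : Fin k ⊕ Fin l → ZMod 2) a.1 +
        (Sum.elim (fun _ => 0) fun _ => 1 : Fin p ⊕ Fin q → ZMod 2) a.2) :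
    ofModel hu.isHomogeneous he.isHomogeneous hw.isHomogeneous (pairHom _ _ _ h) ∈
      Algebra.adjoin ℂ (Set.range fun rs : (Fin k ⊕ Fin l) × (Fin p ⊕ Fin q) =>
        scalarProduct u e w rs.1 rs.2) := by
  induction h using FS.induction with
  | h0 r =>
    rw [AlgHom.commutes, AlgHom.commutes]
    exact Subalgebra.algebraMap_mem _ r
  | h1 a =>
    refine Algebra.subset_adjoin ⟨a, ?_⟩
    rw [pairHom, substMatrix_X, Matrix.mul_apply, map_sum]
    refine Finset.sum_congr rfl fun i _ => ?_
    rw [map_mul, ofModel_genU, ofModel_genW]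
    rfl
  | hm a b ha hb => rw [map_mul, map_mul]; exact Subalgebra.mul_mem _ ha hb
  | ha a b ha hb => rw [map_add, map_add]; exact Subalgebra.add_mem _ ha hb

end MainTheorem

end SuperFFT

end

theorem theorem2p1 {k l n m p q : ℕ} {U V W : Type*}
    [AddCommGroup U] [Module ℂ U] [SuperFFT.Superspace U]
    [AddCommGroup V] [Module ℂ V] [SuperFFT.Superspace V]
    [AddCommGroup W] [Module ℂ W] [SuperFFT.Superspace W]
    (u : Module.Basis (Fin k ⊕ Fin l) ℂ U) (hu : SuperFFT.IsStandardFormat u)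
    (e : Module.Basis (Fin n ⊕ Fin m) ℂ V) (he : SuperFFT.IsStandardFormat e)
    (w : Module.Basis (Fin p ⊕ Fin q) ℂ W) (hw : SuperFFT.IsStandardFormat w) :
    SuperFFT.invariants U V W =
      Algebra.adjoin ℂ (Set.range fun rs : (Fin k ⊕ Fin l) × (Fin p ⊕ Fin q) =>
        SuperFFT.scalarProduct u e w rs.1 rs.2) := by
  refine le_antisymm (fun f hf => ?_) (Algebra.adjoin_le ?_)
  -- An invariant is balanced, hence a polynomial in the entries of xy, and `ofModel` sends these
  -- entries to the scalar products.
  · obtain ⟨h, hh⟩ := (SuperFFT.isBalanced_of_mem_invariants hu.isHomogeneous he.isHomogeneous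
      hw.isHomogeneous hf).mem_range
    rw [← SuperFFT.ofModel_toModel hu.isHomogeneous he.isHomogeneous hw.isHomogeneous f, ← hh]
    exact SuperFFT.ofModel_pairHom_mem u hu e he w hw h
  · rintro _ ⟨a, rfl⟩
    exact SuperFFT.sum_mul_mem_invariants hu.isHomogeneous he.isHomogeneous a.1 (w a.2)
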